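/- Let $K$ be a commutative ring, $A$ and $B$ associative unital $K$-algebras that are projective as $K$-modules, and $M_1,\dots,M_n$ ($n\ge 0$) $A\otimes_K B^o$-modules that are projective over $K$. Let $m_1,\dots,m_n\ge 1$ be integers, $M=\bigoplus_{i=1}^n M_i^{m_i}$ and $M'=\bigoplus_{i=1}^n M_i$. For an $A\otimes_K B^o$-module $N$ let $T_N=\left[\begin{smallmatrix}A&N\\0&B\end{smallmatrix}\right]$ be the triangular matrix algebra, and let $HH^*T=H^*(T,T)$ be the cohomology of the Hochschild complex of the $K$-algebra $T$ (in degree $k$: the $K$-multilinear maps $T^k\to T$). Choose for each $i$ one of the $m_i$ copies of $M_i$ in $M$. This makes $M'$ a direct summand of $M$, with inclusion $\iota:M'\to M$ and projection $\pi:M\to M'$; write also $\iota:T_{M'}\to T_M$ and $\pi:T_M\to T_{M'}$ for the induced algebra morphisms. Let $r^*:HH^*T_M\to HH^*T_{M'}$ be the map induced by $f\mapsto \pi\circ f\circ(\iota\times\cdots\times\iota)$ on cochains. Let $l_M^{*}:Ext^{*-1}_{A\otimes B^o}(M,M)\to HH^{*}T_M$ be the canonical map of the long exact sequence $\cdots\to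 Ext^{*-1}_{A\otimes B^o}(M,M)\to HH^*T_M\to HH^*A\times HH^*B\to\cdots$: it sends $x\in Ext^{k}_{A\otimes B^o}(M,M)$ to the image in $HH^{k+1}T_M$, under the bimodule inclusion $M\subset T_M$, of the Yoneda product in $H^{k+1}(T_M,M)$ of $x$ with the class in $H^1(T_M,M)$ of the derivation $T_M\to M$ that takes a matrix to its upper right entry. Finally, $Ext^{*-1}_{A\otimes B^o}(M,M)$ is the product of the modules $Ext^{*-1}_{A\otimes B^o}(M_i,M_j)$ over all $i,j$ and all pairs (copy of $M_i$ in $M$, copy of $M_j$ in $M$); omitting for all $i,j$ the pair of chosen copies, one obtains a submodule $\prod_{i,j}Ext^{*-1}_{A\otimes B^o}(M_i,M_j)^{m_im_j-1}$, and $l^*$ denotes the restriction of $l_M^*$ to it. Then the sequence of graded $K$-modules $$0\longrightarrow\prod_{i,j}Ext^{*-1}_{A\otimes B^o}(M_i,M_j)^{m_im_j-1}\xrightarrow{\ l^*\ }HH^*T_M\xrightarrow{\ r^*\ }HH^*T_{M'}\longrightarrow0$$ is exact and split in every degree (with $Ext^{-1}=0$, so that $r^0$ is an isomorphism). -/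

import Mathlib

open CategoryTheory CategoryTheory.Abelian TensorProduct

universe u

set_option linter.unusedSectionVars false

namespace Hochschild

section Cochains

variable (K : Type*) [CommRing K] (T : Type*) [Ring T] [Algebra K T]
variable (N : Type*) [AddCommGroup N] [Module K N] [Module T N] [Module Tᵐᵒᵖ N]
  [IsScalarTower K T N] [IsScalarTower K Tᵐᵒᵖ N]

/-- Hochschild `n`-cochains of the `K`-algebra `T` with coefficients in the bimodule `N`:
the `K`-multilinear maps `T × ⋯ × T → N` (`n` factors), i.e. the bimodule maps from the `n`-th
term `T ⊗ T^{⊗ n} ⊗ T` of the bar complex to `N`. -/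
abbrev Cochain (n : ℕ) : Type _ := MultilinearMap K (fun _ : Fin n => T) N

variable {T}

theorem contractNth_update {n : ℕ} (j : Fin n) (g : Fin (n + 1) → T) (i : Fin (n + 1)) :
    ∃ (k : Fin n) (l : T →ₗ[K] T), ∀ x : T,
      Fin.contractNth j.castSucc (· * ·) (Function.update g i x) =
        Function.update (Fin.contractNth j.castSucc (· * ·) g) k (l x) := by
  rcases lt_trichotomy (i : ℕ) (j : ℕ) with h | h | h
  · refine ⟨⟨i, by omega⟩, LinearMap.id, fun x => ?_⟩
    ext k
    simp only [Fin.contractNth, Function.update_apply, Fin.ext_iff, Fin.val_castSucc,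
      Fin.val_succ, LinearMap.id_apply]
    grind
  · refine ⟨j, LinearMap.mulRight K (g j.succ), fun x => ?_⟩
    ext k
    simp only [Fin.contractNth, Function.update_apply, Fin.ext_iff, Fin.val_castSucc,
      Fin.val_succ, LinearMap.mulRight_apply]
    grind
  · by_cases h' : (i : ℕ) = j + 1
    · refine ⟨j, LinearMap.mulLeft K (g j.castSucc), fun x => ?_⟩
      ext k
      simp only [Fin.contractNth, Function.update_apply, Fin.ext_iff, Fin.val_castSucc,
        Fin.val_succ, LinearMap.mulLeft_apply]
      grind
    · refine ⟨⟨i - 1, by omega⟩, LinearMap.id, fun x => ?_⟩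
      ext k
      simp only [Fin.contractNth, Function.update_apply, Fin.ext_iff, Fin.val_castSucc,
        Fin.val_succ, LinearMap.id_apply]
      grind


variable {K N}

/-- `(t₀, …, tₙ) ↦ t₀ f(t₁, …, tₙ)`. -/
def firstFace {n : ℕ} (f : Cochain K T N n) : Cochain K T N (n + 1) where
  toFun g := g 0 • f (Fin.tail g)
  map_update_add' := by
    intro inst g i x y
    obtain rfl := Subsingleton.elim inst (instDecidableEqFin (n + 1))
    refine Fin.cases ?_ (fun i => ?_) i
    · simp [add_smul]
    · simp [Function.update_of_ne (Fin.succ_ne_zero i).symm]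
  map_update_smul' := by
    intro inst g i k x
    obtain rfl := Subsingleton.elim inst (instDecidableEqFin (n + 1))
    refine Fin.cases ?_ (fun i => ?_) i
    · simp
    · simp [Function.update_of_ne (Fin.succ_ne_zero i).symm, smul_comm k]

/-- `(t₀, …, tₙ) ↦ f(t₀, …, tⱼ tⱼ₊₁, …, tₙ)`. -/
def innerFace {n : ℕ} (j : Fin n) (f : Cochain K T N n) : Cochain K T N (n + 1) where
  toFun g := f (Fin.contractNth j.castSucc (· * ·) g)
  map_update_add' := by
    intro inst g i x y
    obtain rfl := Subsingleton.elim inst (instDecidableEqFin (n + 1))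
    obtain ⟨k, l, h⟩ := contractNth_update K j g i
    simp [h]
  map_update_smul' := by
    intro inst g i a x
    obtain rfl := Subsingleton.elim inst (instDecidableEqFin (n + 1))
    obtain ⟨k, l, h⟩ := contractNth_update K j g i
    simp [h]

/-- `(t₀, …, tₙ) ↦ f(t₀, …, tₙ₋₁) tₙ`. -/
def lastFace {n : ℕ} (f : Cochain K T N n) : Cochain K T N (n + 1) where
  toFun g := MulOpposite.op (g (Fin.last n)) • f (Fin.init g)
  map_update_add' := by
    intro inst g i x y
    obtain rfl := Subsingleton.elim inst (instDecidableEqFin (n + 1))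
    refine Fin.lastCases ?_ (fun i => ?_) i
    · simp [add_smul]
    · simp [(Fin.castSucc_lt_last i).ne']
  map_update_smul' := by
    intro inst g i k x
    obtain rfl := Subsingleton.elim inst (instDecidableEqFin (n + 1))
    refine Fin.lastCases ?_ (fun i => ?_) i
    · simp
    · simp [(Fin.castSucc_lt_last i).ne', smul_comm k]

variable (K T N)

/-- The Hochschild coboundary
`(δf)(t₀,…,tₙ) = t₀ f(t₁,…,tₙ) + ∑_{j<n} (-1)^{j+1} f(t₀,…,tⱼtⱼ₊₁,…,tₙ) + (-1)^{n+1} f(t₀,…,tₙ₋₁) tₙ`. -/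
def delta (n : ℕ) : Cochain K T N n →ₗ[K] Cochain K T N (n + 1) where
  toFun f := firstFace f + ∑ j : Fin n, (-1 : K) ^ ((j : ℕ) + 1) • innerFace j f
    + (-1 : K) ^ (n + 1) • lastFace f
  map_add' f f' := by
    ext g
    simp only [firstFace, innerFace, lastFace, add_apply, smul_apply, sum_apply,
      MultilinearMap.coe_mk, smul_add, Finset.sum_add_distrib]
    abel
  map_smul' k f := by
    ext g
    simp only [firstFace, innerFace, lastFace, add_apply, smul_apply, sum_apply,
      MultilinearMap.coe_mk, smul_add, Finset.smul_sum, RingHom.id_apply]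
    simp only [smul_comm k]

theorem delta_apply (n : ℕ) (f : Cochain K T N n) (g : Fin (n + 1) → T) :
    delta K T N n f g = g 0 • f (Fin.tail g)
      + ∑ j : Fin n, (-1 : K) ^ ((j : ℕ) + 1) • f (Fin.contractNth j.castSucc (· * ·) g)
      + (-1 : K) ^ (n + 1) • MulOpposite.op (g (Fin.last n)) • f (Fin.init g) := by
  simp [delta, firstFace, innerFace, lastFace]

/-- Hochschild `n`-cocycles. -/
def cocycles (n : ℕ) : Submodule K (Cochain K T N n) :=
  LinearMap.ker (delta K T N n)

/-- Hochschild `n`-coboundaries. -/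
def coboundaries : (n : ℕ) → Submodule K (Cochain K T N n)
  | 0 => ⊥
  | n + 1 => LinearMap.range (delta K T N n)

/-- Hochschild cohomology `Hⁿ(T, N)`: cocycles modulo coboundaries. -/
abbrev Cohomology (n : ℕ) : Type _ :=
  cocycles K T N n ⧸ (coboundaries K T N n).submoduleOf (cocycles K T N n)

/-- `HHⁿ(T) = Hⁿ(T, T)`. -/
abbrev HH (n : ℕ) : Type _ := Cohomology K T T n

end Cochains

section Functoriality

variable {K : Type*} [CommRing K] {S T : Type*} [Ring S] [Algebra K S] [Ring T] [Algebra K T]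
variable {N N' : Type*}
  [AddCommGroup N] [Module K N] [Module T N] [Module Tᵐᵒᵖ N]
  [IsScalarTower K T N] [IsScalarTower K Tᵐᵒᵖ N]
  [AddCommGroup N'] [Module K N'] [Module S N'] [Module Sᵐᵒᵖ N']
  [IsScalarTower K S N'] [IsScalarTower K Sᵐᵒᵖ N']

/-- The map `f ↦ φ ∘ f ∘ (σ × ⋯ × σ)` on cochains. -/
def cochainMap (σ : S →ₐ[K] T) (φ : N →ₗ[K] N') (n : ℕ) :
    Cochain K T N n →ₗ[K] Cochain K S N' n where
  toFun f := φ.compMultilinearMap (f.compLinearMap fun _ => σ.toLinearMap)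
  map_add' f f' := by ext g; simp
  map_smul' k f := by ext g; simp

theorem cochainMap_apply (σ : S →ₐ[K] T) (φ : N →ₗ[K] N') (n : ℕ) (f : Cochain K T N n)
    (g : Fin n → S) : cochainMap σ φ n f g = φ (f fun i => σ (g i)) := rfl

theorem cochainMap_delta (σ : S →ₐ[K] T) (φ : N →ₗ[K] N')
    (hl : ∀ s x, φ (σ s • x) = s • φ x)
    (hr : ∀ s x, φ (MulOpposite.op (σ s) • x) = MulOpposite.op s • φ x)
    (n : ℕ) (f : Cochain K T N n) :
    cochainMap σ φ (n + 1) (delta K T N n f) = delta K S N' n (cochainMap σ φ n f) := by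
  ext g
  have h : ∀ j : Fin n, (Fin.contractNth j.castSucc (· * ·) fun i => σ (g i)) =
      fun i => σ (Fin.contractNth j.castSucc (· * ·) g i) := by
    intro j
    ext i
    simp only [Fin.contractNth]
    split_ifs <;> simp
  simp only [cochainMap_apply, delta_apply, map_add, map_sum, map_smul, hl, hr, h]
  rfl

/-- The map on Hochschild cohomology induced by `f ↦ φ ∘ f ∘ (σ × ⋯ × σ)`, for an algebra
morphism `σ : S → T` and a `K`-linear map `φ : N → N'` that is a morphism of `S`-bimodules when
the `T`-bimodule `N` is regarded as an `S`-bimodule through `σ`. -/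
def cohomologyMap (σ : S →ₐ[K] T) (φ : N →ₗ[K] N')
    (hl : ∀ s x, φ (σ s • x) = s • φ x)
    (hr : ∀ s x, φ (MulOpposite.op (σ s) • x) = MulOpposite.op s • φ x) (n : ℕ) :
    Cohomology K T N n →ₗ[K] Cohomology K S N' n :=
  Submodule.mapQ _ _
    ((cochainMap σ φ n).restrict (p := cocycles K T N n) (q := cocycles K S N' n) (by
      intro f hf
      rw [cocycles, LinearMap.mem_ker] at hf ⊢
      rw [← cochainMap_delta σ φ hl hr, hf, map_zero]))
    (by
      rintro ⟨f, hf⟩ h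
      change f ∈ coboundaries K T N n at h
      change cochainMap σ φ n f ∈ coboundaries K S N' n
      cases n with
      | zero =>
        rw [coboundaries, Submodule.mem_bot] at h ⊢
        rw [h, map_zero]
      | succ n =>
        obtain ⟨f', rfl⟩ := h
        exact ⟨cochainMap σ φ n f', (cochainMap_delta σ φ hl hr n f').symm⟩)

end Functoriality

end Hochschild

section Triangular

/-- The triangular matrices `[a m; 0 b]` with `a ∈ A`, `m ∈ M`, `b ∈ B`; here `M` is an
`A ⊗[K] Bᵐᵒᵖ`-module. -/
@[ext]
structure Tri (K A M B : Type*) where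
  /-- upper left entry -/
  a : A
  /-- upper right entry -/
  m : M
  /-- lower right entry -/
  b : B

namespace Tri

variable {K A M B : Type*} [CommRing K] [Ring A] [Algebra K A] [Ring B] [Algebra K B]
  [AddCommGroup M] [Module K M] [Module (A ⊗[K] Bᵐᵒᵖ) M] [IsScalarTower K (A ⊗[K] Bᵐᵒᵖ) M]

/-- A triangular matrix as the triple of its entries. -/
def equivProd : Tri K A M B ≃ A × M × B where
  toFun t := (t.a, t.m, t.b)
  invFun p := ⟨p.1, p.2.1, p.2.2⟩
  left_inv _ := rfl
  right_inv _ := rfl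

instance : AddCommGroup (Tri K A M B) := equivProd.addCommGroup

instance : Module K (Tri K A M B) := equivProd.module K

instance : One (Tri K A M B) := ⟨⟨1, 0, 1⟩⟩

/-- `[a m; 0 b] [a' m'; 0 b'] = [aa' am' + mb'; 0 bb']`. -/
instance : Mul (Tri K A M B) :=
  ⟨fun t t' => ⟨t.a * t'.a,
    (t.a ⊗ₜ[K] (1 : Bᵐᵒᵖ)) • t'.m + ((1 : A) ⊗ₜ[K] MulOpposite.op t'.b) • t.m, t.b * t'.b⟩⟩

@[simp] theorem add_a (t t' : Tri K A M B) : (t + t').a = t.a + t'.a := rfl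
@[simp] theorem add_m (t t' : Tri K A M B) : (t + t').m = t.m + t'.m := rfl
@[simp] theorem add_b (t t' : Tri K A M B) : (t + t').b = t.b + t'.b := rfl
@[simp] theorem zero_a : (0 : Tri K A M B).a = 0 := rfl
@[simp] theorem zero_m : (0 : Tri K A M B).m = 0 := rfl
@[simp] theorem zero_b : (0 : Tri K A M B).b = 0 := rfl
@[simp] theorem smul_a (k : K) (t : Tri K A M B) : (k • t).a = k • t.a := rfl
@[simp] theorem smul_m (k : K) (t : Tri K A M B) : (k • t).m = k • t.m := rfl
@[simp] theorem smul_b (k : K) (t : Tri K A M B) : (k • t).b = k • t.b := rfl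
@[simp] theorem one_a : (1 : Tri K A M B).a = 1 := rfl
@[simp] theorem one_m : (1 : Tri K A M B).m = 0 := rfl
@[simp] theorem one_b : (1 : Tri K A M B).b = 1 := rfl
@[simp] theorem mul_a (t t' : Tri K A M B) : (t * t').a = t.a * t'.a := rfl
@[simp] theorem mul_m (t t' : Tri K A M B) : (t * t').m =
    (t.a ⊗ₜ[K] (1 : Bᵐᵒᵖ)) • t'.m + ((1 : A) ⊗ₜ[K] MulOpposite.op t'.b) • t.m := rfl
@[simp] theorem mul_b (t t' : Tri K A M B) : (t * t').b = t.b * t'.b := rfl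

instance : Ring (Tri K A M B) :=
  { (inferInstance : AddCommGroup (Tri K A M B)),
    (inferInstance : One (Tri K A M B)), (inferInstance : Mul (Tri K A M B)) with
    left_distrib := fun x y z => by
      ext <;> simp [mul_add, add_smul, TensorProduct.tmul_add]
      abel
    right_distrib := fun x y z => by
      ext <;> simp [add_mul, add_smul, TensorProduct.add_tmul]
      abel
    zero_mul := fun x => by
      ext
      · simp
      · simp only [mul_m, zero_a, zero_m, TensorProduct.zero_tmul, smul_zero, add_zero]
        exact zero_smul (A ⊗[K] Bᵐᵒᵖ) x.m
      · simp
    mul_zero := fun x => by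
      ext
      · simp
      · simp only [mul_m, zero_b, zero_m, MulOpposite.op_zero, TensorProduct.tmul_zero, smul_zero,
          zero_add]
        exact zero_smul (A ⊗[K] Bᵐᵒᵖ) x.m
      · simp
    mul_assoc := fun x y z => by
      ext
      · simp [mul_assoc]
      · simp [← mul_smul, add_assoc]
      · simp [mul_assoc]
    one_mul := fun x => by ext <;> simp [← Algebra.TensorProduct.one_def]
    mul_one := fun x => by ext <;> simp [← Algebra.TensorProduct.one_def] }

instance : Algebra K (Tri K A M B) :=
  Algebra.ofModule
    (fun k x y => by
      ext
      · simp
      · simp only [mul_m, smul_a, smul_m, smul_add]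
        rw [← TensorProduct.smul_tmul', smul_assoc, smul_comm k _ x.m]
      · simp)
    (fun k x y => by
      ext
      · simp
      · simp only [mul_m, smul_b, smul_m, smul_add, MulOpposite.op_smul]
        rw [TensorProduct.tmul_smul, smul_assoc, smul_comm k _ y.m]
      · simp)

variable {M' : Type*} [AddCommGroup M'] [Module K M'] [Module (A ⊗[K] Bᵐᵒᵖ) M']
  [IsScalarTower K (A ⊗[K] Bᵐᵒᵖ) M']

/-- The algebra morphism `[a m; 0 b] ↦ [a f(m); 0 b]` defined by a bimodule morphism `f`. -/
def map (f : M →ₗ[A ⊗[K] Bᵐᵒᵖ] M') : Tri K A M B →ₐ[K] Tri K A M' B :=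
  AlgHom.ofLinearMap
    { toFun := fun t => ⟨t.a, f t.m, t.b⟩
      map_add' := fun x y => by ext <;> simp
      map_smul' := fun k x => by
        ext
        · simp
        · exact (f.restrictScalars K).map_smul k x.m
        · simp }
    (by ext <;> simp)
    (fun x y => by ext <;> simp)

theorem map_apply (f : M →ₗ[A ⊗[K] Bᵐᵒᵖ] M') (t : Tri K A M B) :
    map f t = ⟨t.a, f t.m, t.b⟩ := rfl

/-- The map `HHⁿ[A M; 0 B] → HHⁿ[A N; 0 B]` for a direct summand `N` of `M` with inclusion
`f : N → M` and projection `g : M → N`: it is induced by restricting cochains along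
`[A N; 0 B] → [A M; 0 B]` and projecting their values along `[A M; 0 B] → [A N; 0 B]`. -/
def restrictHH (f : M' →ₗ[A ⊗[K] Bᵐᵒᵖ] M) (g : M →ₗ[A ⊗[K] Bᵐᵒᵖ] M')
    (h : ∀ x, g (f x) = x) (n : ℕ) :
    Hochschild.HH K (Tri K A M B) n →ₗ[K] Hochschild.HH K (Tri K A M' B) n :=
  Hochschild.cohomologyMap (map f) (map g).toLinearMap
    (fun s x => by ext <;> simp [map_apply, h])
    (fun s x => by ext <;> simp [map_apply, h]) n

end Tri

/-- An `A ⊗[K] Bᵐᵒᵖ`-module `N` regarded as a bimodule over `T = [A M; 0 B]` through the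
projections `T → A` and `T → B`. -/
def Infl (_K _A _M _B N : Type*) : Type _ := N

namespace Infl

variable (K A M B N : Type*) [CommRing K] [Ring A] [Algebra K A] [Ring B] [Algebra K B]
  [AddCommGroup M] [Module K M] [Module (A ⊗[K] Bᵐᵒᵖ) M] [IsScalarTower K (A ⊗[K] Bᵐᵒᵖ) M]
  [AddCommGroup N] [Module (A ⊗[K] Bᵐᵒᵖ) N]

instance : AddCommGroup (Infl K A M B N) := inferInstanceAs (AddCommGroup N)

instance : Module (A ⊗[K] Bᵐᵒᵖ) (Infl K A M B N) := inferInstanceAs (Module (A ⊗[K] Bᵐᵒᵖ) N)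

instance : Module K (Infl K A M B N) :=
  Module.compHom (Infl K A M B N) (algebraMap K (A ⊗[K] Bᵐᵒᵖ))

/-- The projection `[A M; 0 B] → A`. -/
def toA : Tri K A M B →+* A where
  toFun := Tri.a
  map_one' := rfl
  map_mul' _ _ := rfl
  map_zero' := rfl
  map_add' _ _ := rfl

/-- The projection `[A M; 0 B] → B`. -/
def toB : Tri K A M B →+* B where
  toFun := Tri.b
  map_one' := rfl
  map_mul' _ _ := rfl
  map_zero' := rfl
  map_add' _ _ := rfl

instance : Module (Tri K A M B) (Infl K A M B N) :=
  Module.compHom (Infl K A M B N)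
    ((Algebra.TensorProduct.includeLeft (R := K) (S := K) (A := A) (B := Bᵐᵒᵖ)).toRingHom.comp
      (toA K A M B))

instance : Module (Tri K A M B)ᵐᵒᵖ (Infl K A M B N) :=
  Module.compHom (Infl K A M B N)
    ((Algebra.TensorProduct.includeRight (R := K) (A := A) (B := Bᵐᵒᵖ)).toRingHom.comp
      (toB K A M B).op)

variable {K A M B N}

theorem smul_def (t : Tri K A M B) (x : Infl K A M B N) :
    t • x = (t.a ⊗ₜ[K] (1 : Bᵐᵒᵖ)) • x := rfl

theorem op_smul_def (t : Tri K A M B) (x : Infl K A M B N) :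
    MulOpposite.op t • x = ((1 : A) ⊗ₜ[K] MulOpposite.op t.b) • x := rfl

theorem scalar_smul_def (k : K) (x : Infl K A M B N) :
    k • x = algebraMap K (A ⊗[K] Bᵐᵒᵖ) k • x := rfl

instance : IsScalarTower K (Tri K A M B) (Infl K A M B N) where
  smul_assoc k t x := by
    rw [smul_def, smul_def, scalar_smul_def, ← mul_smul, ← Algebra.smul_def, Tri.smul_a,
      TensorProduct.smul_tmul']

instance : IsScalarTower K (Tri K A M B)ᵐᵒᵖ (Infl K A M B N) where
  smul_assoc k t x := by
    induction t using MulOpposite.rec' with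
    | _ t =>
    rw [← MulOpposite.op_smul, op_smul_def, op_smul_def, scalar_smul_def, ← mul_smul,
      ← Algebra.smul_def, Tri.smul_b, MulOpposite.op_smul, TensorProduct.tmul_smul]

end Infl

end Triangular

/-- The category of `A ⊗[K] Bᵐᵒᵖ`-modules is `K`-linear. -/
noncomputable instance (K A B : Type u) [CommRing K] [Ring A] [Algebra K A] [Ring B] [Algebra K B] :
    Linear K (ModuleCat.{u} (A ⊗[K] Bᵐᵒᵖ)) :=
  ModuleCat.Algebra.instLinear

section Happel

variable {K A B : Type u} [CommRing K] [Ring A] [Algebra K A] [Ring B] [Algebra K B]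
variable {M : Type u} [AddCommGroup M] [Module K M] [Module (A ⊗[K] Bᵐᵒᵖ) M]
  [IsScalarTower K (A ⊗[K] Bᵐᵒᵖ) M]

/-- `IsHappelImage n x y` says that the class `y ∈ HHⁿ⁺¹(T)`, `T = [A M; 0 B]`, is the image of
`x ∈ Extⁿ(M, M)` (over `A ⊗ Bᵒᵖ`) under the canonical map of the long exact sequence
`⋯ → Extⁿ(M, M) → HHⁿ⁺¹(T) → HHⁿ⁺¹(A) × HHⁿ⁺¹(B) → ⋯`.

The projection `T → M` is a derivation, hence a class in `H¹(T, M)`, and `y` is its Yoneda product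
`x · [T → M] ∈ Hⁿ⁺¹(T, M)`, carried to `Hⁿ⁺¹(T, T)` by the bimodule inclusion `M → T`.
Concretely: `P` is a projective resolution of the `A ⊗ Bᵒᵖ`-module `M`, the cochains
`θ k : Tᵏ⁺¹ → P k` lift the derivation through `P` (`θ 0` lifts it along `P 0 → M`, and
`d ∘ θ (k + 1) = δ (θ k)`), the class `x` is represented by the cocycle `φ : P n → M`, and `y` is
the class of `φ ∘ θ n`, with values in `M ⊆ T`. -/
def IsHappelImage (n : ℕ)
    (x : Ext (ModuleCat.of (A ⊗[K] Bᵐᵒᵖ) M) (ModuleCat.of (A ⊗[K] Bᵐᵒᵖ) M) n)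
    (y : Hochschild.HH K (Tri K A M B) (n + 1)) : Prop :=
  ∃ (P : ProjectiveResolution (ModuleCat.of (A ⊗[K] Bᵐᵒᵖ) M))
    (θ : ∀ k : ℕ,
      Hochschild.Cochain K (Tri K A M B) (Infl K A M B (P.complex.X k)) (k + 1))
    (φ : P.complex.X n ⟶ ModuleCat.of (A ⊗[K] Bᵐᵒᵖ) M)
    (hφ : P.complex.d (n + 1) n ≫ φ = 0)
    (z : Hochschild.cocycles K (Tri K A M B) (Tri K A M B) (n + 1)),
    (∀ t : Fin 1 → Tri K A M B, (P.π.f 0).hom (θ 0 t) = (t 0).m) ∧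
    (∀ (k : ℕ) (t : Fin (k + 2) → Tri K A M B),
      (P.complex.d (k + 1) k).hom (θ (k + 1) t) =
        Hochschild.delta K (Tri K A M B) (Infl K A M B (P.complex.X k)) (k + 1) (θ k) t) ∧
    x = P.extMk φ (n + 1) rfl hφ ∧
    (∀ t : Fin (n + 1) → Tri K A M B, z.1 t = ⟨0, φ.hom (θ n t), 0⟩) ∧
    y = Submodule.Quotient.mk z

end Happel

section Copies

variable {n : ℕ} {m : Fin n → ℕ}

/-- The inclusion `⨁ᵢ Xᵢ → ⨁ᵢ Xᵢ^{mᵢ}` of the copies number `c i`. -/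
def copyIncl (R : Type*) [Ring R] (X : Fin n → Type*) [∀ i, AddCommGroup (X i)]
    [∀ i, Module R (X i)] (c : ∀ i, Fin (m i)) :
    (∀ i, X i) →ₗ[R] (∀ i, Fin (m i) → X i) :=
  LinearMap.pi fun i => LinearMap.single R (fun _ : Fin (m i) => X i) (c i) ∘ₗ LinearMap.proj i

/-- The projection `⨁ᵢ Xᵢ^{mᵢ} → ⨁ᵢ Xᵢ` onto the copies number `c i`. -/
def copyProj (R : Type*) [Ring R] (X : Fin n → Type*) [∀ i, AddCommGroup (X i)]
    [∀ i, Module R (X i)] (c : ∀ i, Fin (m i)) :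
    (∀ i, Fin (m i) → X i) →ₗ[R] (∀ i, X i) :=
  LinearMap.pi fun i => LinearMap.proj (c i) ∘ₗ LinearMap.proj i

theorem copyProj_copyIncl (R : Type*) [Ring R] (X : Fin n → Type*) [∀ i, AddCommGroup (X i)]
    [∀ i, Module R (X i)] (c : ∀ i, Fin (m i)) (x : ∀ i, X i) :
    copyProj R X c (copyIncl R X c x) = x := by
  ext i
  simp [copyProj, copyIncl]

/-- The pairs (copy of `Xᵢ`, copy of `Xⱼ`) other than the pair of chosen copies `(c i, c j)`. -/
abbrev OtherPairs (c : ∀ i, Fin (m i)) (i j : Fin n) : Type :=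
  {p : Fin (m i) × Fin (m j) // p ≠ (c i, c j)}

theorem card_otherPairs (c : ∀ i, Fin (m i)) (i j : Fin n) :
    Fintype.card (OtherPairs c i j) = m i * m j - 1 := by
  rw [Fintype.card_subtype_compl]
  simp

variable {K A B : Type u} [CommRing K] [Ring A] [Algebra K A] [Ring B] [Algebra K B]
variable (X : Fin n → Type u) [∀ i, AddCommGroup (X i)] [∀ i, Module (A ⊗[K] Bᵐᵒᵖ) (X i)]

/-- The inclusion `Xᵢ → ⨁ᵢ Xᵢ^{mᵢ}` of the copy number `p` of `Xᵢ`. -/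
def inclOne (m : Fin n → ℕ) (i : Fin n) (p : Fin (m i)) :
    ModuleCat.of (A ⊗[K] Bᵐᵒᵖ) (X i) ⟶ ModuleCat.of (A ⊗[K] Bᵐᵒᵖ) (∀ i, Fin (m i) → X i) :=
  ModuleCat.ofHom (LinearMap.single (A ⊗[K] Bᵐᵒᵖ) (fun i => Fin (m i) → X i) i ∘ₗ
    LinearMap.single (A ⊗[K] Bᵐᵒᵖ) (fun _ : Fin (m i) => X i) p)

/-- The projection `⨁ᵢ Xᵢ^{mᵢ} → Xᵢ` onto the copy number `p` of `Xᵢ`. -/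
def projOne (m : Fin n → ℕ) (i : Fin n) (p : Fin (m i)) :
    ModuleCat.of (A ⊗[K] Bᵐᵒᵖ) (∀ i, Fin (m i) → X i) ⟶ ModuleCat.of (A ⊗[K] Bᵐᵒᵖ) (X i) :=
  ModuleCat.ofHom (LinearMap.proj p ∘ₗ LinearMap.proj i)

/-- The inclusion `∏_{i,j} Extᵏ(Xᵢ, Xⱼ)^{mᵢmⱼ-1} → Extᵏ(M, M)`, `M = ⨁ᵢ Xᵢ^{mᵢ}`: the factor
number `s` of index `(i, j)` is the summand of `Extᵏ(M, M)` that belongs to the copy number `p`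
of `Xᵢ` (source) and the copy number `q` of `Xⱼ` (target), `(p, q) = e i j s`. -/
noncomputable def otherExtIncl (c : ∀ i, Fin (m i))
    (e : ∀ i j, Fin (m i * m j - 1) ≃ OtherPairs c i j) (k : ℕ) :
    (∀ i j, Fin (m i * m j - 1) →
      Ext (ModuleCat.of (A ⊗[K] Bᵐᵒᵖ) (X i)) (ModuleCat.of (A ⊗[K] Bᵐᵒᵖ) (X j)) k) →ₗ[K]
    Ext (ModuleCat.of (A ⊗[K] Bᵐᵒᵖ) (∀ i, Fin (m i) → X i))
      (ModuleCat.of (A ⊗[K] Bᵐᵒᵖ) (∀ i, Fin (m i) → X i)) k where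
  toFun x := ∑ i, ∑ j, ∑ s,
    (Ext.mk₀ (projOne X m i (e i j s).1.1)).comp
      ((x i j s).comp (Ext.mk₀ (inclOne X m j (e i j s).1.2)) (add_zero k)) (zero_add k)
  map_add' x y := by simp [Finset.sum_add_distrib]
  map_smul' a x := by simp [Finset.smul_sum]

/-- The map `HHᵏ[A M; 0 B] → HHᵏ[A M'; 0 B]`, for `M = ⨁ᵢ Xᵢ^{mᵢ}` and its direct summand
`M' = ⨁ᵢ Xᵢ` formed by the copies number `c i` of the `Xᵢ`. -/
def copyRestrictHH (K A B : Type u) [CommRing K] [Ring A] [Algebra K A] [Ring B] [Algebra K B]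
    (X : Fin n → Type u) [∀ i, AddCommGroup (X i)] [∀ i, Module K (X i)]
    [∀ i, Module (A ⊗[K] Bᵐᵒᵖ) (X i)] [∀ i, IsScalarTower K (A ⊗[K] Bᵐᵒᵖ) (X i)]
    (c : ∀ i, Fin (m i)) (k : ℕ) :
    Hochschild.HH K (Tri K A (∀ i, Fin (m i) → X i) B) k →ₗ[K]
      Hochschild.HH K (Tri K A (∀ i, X i) B) k :=
  Tri.restrictHH (copyIncl (A ⊗[K] Bᵐᵒᵖ) X c) (copyProj (A ⊗[K] Bᵐᵒᵖ) X c)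
    (copyProj_copyIncl (A ⊗[K] Bᵐᵒᵖ) X c) k

end Copies

/-! Write `T = [A M; 0 B]`. For an `A ⊗ Bᵒᵖ`-module `N`, inflated to a `T`-bimodule, Hochschild
cohomology is a shifted Ext: `Hⁿ⁺¹(T, N) ≅ Extⁿ(M, N)`. Indeed the cochains `Tⁿ → N` are the
morphisms to `N` from `A ⊗ T^{⊗ n} ⊗ B`, and this complex computes `Tor^T(A, B)`, which is `M` in
degree 1 and zero elsewhere. Its degree 0 end splits off, and projectivity over `K` makes the
remainder a projective resolution `res` of `M`; `extClass` compares cocycles with Ext classes along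
it. Exactness is obtained by duality: the `K`-linear maps from the complex to `V` are the Hochschild
cochains with values in the coinduced bimodule of bilinear maps `A × B → V`, where explicit
contractions exist. The canonical map `happelMap` is the inverse isomorphism for `N = M`, followed
by `M ⊆ T`.

The diagonal idempotents of `T` show that a cocycle of positive degree is cohomologous to one whose
diagonal entries depend on the corresponding entries of the arguments only (`exists_isDiagonal`).
Such a diagonal does not notice a change of `M`.

Exactness in the middle: if the restriction of such a cocycle `f` to `M'` is a coboundary `δg`,
subtracting the coboundary of the diagonal part of `g` leaves a cocycle with values in `M`, that is,
an Ext class, and its component from `M'` to `M'` is zero (`exists_happelMap_eq`).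

Surjectivity: a diagonal cocycle for `M'` is lifted by letting every copy of `Mᵢ` carry the
component of the corner on `Mᵢ` (`exists_cocycle_lift`). What is missed after restriction has values
in the corner, and extends by zero on the other copies.

Splitting: morphisms `ι : N₁ → M` and `π : M → N₂` with `π ι = 0` give a chain map `f ↦ π f(ι × ⋯ ×
ι)`, hence a map `HHⁿ⁺¹(T) → Extⁿ(N₁, N₂)` that extends `x ↦ π x ι` (`cornerHH_happelMap`).
Components of Ext between different copies are read off in this way. For a copy `p` that is not
chosen, the component from `p` to itself has `π_p ι_p = 1`; there the pair `ι_p - ι_c`, `π_p + π_c`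
with the chosen copy `c` is used, whose composite is `1 - 1 = 0`, and the component at `c`, which it
also sees, is zero on the omitted-pair submodule (`exists_component_linear`). This yields a
retraction of `l*`, and with surjectivity the sequence splits. -/

namespace Hochschild

/-! ### Multilinear maps and currying -/

/-- `K`-multilinear maps in `n` variables from `T` to `N`. -/
abbrev Multi (K T N : Type*) [CommRing K] [AddCommGroup T] [Module K T] [AddCommGroup N]
    [Module K N] (n : ℕ) : Type _ :=
  MultilinearMap K (fun _ : Fin n => T) N

section Curry

variable {K T N N' : Type*} [CommRing K] [AddCommGroup T] [Module K T] [AddCommGroup N]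
  [Module K N] [AddCommGroup N'] [Module K N']

/-- Separating the last variable of a multilinear map. -/
abbrev curryEquiv (K T N : Type*) [CommRing K] [AddCommGroup T] [Module K T] [AddCommGroup N]
    [Module K N] (n : ℕ) : Multi K T N (n + 1) ≃ₗ[K] Multi K T (T →ₗ[K] N) n :=
  (multilinearCurryRightEquiv K (fun _ : Fin (n + 1) => T) N)

theorem curryEquiv_apply {n : ℕ} (f : Multi K T N (n + 1)) (t : Fin n → T) (x : T) :
    curryEquiv K T N n f t x = f (Fin.snoc t x) := rfl

/-- Multilinear maps in no variables. -/
abbrev nullaryEquiv (K T N : Type*) [CommRing K] [AddCommGroup T] [Module K T] [AddCommGroup N]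
    [Module K N] : N ≃ₗ[K] Multi K T N 0 :=
  MultilinearMap.constLinearEquivOfIsEmpty K K (fun _ : Fin 0 => T) N

end Curry

/-! ### The Hochschild coboundary for arbitrary actions, by recursion on the last variable -/

section Bimodule

variable {K T N : Type u} [CommRing K] [Ring T] [Algebra K T] [AddCommGroup N] [Module K N]

/-- Postcomposition as a left action of `T` on the linear maps `T → N`. -/
def curryL (L : T →ₗ[K] Module.End K N) : T →ₗ[K] Module.End K (T →ₗ[K] N) :=
  LinearMap.mk₂ K (fun t φ => L t ∘ₗ φ) (by intros; ext; simp) (by intros; ext; simp)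
    (by intros; ext; simp) (by intros; ext; simp)

/-- The right action `(φ t)(x) = φ(t x) - φ(t) x` of `T` on the linear maps `T → N`. -/
def curryR (R : T →ₗ[K] Module.End K N) : T →ₗ[K] Module.End K (T →ₗ[K] N) :=
  LinearMap.mk₂ K (fun t φ => φ ∘ₗ LinearMap.mulLeft K t - R.flip (φ t))
    (by intros; ext; simp [add_mul]; abel) (by intros; ext; simp [smul_sub])
    (by intros; ext; simp; abel) (by intros; ext; simp [smul_sub])

@[simp] theorem curryL_apply (L : T →ₗ[K] Module.End K N) (t : T) (φ : T →ₗ[K] N) (x : T) :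
    curryL L t φ x = L t (φ x) := rfl

@[simp] theorem curryR_apply (R : T →ₗ[K] Module.End K N) (t : T) (φ : T →ₗ[K] N) (x : T) :
    curryR R t φ x = φ (t * x) - R x (φ t) := rfl

/-- The Hochschild coboundary for the left and right actions `L` and `R` of `T` on `N`, defined
by recursion on the last variable. -/
def gdelta : (n : ℕ) → {N : Type u} → [AddCommGroup N] → [Module K N] →
    (L R : T →ₗ[K] Module.End K N) → Multi K T N n →ₗ[K] Multi K T N (n + 1)
  | 0, N, _, _, L, R => (curryEquiv K T N 0).symm.toLinearMap ∘ₗ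
      (nullaryEquiv K T (T →ₗ[K] N)).toLinearMap ∘ₗ (L.flip - R.flip) ∘ₗ
      (nullaryEquiv K T N).symm.toLinearMap
  | n + 1, N, _, _, L, R => (curryEquiv K T N (n + 1)).symm.toLinearMap ∘ₗ
      gdelta n (curryL L) (curryR R) ∘ₗ (curryEquiv K T N n).toLinearMap

theorem gdelta_zero_apply (L R : T →ₗ[K] Module.End K N) (f : Multi K T N 0) (t : Fin 1 → T) :
    gdelta 0 L R f t = L (t 0) (f ![]) - R (t 0) (f ![]) := by
  change L.flip (f 0) (t 0) - R.flip (f 0) (t 0) = _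
  rw [Subsingleton.elim (0 : Fin 0 → T) ![]]
  rfl

theorem gdelta_succ_apply {n : ℕ} (L R : T →ₗ[K] Module.End K N) (f : Multi K T N (n + 1))
    (t : Fin (n + 2) → T) :
    gdelta (n + 1) L R f t =
      gdelta n (curryL L) (curryR R) (curryEquiv K T N n f) (Fin.init t) (t (Fin.last _)) := rfl

theorem curry_gdelta {n : ℕ} (L R : T →ₗ[K] Module.End K N) (f : Multi K T N (n + 1)) :
    curryEquiv K T N (n + 1) (gdelta (n + 1) L R f) =
      gdelta n (curryL L) (curryR R) (curryEquiv K T N n f) := by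
  simp [gdelta]

/-- The two summands of `curryR` supply the last inner face and the last face; all other faces come
from the smaller degree. Since `gdelta` is recursive, identities between operators that also curry
can be checked in degree 0, with arbitrary coefficients. -/
theorem gdelta_apply (n : ℕ) {N : Type u} [AddCommGroup N] [Module K N]
    (L R : T →ₗ[K] Module.End K N) (f : Multi K T N n) (g : Fin (n + 1) → T) :
    gdelta n L R f g = L (g 0) (f (Fin.tail g))
      + ∑ j : Fin n, (-1 : K) ^ ((j : ℕ) + 1) • f (Fin.contractNth j.castSucc (· * ·) g)
      + (-1 : K) ^ (n + 1) • R (g (Fin.last n)) (f (Fin.init g)) := by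
  induction n generalizing N with
  | zero =>
    have h1 : Fin.tail g = ![] := Subsingleton.elim _ _
    have h2 : Fin.init g = ![] := Subsingleton.elim _ _
    rw [gdelta_zero_apply, h1, h2]
    simp [sub_eq_add_neg]
  | succ n ih =>
    rw [gdelta_succ_apply, ih]
    have h1 : (Fin.snoc (Fin.tail (Fin.init g)) (g (Fin.last _)) : Fin (n + 1) → T) =
        Fin.tail g := by
      ext i; refine Fin.lastCases ?_ (fun i => ?_) i <;> simp [Fin.tail, Fin.init]
    have h2 : ∀ j : Fin n, (Fin.snoc (Fin.contractNth j.castSucc (· * ·) (Fin.init g))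
        (g (Fin.last _)) : Fin (n + 1) → T) =
        Fin.contractNth j.castSucc.castSucc (· * ·) g := by
      intro j
      ext i
      simp only [Fin.contractNth, Fin.snoc, Fin.init, Fin.castSucc, Fin.castAdd, Fin.castLE,
        Fin.succ, Fin.last, cast_eq, Fin.castLT]
      grind
    have h3 : (Fin.snoc (Fin.init (Fin.init g)) (g (Fin.last n).castSucc * g (Fin.last _)) :
        Fin (n + 1) → T) = Fin.contractNth (Fin.last n).castSucc (· * ·) g := by
      ext i
      simp only [Fin.contractNth, Fin.snoc, Fin.init, Fin.castSucc, Fin.castAdd, Fin.castLE,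
        Fin.succ, Fin.last, cast_eq, Fin.castLT]
      grind
    have h4 : (Fin.snoc (Fin.init (Fin.init g)) (g (Fin.last n).castSucc) :
        Fin (n + 1) → T) = Fin.init g := by
      ext i; refine Fin.lastCases ?_ (fun i => ?_) i <;> simp [Fin.init]
    simp only [LinearMap.add_apply, LinearMap.smul_apply, LinearMap.sum_apply, curryL_apply,
      curryR_apply, curryEquiv_apply, h1, h2, Fin.sum_univ_castSucc]
    have h5 : Fin.init g (Fin.last n) = g (Fin.last n).castSucc := rfl
    have h6 : Fin.init g 0 = g 0 := rfl
    rw [h5, h6, h3, h4, Fin.val_last, smul_sub, pow_succ (-1 : K) (n + 1)]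
    simp only [Fin.val_castSucc, mul_neg, mul_one, neg_smul]
    abel

/-- The map `f ↦ c ∘ f ∘ (σ × ⋯ × σ)`. -/
def multiMap {S N' : Type u} [Ring S] [Algebra K S] [AddCommGroup N'] [Module K N']
    (σ : S →ₗ[K] T) (c : N →ₗ[K] N') (n : ℕ) : Multi K T N n →ₗ[K] Multi K S N' n where
  toFun f := c.compMultilinearMap (f.compLinearMap fun _ => σ)
  map_add' f f' := by ext g; simp
  map_smul' k f := by ext g; simp

@[simp] theorem multiMap_apply {S N' : Type u} [Ring S] [Algebra K S] [AddCommGroup N']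
    [Module K N'] (σ : S →ₗ[K] T) (c : N →ₗ[K] N') (n : ℕ) (f : Multi K T N n) (g : Fin n → S) :
    multiMap σ c n f g = c (f fun i => σ (g i)) := rfl

section Naturality

variable {S N' : Type u} [Ring S] [Algebra K S] [AddCommGroup N'] [Module K N']
  {σ : S →ₗ[K] T} {c : N →ₗ[K] N'} {L R : T →ₗ[K] Module.End K N} {L' R' : S →ₗ[K] Module.End K N'}

/-- No compatibility of `c` with the right actions is assumed, so only the last face produces a
defect. This is needed for evaluation maps on curried cochains, which respect postcomposition but
not `curryR`. -/
theorem gdelta_multiMap_sub (hσ : ∀ s t, σ (s * t) = σ s * σ t)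
    (hL : ∀ s x, c (L (σ s) x) = L' s (c x)) {n : ℕ} (f : Multi K T N n) (t : Fin (n + 1) → S) :
    gdelta n L' R' (multiMap σ c n f) t = c (gdelta n L R f fun i => σ (t i)) +
      (-1 : K) ^ (n + 1) • (R' (t (Fin.last n)) (c (f fun i => σ (t i.castSucc))) -
        c (R (σ (t (Fin.last n))) (f fun i => σ (t i.castSucc)))) := by
  have h : ∀ j : Fin n, (Fin.contractNth j.castSucc (· * ·) fun i => σ (t i)) =
      fun i => σ (Fin.contractNth j.castSucc (· * ·) t i) := by
    intro j
    ext i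
    simp only [Fin.contractNth]
    split_ifs <;> simp [hσ]
  simp only [gdelta_apply, multiMap_apply, map_add, map_sum, map_smul, hL, h, smul_sub]
  unfold Fin.tail Fin.init
  abel

theorem gdelta_multiMap (hσ : ∀ s t, σ (s * t) = σ s * σ t)
    (hL : ∀ s x, c (L (σ s) x) = L' s (c x)) (hR : ∀ s x, c (R (σ s) x) = R' s (c x))
    {n : ℕ} (f : Multi K T N n) :
    gdelta n L' R' (multiMap σ c n f) = multiMap σ c (n + 1) (gdelta n L R f) := by
  ext t
  rw [gdelta_multiMap_sub (R := R) hσ hL, hR]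
  simp

end Naturality

/-- Commuting left and right actions of the algebra `T`. -/
structure IsBiaction (L R : T →ₗ[K] Module.End K N) : Prop where
  left_mul : ∀ s t x, L (s * t) x = L s (L t x)
  right_mul : ∀ s t x, R (s * t) x = R t (R s x)
  comm : ∀ s t x, L s (R t x) = R t (L s x)

theorem IsBiaction.curry {L R : T →ₗ[K] Module.End K N} (h : IsBiaction L R) :
    IsBiaction (curryL L) (curryR R) where
  left_mul s t φ := by ext x; simp [h.left_mul]
  right_mul s t φ := by ext x; simp [h.right_mul, mul_assoc]
  comm s t φ := by ext x; simp [h.comm]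

theorem multi_ext_snoc {n : ℕ} {f g : Multi K T N (n + 1)}
    (h : curryEquiv K T N n f = curryEquiv K T N n g) : f = g :=
  (curryEquiv K T N n).injective h

theorem curryEquiv_zero_apply (f : Multi K T N 1) (x : T) (t : Fin 0 → T) :
    curryEquiv K T N 0 f t x = f ![x] := by
  rw [curryEquiv_apply]
  congr 1
  ext i
  rw [Fin.eq_zero i]
  rfl

/-- Currying preserves `IsBiaction`, so only degree 0 requires a computation. Units play no role,
and could not be imposed: `curryR` is not unital. -/
theorem gdelta_gdelta {N : Type u} [AddCommGroup N] [Module K N] {L R : T →ₗ[K] Module.End K N}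
    (h : IsBiaction L R) {n : ℕ} (f : Multi K T N n) :
    gdelta (n + 1) L R (gdelta n L R f) = 0 := by
  induction n generalizing N with
  | zero =>
    ext t
    have h1 : ∀ x, curryEquiv K T N 0 (gdelta 0 L R f) ![] x = L x (f ![]) - R x (f ![]) :=
      fun x => by rw [curryEquiv_zero_apply, gdelta_zero_apply]; rfl
    rw [gdelta_succ_apply, gdelta_zero_apply]
    simp [h1, h.left_mul, h.right_mul, h.comm]
  | succ n ih =>
    apply multi_ext_snoc
    rw [curry_gdelta, curry_gdelta, ih h.curry, map_zero]

/-! ### Cup products, contractions and homotopies -/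

section Cup

variable {N' : Type u} [AddCommGroup N'] [Module K N']

/-- Postcomposition with values in linear maps `T → N`. -/
def curryCup {N N' : Type u} [AddCommGroup N] [Module K N] [AddCommGroup N'] [Module K N']
    (D : T →ₗ[K] N' →ₗ[K] N) : T →ₗ[K] (T →ₗ[K] N') →ₗ[K] (T →ₗ[K] N) :=
  LinearMap.mk₂ K (fun t φ => D t ∘ₗ φ) (by intros; ext; simp) (by intros; ext; simp)
    (by intros; ext; simp) (by intros; ext; simp)

@[simp] theorem curryCup_apply (D : T →ₗ[K] N' →ₗ[K] N) (t : T) (φ : T →ₗ[K] N') (x : T) :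
    curryCup D t φ x = D t (φ x) := rfl

/-- The cup product `(t₀, …, tₙ) ↦ D(t₀) g(t₁, …, tₙ)`. -/
def cup : (n : ℕ) → {N N' : Type u} → [AddCommGroup N] → [Module K N] → [AddCommGroup N'] →
    [Module K N'] → (D : T →ₗ[K] N' →ₗ[K] N) → Multi K T N' n →ₗ[K] Multi K T N (n + 1)
  | 0, N, N', _, _, _, _, D => (curryEquiv K T N 0).symm.toLinearMap ∘ₗ
      (nullaryEquiv K T (T →ₗ[K] N)).toLinearMap ∘ₗ D.flip ∘ₗ
      (nullaryEquiv K T N').symm.toLinearMap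
  | n + 1, N, N', _, _, _, _, D => (curryEquiv K T N (n + 1)).symm.toLinearMap ∘ₗ
      cup n (curryCup D) ∘ₗ (curryEquiv K T N' n).toLinearMap

theorem cup_zero_apply (D : T →ₗ[K] N' →ₗ[K] N) (g : Multi K T N' 0) (t : Fin 1 → T) :
    cup 0 D g t = D (t 0) (g ![]) := by
  change D.flip (g 0) (t 0) = _
  rw [Subsingleton.elim (0 : Fin 0 → T) ![]]
  rfl

theorem cup_succ_apply {n : ℕ} (D : T →ₗ[K] N' →ₗ[K] N) (g : Multi K T N' (n + 1))
    (t : Fin (n + 2) → T) :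
    cup (n + 1) D g t =
      cup n (curryCup D) (curryEquiv K T N' n g) (Fin.init t) (t (Fin.last _)) := rfl

theorem curry_cup {n : ℕ} (D : T →ₗ[K] N' →ₗ[K] N) (g : Multi K T N' (n + 1)) :
    curryEquiv K T N (n + 1) (cup (n + 1) D g) = cup n (curryCup D) (curryEquiv K T N' n g) := by
  simp [cup]

/-- `D` is a derivation with values in the maps `N' → N`, so it is a 1-cocycle and the Leibniz rule
leaves only the term with the coboundary of `g`. Both hypotheses pass to `curryCup`, which reduces
the claim to degree 0. -/
theorem gdelta_cup {N N' : Type u} [AddCommGroup N] [Module K N] [AddCommGroup N'] [Module K N']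
    {D : T →ₗ[K] N' →ₗ[K] N} {L R : T →ₗ[K] Module.End K N} {L' R' : T →ₗ[K] Module.End K N'}
    (hL : ∀ s t x, D (s * t) x = L s (D t x) + D s (L' t x))
    (hR : ∀ s t x, R s (D t x) = D t (R' s x)) {n : ℕ} (g : Multi K T N' n) :
    gdelta (n + 1) L R (cup n D g) = -cup (n + 1) D (gdelta n L' R' g) := by
  induction n generalizing N N' with
  | zero =>
    ext t
    have h1 : ∀ x, curryEquiv K T N 0 (cup 0 D g) ![] x = D x (g ![]) :=
      fun x => by rw [curryEquiv_zero_apply, cup_zero_apply]; rfl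
    have h2 : ∀ x, curryEquiv K T N' 0 (gdelta 0 L' R' g) ![] x = L' x (g ![]) - R' x (g ![]) :=
      fun x => by rw [curryEquiv_zero_apply, gdelta_zero_apply]; rfl
    rw [gdelta_succ_apply, gdelta_zero_apply, neg_apply, cup_succ_apply,
      cup_zero_apply]
    simp only [LinearMap.sub_apply, curryL_apply, curryR_apply, curryCup_apply, h1, h2, hL, hR,
      map_sub]
    abel
  | succ n ih =>
    apply multi_ext_snoc
    rw [curry_gdelta, curry_cup, map_neg, curry_cup, curry_gdelta]
    refine ih (fun s t φ => ?_) (fun s t φ => ?_) _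
    · ext x; simp [hL]
    · ext x; simp [hR]

end Cup

section Insertion

/-- The contraction of the first variable, with values in linear maps `T → N'`. -/
def curryIns {N N' : Type u} [AddCommGroup N] [Module K N] [AddCommGroup N'] [Module K N']
    (v : (T →ₗ[K] N) →ₗ[K] N') : (T →ₗ[K] T →ₗ[K] N) →ₗ[K] (T →ₗ[K] N') where
  toFun Φ := v ∘ₗ Φ.flip
  map_add' Φ Ψ := by ext x; exact v.map_add (Φ.flip x) (Ψ.flip x)
  map_smul' k Φ := by ext x; exact v.map_smul k (Φ.flip x)

theorem curryIns_apply {N N' : Type u} [AddCommGroup N] [Module K N] [AddCommGroup N']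
    [Module K N'] (v : (T →ₗ[K] N) →ₗ[K] N') (Φ : T →ₗ[K] T →ₗ[K] N) (x : T) :
    curryIns v Φ x = v (Φ.flip x) := rfl

/-- The contraction `(t₁, …, tₙ) ↦ v(t ↦ f(t, t₁, …, tₙ))` of the first variable. -/
def ins : (n : ℕ) → {N N' : Type u} → [AddCommGroup N] → [Module K N] → [AddCommGroup N'] →
    [Module K N'] → (v : (T →ₗ[K] N) →ₗ[K] N') → Multi K T N (n + 1) →ₗ[K] Multi K T N' n
  | 0, N, N', _, _, _, _, v => (nullaryEquiv K T N').toLinearMap ∘ₗ v ∘ₗ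
      (nullaryEquiv K T (T →ₗ[K] N)).symm.toLinearMap ∘ₗ (curryEquiv K T N 0).toLinearMap
  | n + 1, N, N', _, _, _, _, v => (curryEquiv K T N' n).symm.toLinearMap ∘ₗ
      ins n (curryIns v) ∘ₗ (curryEquiv K T N (n + 1)).toLinearMap

variable {N' : Type u} [AddCommGroup N'] [Module K N']

theorem ins_zero_apply (v : (T →ₗ[K] N) →ₗ[K] N') (f : Multi K T N 1) (t : Fin 0 → T) :
    ins 0 v f t = v (curryEquiv K T N 0 f ![]) := by
  change v (curryEquiv K T N 0 f 0) = _
  rw [Subsingleton.elim (0 : Fin 0 → T) ![]]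

theorem ins_succ_apply {n : ℕ} (v : (T →ₗ[K] N) →ₗ[K] N') (f : Multi K T N (n + 2))
    (t : Fin (n + 1) → T) :
    ins (n + 1) v f t =
      ins n (curryIns v) (curryEquiv K T N (n + 1) f) (Fin.init t) (t (Fin.last _)) := rfl

theorem curry_ins {n : ℕ} (v : (T →ₗ[K] N) →ₗ[K] N') (f : Multi K T N (n + 2)) :
    curryEquiv K T N' n (ins (n + 1) v f) = ins n (curryIns v) (curryEquiv K T N (n + 1) f) := by
  simp [ins]

theorem curry_curry_gdelta_zero (L R : T →ₗ[K] Module.End K N) (f : Multi K T N 1) (x y : T) :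
    curryEquiv K T _ 0 (curryEquiv K T N 1 (gdelta 1 L R f)) ![] x y =
      L x (f ![y]) - f ![x * y] + R y (f ![x]) := by
  rw [curry_gdelta, curryEquiv_zero_apply, gdelta_zero_apply]
  simp only [LinearMap.sub_apply, curryL_apply, curryR_apply, curryEquiv_zero_apply]
  simp
  abel

/-- With `D = 0` this is the usual contracting homotopy for coefficients coinduced on the left. In
general `v` is left linear only up to `D` and `w`, and the error is a cup product one degree lower.
The three hypotheses are stable under currying. -/
theorem ins_gdelta {N N' : Type u} [AddCommGroup N] [Module K N] [AddCommGroup N'] [Module K N']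
    {D : T →ₗ[K] N' →ₗ[K] N} {L R : T →ₗ[K] Module.End K N}
    {v : (T →ₗ[K] N) →ₗ[K] N} {w : (T →ₗ[K] N) →ₗ[K] N'}
    (h1 : ∀ y, v (L.flip y) = y) (h2 : ∀ x φ, v (R x ∘ₗ φ) = R x (v φ))
    (h3 : ∀ x φ, v (φ ∘ₗ LinearMap.mulRight K x) = L x (v φ) + D x (w φ))
    {n : ℕ} (f : Multi K T N (n + 1)) :
    ins (n + 1) v (gdelta (n + 1) L R f) + gdelta n L R (ins n v f) = f - cup n D (ins n w f) := by
  induction n generalizing N N' with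
  | zero =>
    ext t
    set φ := curryEquiv K T N 0 f ![] with hφ
    have e1 : ins (0 + 1) v (gdelta (0 + 1) L R f) t =
        v (L.flip (φ (t 0)) - φ ∘ₗ LinearMap.mulRight K (t 0) + R (t 0) ∘ₗ φ) := by
      rw [ins_succ_apply, ins_zero_apply, curryIns_apply]
      congr 1
      ext y
      rw [LinearMap.flip_apply, curry_curry_gdelta_zero]
      simp [hφ, curryEquiv_zero_apply]
    have e2 : f t = φ (t 0) := by
      rw [hφ, curryEquiv_zero_apply]; congr 1; ext i; rw [Fin.eq_zero i]; rfl
    simp only [add_apply, sub_apply, e1, e2, gdelta_zero_apply,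
      cup_zero_apply, ins_zero_apply, ← hφ, map_add, map_sub, h1, h2, h3]
    abel
  | succ n ih =>
    apply multi_ext_snoc
    rw [map_add, curry_ins, curry_gdelta, curry_gdelta, curry_ins, map_sub, curry_cup, curry_ins]
    refine ih (fun φ => ?_) (fun x Φ => ?_) (fun x Φ => ?_) _
    · ext x
      rw [curryIns_apply]
      exact h1 (φ x)
    · ext y
      rw [curryIns_apply, curryR_apply, curryIns_apply, curryIns_apply, ← h2, ← map_sub]
      congr 1
    · ext y
      rw [curryIns_apply, LinearMap.add_apply, curryL_apply, curryCup_apply, curryIns_apply,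
        curryIns_apply, ← h3]
      congr 1

/-- Here `w` is equivariant and kills the first face, so contraction of the first variable is a
chain map up to sign; it turns the error term of `ins_gdelta` into a cocycle. -/
theorem ins_gdelta_neg {N N' : Type u} [AddCommGroup N] [Module K N] [AddCommGroup N']
    [Module K N'] {L R : T →ₗ[K] Module.End K N} {L' R' : T →ₗ[K] Module.End K N'}
    {w : (T →ₗ[K] N) →ₗ[K] N'}
    (h1 : ∀ y, w (L.flip y) = 0) (h2 : ∀ x φ, w (R x ∘ₗ φ) = R' x (w φ))
    (h3 : ∀ x φ, w (φ ∘ₗ LinearMap.mulRight K x) = L' x (w φ))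
    {n : ℕ} (f : Multi K T N (n + 1)) :
    ins (n + 1) w (gdelta (n + 1) L R f) = - gdelta n L' R' (ins n w f) := by
  induction n generalizing N N' with
  | zero =>
    ext t
    set φ := curryEquiv K T N 0 f ![] with hφ
    have e1 : ins (0 + 1) w (gdelta (0 + 1) L R f) t =
        w (L.flip (φ (t 0)) - φ ∘ₗ LinearMap.mulRight K (t 0) + R (t 0) ∘ₗ φ) := by
      rw [ins_succ_apply, ins_zero_apply, curryIns_apply]
      congr 1
      ext y
      rw [LinearMap.flip_apply, curry_curry_gdelta_zero]
      simp [hφ, curryEquiv_zero_apply]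
    simp only [neg_apply, e1, gdelta_zero_apply,
      ins_zero_apply, ← hφ, map_add, map_sub, h1, h2, h3]
    abel
  | succ n ih =>
    apply multi_ext_snoc
    rw [curry_ins, curry_gdelta, map_neg, curry_gdelta, curry_ins]
    refine ih (fun φ => ?_) (fun x Φ => ?_) (fun x Φ => ?_) _
    · ext x
      rw [curryIns_apply]
      exact h1 (φ x)
    · ext y
      rw [curryIns_apply, curryR_apply, curryIns_apply, curryIns_apply, ← h2, ← map_sub]
      congr 1
    · ext y
      rw [curryIns_apply, curryL_apply, curryIns_apply, ← h3]
      congr 1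

end Insertion

section Homotopy

variable {S : Type u} [Ring S] [Algebra K S]

/-- `φ ↦ c ∘ φ ∘ p`. -/
def curryCoeff {N N' : Type u} [AddCommGroup N] [Module K N] [AddCommGroup N'] [Module K N']
    (p : S →ₗ[K] T) (c : N →ₗ[K] N') : (T →ₗ[K] N) →ₗ[K] (S →ₗ[K] N') where
  toFun φ := c ∘ₗ φ ∘ₗ p
  map_add' φ ψ := by ext; simp
  map_smul' k φ := by ext; simp

/-- The homotopy `f ↦ ∑ᵢ (-1)ⁱ c(f(q t₁, …, q tᵢ, e, p tᵢ₊₁, …, p tₙ))`. -/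
def htpy (q p : S →ₗ[K] T) (e : T) : (n : ℕ) → {N N' : Type u} → [AddCommGroup N] →
    [Module K N] → [AddCommGroup N'] → [Module K N'] → (c : N →ₗ[K] N') →
    Multi K T N (n + 1) →ₗ[K] Multi K S N' n
  | 0, N, N', _, _, _, _, c => (nullaryEquiv K S N').toLinearMap ∘ₗ c ∘ₗ LinearMap.applyₗ e ∘ₗ
      (nullaryEquiv K T (T →ₗ[K] N)).symm.toLinearMap ∘ₗ (curryEquiv K T N 0).toLinearMap
  | n + 1, N, N', _, _, _, _, c => (curryEquiv K S N' n).symm.toLinearMap ∘ₗ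
      htpy q p e n (curryCoeff p c) ∘ₗ (curryEquiv K T N (n + 1)).toLinearMap +
      (-1 : K) ^ (n + 1) • multiMap q (c ∘ₗ LinearMap.applyₗ e) (n + 1) ∘ₗ
        (curryEquiv K T N (n + 1)).toLinearMap

theorem htpy_zero_apply {N N' : Type u} [AddCommGroup N] [Module K N] [AddCommGroup N']
    [Module K N'] (q p : S →ₗ[K] T) (e : T) (c : N →ₗ[K] N') (f : Multi K T N 1)
    (t : Fin 0 → S) : htpy q p e 0 c f t = c (f ![e]) := by
  change c (curryEquiv K T N 0 f 0 e) = _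
  rw [curryEquiv_zero_apply]

theorem htpy_succ_apply {N N' : Type u} [AddCommGroup N] [Module K N] [AddCommGroup N']
    [Module K N'] (q p : S →ₗ[K] T) (e : T) (c : N →ₗ[K] N') {n : ℕ} (f : Multi K T N (n + 2))
    (t : Fin (n + 1) → S) : htpy q p e (n + 1) c f t =
      htpy q p e n (curryCoeff p c) (curryEquiv K T N (n + 1) f) (Fin.init t) (t (Fin.last n)) +
      (-1 : K) ^ (n + 1) • c (f (Fin.snoc (fun i => q (t i)) e)) := rfl

theorem curry_htpy {N N' : Type u} [AddCommGroup N] [Module K N] [AddCommGroup N']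
    [Module K N'] (q p : S →ₗ[K] T) (e : T) (c : N →ₗ[K] N') {n : ℕ} (f : Multi K T N (n + 2)) :
    curryEquiv K S N' n (htpy q p e (n + 1) c f) =
      htpy q p e n (curryCoeff p c) (curryEquiv K T N (n + 1) f) +
      (-1 : K) ^ (n + 1) • curryEquiv K S N' n (multiMap q (c ∘ₗ LinearMap.applyₗ e) (n + 1)
        (curryEquiv K T N (n + 1) f)) := by
  simp [htpy]

/-- The prism argument: `q s * e = e * p s` says that `e` intertwines the two algebra maps, so
consecutive terms of the alternating sum cancel and only the ends, `e` in first and in last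
position, survive. -/
theorem gdelta_htpy {N N' : Type u} [AddCommGroup N] [Module K N] [AddCommGroup N']
    [Module K N'] {q p : S →ₗ[K] T} {e : T} {c : N →ₗ[K] N'}
    {L R : T →ₗ[K] Module.End K N} {L' R' : S →ₗ[K] Module.End K N'}
    (hq : ∀ s t, q (s * t) = q s * q t) (hp : ∀ s t, p (s * t) = p s * p t)
    (he : ∀ s, q s * e = e * p s)
    (hL : ∀ s x, c (L (q s) x) = L' s (c x)) (hR : ∀ s x, c (R (p s) x) = R' s (c x))
    {n : ℕ} (f : Multi K T N (n + 1)) :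
    gdelta n L' R' (htpy q p e n c f) + htpy q p e (n + 1) c (gdelta (n + 1) L R f) =
      multiMap p (c ∘ₗ L e) (n + 1) f - multiMap q (c ∘ₗ R e) (n + 1) f := by
  induction n generalizing N N' with
  | zero =>
    ext t
    have e0 : ∀ σ : S →ₗ[K] T, (fun i => σ (t i)) = ![σ (t 0)] := fun σ => by
      ext i; rw [Fin.eq_zero i]; rfl
    have e2 : ∀ x y : T, gdelta 1 L R f ![x, y] = L x (f ![y]) - f ![x * y] + R y (f ![x]) := by
      intro x y
      rw [← curry_curry_gdelta_zero, curryEquiv_zero_apply, curryEquiv_apply]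
      congr 1
      ext i
      fin_cases i <;> rfl
    rw [add_apply, htpy_succ_apply, htpy_zero_apply, gdelta_zero_apply, htpy_zero_apply]
    have e3 : (Fin.snoc (fun i => q (t i)) e : Fin 2 → T) = ![q (t 0), e] := by
      ext i; fin_cases i <;> rfl
    have e4 : curryEquiv K T N 1 (gdelta 1 L R f) ![e] (p (t 0)) = gdelta 1 L R f ![e, p (t 0)] := by
      rw [curryEquiv_apply]
      congr 1
      ext i
      fin_cases i <;> rfl
    change _ + (c (curryEquiv K T N 1 (gdelta 1 L R f) ![e] (p (t 0))) + _) = _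
    rw [e3, e4]
    simp only [sub_apply, multiMap_apply, e0, zero_add, e2, LinearMap.comp_apply]
    simp [hL, hR, he]
    abel
  | succ n ih =>
    apply multi_ext_snoc
    rw [map_add, curry_gdelta, curry_htpy, map_add, curry_htpy, curry_gdelta, map_smul,
      ← curry_gdelta L' R', add_add_add_comm, ih (L' := curryL L') (R' := curryR R')
        (fun s φ => by ext x; simp [curryCoeff, hL]) (fun s φ => by
          ext x; simp [curryCoeff, hR, hp])]
    ext t x
    -- The induction hypothesis covers the terms with `e` before the last variable. The term with
    -- `e` last is an evaluation at `e`, which is not linear for `curryR`; `key` records its defect.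
    set F := curryEquiv K T N (n + 1) f with hF
    have key := gdelta_multiMap_sub (c := c ∘ₗ LinearMap.applyₗ e) (R := curryR R) (R' := R')
      (L := curryL L) (L' := L') hq (fun s φ => by simp [hL]) F (Fin.snoc t x)
    have e0 : ∀ σ : S →ₗ[K] T, (fun i => σ ((Fin.snoc t x : Fin (n + 2) → S) i)) =
        (Fin.snoc (fun i => σ (t i)) (σ x) : Fin (n + 2) → T) := by
      intro σ
      ext i
      refine Fin.lastCases ?_ (fun i => ?_) i <;> simp
    have e2 : curryEquiv K S N' (n + 1) (multiMap q (c ∘ₗ LinearMap.applyₗ e) (n + 2)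
        (gdelta (n + 1) (curryL L) (curryR R) F)) t x =
        c (gdelta (n + 1) (curryL L) (curryR R) F (Fin.snoc (fun i => q (t i)) (q x)) e) := by
      rw [curryEquiv_apply, multiMap_apply, e0]
      rfl
    have e3 : curryEquiv K S N' (n + 1) (multiMap p (c ∘ₗ L e) (n + 2) f -
        multiMap q (c ∘ₗ R e) (n + 2) f) t x =
        c (L e (F (fun i => p (t i)) (p x))) - c (R e (F (fun i => q (t i)) (q x))) := by
      rw [curryEquiv_apply, sub_apply, multiMap_apply, multiMap_apply, e0, e0]
      rfl
    rw [e3]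
    simp only [add_apply, sub_apply, LinearMap.add_apply, LinearMap.sub_apply, smul_apply,
      LinearMap.smul_apply, e2]
    simp only [curryEquiv_apply, key, multiMap_apply, e0, LinearMap.comp_apply,
      Fin.snoc_last, Fin.snoc_castSucc, LinearMap.applyₗ_apply_apply, curryR_apply, curryCoeff,
      LinearMap.coe_mk, AddHom.coe_mk, curryL_apply, map_sub, he, hR, pow_succ (-1 : K) (n + 1)]
    rcases neg_one_pow_eq_or K (n + 1) with h | h <;> rw [h] <;>
      simp only [one_mul, neg_mul, neg_smul, one_smul, neg_neg, mul_neg] <;> abel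

end Homotopy

end Bimodule
end Hochschild

namespace Hochschild

section ModuleActions

variable (K T N : Type u) [CommRing K] [Ring T] [Algebra K T]
  [AddCommGroup N] [Module K N] [Module T N] [Module Tᵐᵒᵖ N]
  [IsScalarTower K T N] [IsScalarTower K Tᵐᵒᵖ N]

/-- The left action of `T` on a bimodule. -/
def leftAct : T →ₗ[K] Module.End K N := (Algebra.lsmul K K N).toLinearMap

/-- The right action of `T` on a bimodule. -/
def rightAct : T →ₗ[K] Module.End K N :=
  (Algebra.lsmul K K N).toLinearMap ∘ₗ (MulOpposite.opLinearEquiv K).toLinearMap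

variable {K T N}

@[simp] theorem leftAct_apply (t : T) (x : N) : leftAct K T N t x = t • x := rfl

@[simp] theorem rightAct_apply (t : T) (x : N) :
    rightAct K T N t x = MulOpposite.op t • x := rfl

theorem delta_eq_gdelta (n : ℕ) (f : Cochain K T N n) :
    delta K T N n f = gdelta n (leftAct K T N) (rightAct K T N) f := by
  ext g
  rw [delta_apply, gdelta_apply]
  rfl

theorem delta_delta [SMulCommClass T Tᵐᵒᵖ N] (n : ℕ) (f : Cochain K T N n) :
    delta K T N (n + 1) (delta K T N n f) = 0 := by
  rw [delta_eq_gdelta, delta_eq_gdelta]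
  refine gdelta_gdelta ⟨fun s t x => ?_, fun s t x => ?_, fun s t x => ?_⟩ f
  · simp [mul_smul]
  · simp [mul_smul]
  · simp [smul_comm]

end ModuleActions

end Hochschild

/-! ### Diagonal form of the cocycles of a triangular algebra -/

namespace Tri

open Hochschild

variable {K A M B : Type u} [CommRing K] [Ring A] [Algebra K A] [Ring B] [Algebra K B]
  [AddCommGroup M] [Module K M] [Module (A ⊗[K] Bᵐᵒᵖ) M] [IsScalarTower K (A ⊗[K] Bᵐᵒᵖ) M]

variable (K A M B) in
/-- The upper left entry. -/
@[simps] def prA : Tri K A M B →ₗ[K] A where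
  toFun := Tri.a
  map_add' _ _ := rfl
  map_smul' _ _ := rfl

variable (K A M B) in
/-- The lower right entry. -/
@[simps] def prB : Tri K A M B →ₗ[K] B where
  toFun := Tri.b
  map_add' _ _ := rfl
  map_smul' _ _ := rfl

variable (K A M B) in
/-- The matrices with only an upper left entry. -/
@[simps] def inA : A →ₗ[K] Tri K A M B where
  toFun a := ⟨a, 0, 0⟩
  map_add' _ _ := by ext <;> simp
  map_smul' _ _ := by ext <;> simp

variable (K A M B) in
/-- The matrices with only an upper right entry. -/
@[simps] def inM : M →ₗ[K] Tri K A M B where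
  toFun m := ⟨0, m, 0⟩
  map_add' _ _ := by ext <;> simp
  map_smul' _ _ := by ext <;> simp

variable (K A M B) in
/-- The matrices with only a lower right entry. -/
@[simps] def inB : B →ₗ[K] Tri K A M B where
  toFun b := ⟨0, 0, b⟩
  map_add' _ _ := by ext <;> simp
  map_smul' _ _ := by ext <;> simp

@[simp] theorem zero_tensor_smul {N : Type*} [AddCommGroup N] [Module (A ⊗[K] Bᵐᵒᵖ) N] (x : N) :
    (0 : A ⊗[K] Bᵐᵒᵖ) • x = 0 :=
  zero_smul (A ⊗[K] Bᵐᵒᵖ) x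

theorem one_tmul_one_smul {N : Type*} [AddCommGroup N] [Module (A ⊗[K] Bᵐᵒᵖ) N] (x : N) :
    ((1 : A) ⊗ₜ[K] (1 : Bᵐᵒᵖ)) • x = x := by
  rw [← Algebra.TensorProduct.one_def, one_smul]

theorem inA_mul (a : A) (t : Tri K A M B) :
    inA K A M B a * t = inA K A M B (a * t.a) + inM K A M B ((a ⊗ₜ[K] (1 : Bᵐᵒᵖ)) • t.m) := by
  ext <;> simp

theorem inM_mul (x : M) (t : Tri K A M B) :
    inM K A M B x * t = inM K A M B (((1 : A) ⊗ₜ[K] MulOpposite.op t.b) • x) := by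
  ext <;> simp

section Diagonal

variable {N : Type u} [AddCommGroup N] [Module K N] {L R : Tri K A M B →ₗ[K] Module.End K N}

/-- A cocycle with coefficients on which both actions factor through `T → A` is cohomologous to
one that depends on the upper left entries only. -/
theorem exists_gdelta_eq_sub_upperLeft (hL : ∀ t x, L (inA K A M B t.a) x = L t x)
    (hR : ∀ t x, R (inA K A M B t.a) x = R t x) (hL1 : ∀ x, L 1 x = x) (hR1 : ∀ x, R 1 x = x)
    {n : ℕ} (f : Multi K (Tri K A M B) N (n + 1)) (hf : gdelta (n + 1) L R f = 0) :
    ∃ g : Multi K (Tri K A M B) N n,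
      f = gdelta n L R g + multiMap (inA K A M B ∘ₗ prA K A M B) LinearMap.id (n + 1) f := by
  -- With `e` the upper left idempotent, `t e` is the upper left part of `t`, so `e` intertwines the
  -- identity with the projection of `T` to that corner. The sign is that of the order of the two
  -- ends in `gdelta_htpy`.
  refine ⟨-htpy LinearMap.id (inA K A M B ∘ₗ prA K A M B) (inA K A M B 1) n LinearMap.id f, ?_⟩
  have h := gdelta_htpy (q := LinearMap.id) (p := inA K A M B ∘ₗ prA K A M B)
    (e := inA K A M B 1) (c := LinearMap.id) (L := L) (R := R) (L' := L) (R' := R)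
    (fun s t => rfl) (fun s t => by ext <;> simp) (fun s => by ext <;> simp)
    (fun s x => rfl) (fun s x => hR s x) f
  rw [hf, map_zero, add_zero] at h
  rw [map_neg, h, neg_sub, ← sub_eq_iff_eq_add]
  have e1 : ∀ x, L (inA K A M B 1) x = x := fun x => (hL 1 x).trans (hL1 x)
  have e2 : ∀ x, R (inA K A M B 1) x = x := fun x => (hR 1 x).trans (hR1 x)
  ext t
  simp only [sub_apply, multiMap_apply, LinearMap.comp_apply, e1, e2, LinearMap.id_apply]

/-- A cocycle with coefficients on which both actions factor through `T → B` is cohomologous to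
one that depends on the lower right entries only. -/
theorem exists_gdelta_eq_sub_lowerRight (hL : ∀ t x, L (inB K A M B t.b) x = L t x)
    (hR : ∀ t x, R (inB K A M B t.b) x = R t x) (hL1 : ∀ x, L 1 x = x) (hR1 : ∀ x, R 1 x = x)
    {n : ℕ} (f : Multi K (Tri K A M B) N (n + 1)) (hf : gdelta (n + 1) L R f = 0) :
    ∃ g : Multi K (Tri K A M B) N n,
      f = gdelta n L R g + multiMap (inB K A M B ∘ₗ prB K A M B) LinearMap.id (n + 1) f := by
  -- Now `e t` is the lower right part of `t`, so the roles of the two algebra maps, and the sign,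
  -- are exchanged.
  refine ⟨htpy (inB K A M B ∘ₗ prB K A M B) LinearMap.id (inB K A M B 1) n LinearMap.id f, ?_⟩
  have h := gdelta_htpy (q := inB K A M B ∘ₗ prB K A M B) (p := LinearMap.id)
    (e := inB K A M B 1) (c := LinearMap.id) (L := L) (R := R) (L' := L) (R' := R)
    (fun s t => by ext <;> simp) (fun s t => rfl) (fun s => by ext <;> simp)
    (fun s x => hL s x) (fun s x => rfl) f
  rw [hf, map_zero, add_zero] at h
  rw [h, ← sub_eq_iff_eq_add]
  have e1 : ∀ x, L (inB K A M B 1) x = x := fun x => (hL 1 x).trans (hL1 x)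
  have e2 : ∀ x, R (inB K A M B 1) x = x := fun x => (hR 1 x).trans (hR1 x)
  ext t
  simp only [sub_apply, multiMap_apply, LinearMap.comp_apply, e1, e2, LinearMap.id_apply]

end Diagonal

section Normalization

variable (K A M B) in
/-- Left multiplication by upper left entries. -/
def leftA : Tri K A M B →ₗ[K] Module.End K A := LinearMap.mul K A ∘ₗ prA K A M B

variable (K A M B) in
/-- Right multiplication by upper left entries. -/
def rightA : Tri K A M B →ₗ[K] Module.End K A := (LinearMap.mul K A).flip ∘ₗ prA K A M B

variable (K A M B) in
/-- Left multiplication by lower right entries. -/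
def leftB : Tri K A M B →ₗ[K] Module.End K B := LinearMap.mul K B ∘ₗ prB K A M B

variable (K A M B) in
/-- Right multiplication by lower right entries. -/
def rightB : Tri K A M B →ₗ[K] Module.End K B := (LinearMap.mul K B).flip ∘ₗ prB K A M B

theorem gdelta_prA {n : ℕ} (f : Cochain K (Tri K A M B) (Tri K A M B) n) :
    gdelta n (leftA K A M B) (rightA K A M B) (multiMap LinearMap.id (prA K A M B) n f) =
      multiMap LinearMap.id (prA K A M B) (n + 1) (delta K _ _ n f) := by
  rw [delta_eq_gdelta]
  exact gdelta_multiMap (fun _ _ => rfl) (fun _ _ => rfl) (fun _ _ => rfl) f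

theorem gdelta_prB {n : ℕ} (f : Cochain K (Tri K A M B) (Tri K A M B) n) :
    gdelta n (leftB K A M B) (rightB K A M B) (multiMap LinearMap.id (prB K A M B) n f) =
      multiMap LinearMap.id (prB K A M B) (n + 1) (delta K _ _ n f) := by
  rw [delta_eq_gdelta]
  exact gdelta_multiMap (fun _ _ => rfl) (fun _ _ => rfl) (fun _ _ => rfl) f

/-- A cochain whose diagonal entries only depend on the corresponding entries of the arguments. -/
def IsDiagonal {n : ℕ} (f : Cochain K (Tri K A M B) (Tri K A M B) n) : Prop :=
  (∀ t, (f t).a = (f fun i => inA K A M B (t i).a).a) ∧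
    ∀ t, (f t).b = (f fun i => inB K A M B (t i).b).b

/-- Every cocycle of positive degree is cohomologous to a diagonal one. -/
theorem exists_isDiagonal {n : ℕ} (f : Cochain K (Tri K A M B) (Tri K A M B) (n + 1))
    (hf : delta K _ _ (n + 1) f = 0) :
    ∃ g : Cochain K (Tri K A M B) (Tri K A M B) n, IsDiagonal (f - delta K _ _ n g) := by
  obtain ⟨gA, hA⟩ := exists_gdelta_eq_sub_upperLeft (L := leftA K A M B) (R := rightA K A M B)
    (fun _ _ => rfl) (fun _ _ => rfl) (fun x => one_mul x) (fun x => mul_one x)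
    (multiMap LinearMap.id (prA K A M B) (n + 1) f) (by rw [gdelta_prA, hf, map_zero])
  obtain ⟨gB, hB⟩ := exists_gdelta_eq_sub_lowerRight (L := leftB K A M B) (R := rightB K A M B)
    (fun _ _ => rfl) (fun _ _ => rfl) (fun x => one_mul x) (fun x => mul_one x)
    (multiMap LinearMap.id (prB K A M B) (n + 1) f) (by rw [gdelta_prB, hf, map_zero])
  -- Taking the `A`-entry and taking the `B`-entry both commute with the coboundary, so the two
  -- corrections can be made at once, one in each diagonal corner.
  let g : Cochain K (Tri K A M B) (Tri K A M B) n :=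
    multiMap LinearMap.id (inA K A M B) n gA + multiMap LinearMap.id (inB K A M B) n gB
  have gA' : multiMap LinearMap.id (prA K A M B) n g = gA := by ext t; simp [g]
  have gB' : multiMap LinearMap.id (prB K A M B) n g = gB := by ext t; simp [g]
  rw [← gA', gdelta_prA] at hA
  rw [← gB', gdelta_prB] at hB
  have hA' : ∀ t, (f t).a - (delta K _ _ n g t).a = (f fun i => inA K A M B (t i).a).a := fun t =>
    sub_eq_iff_eq_add'.2 (congrArg (fun h => h t) hA)
  have hB' : ∀ t, (f t).b - (delta K _ _ n g t).b = (f fun i => inB K A M B (t i).b).b := fun t =>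
    sub_eq_iff_eq_add'.2 (congrArg (fun h => h t) hB)
  -- The corrected entry at `t` is the value of `f` on the corner parts of `t`. The same formula at
  -- these parts, which are their own corner parts, gives the same value.
  exact ⟨g, fun t => (hA' t).trans (hA' fun i => inA K A M B (t i).a).symm,
    fun t => (hB' t).trans (hB' fun i => inB K A M B (t i).b).symm⟩

end Normalization

section Generic

variable {T N N' : Type u} [Ring T] [Algebra K T] [AddCommGroup N] [Module K N] [AddCommGroup N']
  [Module K N'] {L R : T →ₗ[K] Module.End K N} {L' R' : T →ₗ[K] Module.End K N'}

theorem exists_gdelta_eq_add {n : ℕ} {f f' : Multi K T N (n + 1)} (hf : ∃ g, gdelta n L R g = f)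
    (hf' : ∃ g, gdelta n L R g = f') : ∃ g, gdelta n L R g = f + f' := by
  obtain ⟨g, rfl⟩ := hf
  obtain ⟨g', rfl⟩ := hf'
  exact ⟨g + g', map_add _ _ _⟩

theorem eq_gdelta_ins_add_cup {D : T →ₗ[K] N' →ₗ[K] N} {v : (T →ₗ[K] N) →ₗ[K] N}
    {w : (T →ₗ[K] N) →ₗ[K] N'}
    (h1 : ∀ y, v (L.flip y) = y) (h2 : ∀ x φ, v (R x ∘ₗ φ) = R x (v φ))
    (h3 : ∀ x φ, v (φ ∘ₗ LinearMap.mulRight K x) = L x (v φ) + D x (w φ))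
    {n : ℕ} (f : Multi K T N (n + 1)) (hf : gdelta (n + 1) L R f = 0) :
    f = gdelta n L R (ins n v f) + cup n D (ins n w f) := by
  have := ins_gdelta h1 h2 h3 f
  rw [hf, map_zero, zero_add] at this
  rw [this, sub_add_cancel]

theorem gdelta_ins_eq_zero {w : (T →ₗ[K] N) →ₗ[K] N'}
    (h1 : ∀ y, w (L.flip y) = 0) (h2 : ∀ x φ, w (R x ∘ₗ φ) = R' x (w φ))
    (h3 : ∀ x φ, w (φ ∘ₗ LinearMap.mulRight K x) = L' x (w φ))
    {n : ℕ} (f : Multi K T N (n + 1)) (hf : gdelta (n + 1) L R f = 0) :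
    gdelta n L' R' (ins n w f) = 0 := by
  have := ins_gdelta_neg h1 h2 h3 f
  rw [hf, map_zero] at this
  exact neg_eq_zero.1 this.symm

theorem exists_gdelta_eq_cup {D : T →ₗ[K] N' →ₗ[K] N}
    (hL : ∀ s t x, D (s * t) x = L s (D t x) + D s (L' t x))
    (hR : ∀ s t x, R s (D t x) = D t (R' s x)) {n : ℕ} (g : Multi K T N' n) :
    ∃ h, gdelta (n + 1) L R h = cup (n + 1) D (gdelta n L' R' g) :=
  ⟨-cup n D g, by rw [map_neg, gdelta_cup hL hR, neg_neg]⟩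

end Generic

/-! ### Cohomology with coinduced coefficients -/

section Coinduced

variable (V : Type u) [AddCommGroup V] [Module K V]

variable (K A M B) in
/-- `t ↦ (a ↦ a t)`, where the upper right entry of the matrix `t` acts. -/
def mulM : Tri K A M B →ₗ[K] A →ₗ[K] M :=
  LinearMap.mk₂ K (fun t a => (a ⊗ₜ[K] (1 : Bᵐᵒᵖ)) • t.m) (by intros; simp)
    (by intro k t a; exact smul_comm _ k t.m)
    (by intros; simp [TensorProduct.add_tmul, add_smul])
    (by intros; simp [← TensorProduct.smul_tmul'])

variable (K A M B) in
/-- The right action of `t` on `M` through the lower right entry. -/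
def actM : Tri K A M B →ₗ[K] M →ₗ[K] M :=
  LinearMap.mk₂ K (fun t x => ((1 : A) ⊗ₜ[K] MulOpposite.op t.b) • x)
    (by intros; simp [TensorProduct.tmul_add, add_smul])
    (by intros; simp) (by intros; simp) (by intro k t x; exact smul_comm _ k x)

@[simp] theorem mulM_apply (t : Tri K A M B) (a : A) :
    mulM K A M B t a = (a ⊗ₜ[K] (1 : Bᵐᵒᵖ)) • t.m := rfl

@[simp] theorem actM_apply (t : Tri K A M B) (x : M) :
    actM K A M B t x = ((1 : A) ⊗ₜ[K] MulOpposite.op t.b) • x := rfl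

/-- Precomposition in the first variable. -/
def precomp {T X Y W : Type u} [AddCommGroup T] [Module K T] [AddCommGroup X] [Module K X]
    [AddCommGroup Y] [Module K Y] [AddCommGroup W] [Module K W] (μ : T →ₗ[K] X →ₗ[K] Y) :
    T →ₗ[K] (Y →ₗ[K] W) →ₗ[K] (X →ₗ[K] W) :=
  LinearMap.mk₂ K (fun t g => g ∘ₗ μ t) (by intros; ext; simp) (by intros; ext; simp)
    (by intros; ext; simp) (by intros; ext; simp)

@[simp] theorem precomp_apply {T X Y W : Type u} [AddCommGroup T] [Module K T] [AddCommGroup X]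
    [Module K X] [AddCommGroup Y] [Module K Y] [AddCommGroup W] [Module K W]
    (μ : T →ₗ[K] X →ₗ[K] Y) (t : T) (g : Y →ₗ[K] W) (x : X) : precomp μ t g x = g (μ t x) := rfl

/-- Precomposition in the second variable. -/
def precomp₂ {T X Y Z W : Type u} [AddCommGroup T] [Module K T] [AddCommGroup X] [Module K X]
    [AddCommGroup Y] [Module K Y] [AddCommGroup Z] [Module K Z] [AddCommGroup W] [Module K W]
    (ν : T →ₗ[K] Y →ₗ[K] Z) : T →ₗ[K] (X →ₗ[K] Z →ₗ[K] W) →ₗ[K] (X →ₗ[K] Y →ₗ[K] W) :=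
  LinearMap.mk₂ K (fun t g => g.compl₂ (ν t)) (by intros; ext; simp) (by intros; ext; simp)
    (by intros; ext; simp) (by intros; ext; simp)

@[simp] theorem precomp₂_apply {T X Y Z W : Type u} [AddCommGroup T] [Module K T]
    [AddCommGroup X] [Module K X] [AddCommGroup Y] [Module K Y] [AddCommGroup Z] [Module K Z]
    [AddCommGroup W] [Module K W] (ν : T →ₗ[K] Y →ₗ[K] Z) (t : T) (g : X →ₗ[K] Z →ₗ[K] W)
    (x : X) (y : Y) : precomp₂ ν t g x y = g x (ν t y) := rfl

variable (K A M B) in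
/-- The right action of `T` on a space of bilinear maps `X × B → V` through `T → B`. -/
def coindR (X : Type u) [AddCommGroup X] [Module K X] :
    Tri K A M B →ₗ[K] Module.End K (X →ₗ[K] B →ₗ[K] V) :=
  precomp₂ (leftB K A M B)

variable (K A M B) in
/-- The left action of `T` on the space of bilinear maps `A × B → V` through `T → A`. -/
def coindA : Tri K A M B →ₗ[K] Module.End K (A →ₗ[K] B →ₗ[K] V) := precomp (rightA K A M B)

variable (K A M B) in
/-- The left action of `T` on the space of bilinear maps `M × B → V` through `T → B`. -/
def coindM : Tri K A M B →ₗ[K] Module.End K (M →ₗ[K] B →ₗ[K] V) := precomp (actM K A M B)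

variable (K A M B) in
/-- Composition with an insertion in the first variable. -/
def evalFirst (X : Type u) [AddCommGroup X] [Module K X] (i : X →ₗ[K] Tri K A M B) :
    (Tri K A M B →ₗ[K] A →ₗ[K] B →ₗ[K] V) →ₗ[K] (X →ₗ[K] B →ₗ[K] V) where
  toFun φ := (φ ∘ₗ i).flip 1
  map_add' φ ψ := by ext; simp
  map_smul' k φ := by ext; simp

@[simp] theorem evalFirst_apply (X : Type u) [AddCommGroup X] [Module K X]
    (i : X →ₗ[K] Tri K A M B) (φ : Tri K A M B →ₗ[K] A →ₗ[K] B →ₗ[K] V) (x : X) (b : B) :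
    evalFirst K A M B V X i φ x b = φ (i x) 1 b := rfl

variable (K A M B) in
/-- Composition with an insertion in the last variable. -/
def evalLast : (Tri K A M B →ₗ[K] M →ₗ[K] B →ₗ[K] V) →ₗ[K] (M →ₗ[K] B →ₗ[K] V) where
  toFun φ := LinearMap.mk₂ K (fun m b => φ (inB K A M B b) m 1) (by intros; simp)
    (by intros; simp) (by intros; rw [map_add, map_add]; rfl)
    (by intros; rw [map_smul, map_smul]; rfl)
  map_add' φ ψ := by ext; simp
  map_smul' k φ := by ext; simp

@[simp] theorem evalLast_apply (φ : Tri K A M B →ₗ[K] M →ₗ[K] B →ₗ[K] V) (m : M) (b : B) :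
    evalLast K A M B V φ m b = φ (inB K A M B b) m 1 := rfl

variable {V}

/-- Both actions factor through `T → B`, so only lower right entries matter. The right action is
coinduced, and moving the `B`-argument into the last variable, as `evalLast` does, is then a
contraction up to sign. -/
theorem exists_gdelta_eq_of_coindM {n : ℕ}
    (f : Multi K (Tri K A M B) (M →ₗ[K] B →ₗ[K] V) (n + 1))
    (hf : gdelta (n + 1) (coindM K A M B V) (coindR K A M B V M) f = 0) :
    ∃ g, gdelta n (coindM K A M B V) (coindR K A M B V M) g = f := by
  obtain ⟨g, hg⟩ := exists_gdelta_eq_sub_lowerRight (L := coindM K A M B V)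
    (R := coindR K A M B V M) (fun t x => by ext; simp [coindM])
    (fun t x => by ext; simp [coindR, leftB])
    (fun x => by ext; simp [coindM, one_tmul_one_smul])
    (fun x => by ext; simp [coindR, leftB]) f hf
  set h := multiMap (inB K A M B ∘ₗ prB K A M B) LinearMap.id (n + 1) f with hh
  have hh0 : gdelta (n + 1) (coindM K A M B V) (coindR K A M B V M) h = 0 := by
    rw [hh, gdelta_multiMap (L := coindM K A M B V) (R := coindR K A M B V M)
      (fun s t => by ext <;> simp)
      (fun t x => by ext; simp [coindM]) (fun t x => by ext; simp [coindR, leftB]), hf, map_zero]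
  have key : gdelta n (coindM K A M B V) (coindR K A M B V M)
      ((-1 : K) ^ (n + 1) • multiMap LinearMap.id (evalLast K A M B V) n
        (curryEquiv K _ _ n h)) = h := by
    rw [map_smul]
    ext t m b
    rw [smul_apply, gdelta_multiMap_sub (σ := LinearMap.id)
      (L := curryL (coindM K A M B V)) (R := curryR (coindR K A M B V M)) (fun _ _ => rfl)
      (fun s x => by ext; simp [coindM]), ← curry_gdelta, hh0]
    -- The product `s * inB b` still has a corner entry, but `h` sees lower right entries only.
    -- Hence two of the three terms in the defect cancel and `h t` itself remains.
    have e : ∀ (s : Tri K A M B) b, h (Fin.snoc (fun i => t i.castSucc) (s * inB K A M B b)) =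
        h (Fin.snoc (fun i => t i.castSucc) (inB K A M B (s.b * b))) := by
      intro s b
      simp only [hh, multiMap_apply]
      congr 2
      ext i : 1
      refine Fin.lastCases ?_ (fun i => ?_) i <;> simp
    have e' : (Fin.snoc (fun i => t i.castSucc) (t (Fin.last n)) : Fin (n + 1) → _) = t :=
      Fin.snoc_init_self t
    have e'' : (-1 : K) ^ (n + 1) * (-1) ^ (n + 1) = 1 := by rw [← mul_pow]; simp
    simp [curryEquiv_apply, coindR, leftB, e, e', smul_smul, e'']
  rw [hg]
  exact exists_gdelta_eq_add ⟨g, rfl⟩ ⟨_, key⟩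

/-- The contraction inserts `inA a` in the first variable and puts `1` for the `A`-argument. It is
not left linear: `inA a * t` has, besides its upper left part, the corner entry `a t.m`. The error
is the cup product of `mulM` with the insertion of corner matrices, which is again a cocycle. -/
theorem coind_decomposition {n : ℕ}
    (f : Multi K (Tri K A M B) (A →ₗ[K] B →ₗ[K] V) (n + 1))
    (hf : gdelta (n + 1) (coindA K A M B V) (coindR K A M B V A) f = 0) :
    ∃ (g : Multi K (Tri K A M B) (A →ₗ[K] B →ₗ[K] V) n)
      (h : Multi K (Tri K A M B) (M →ₗ[K] B →ₗ[K] V) n),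
      gdelta n (coindM K A M B V) (coindR K A M B V M) h = 0 ∧
      f = gdelta n (coindA K A M B V) (coindR K A M B V A) g +
        cup n (precomp (mulM K A M B)) h := by
  refine ⟨ins n (evalFirst K A M B V A (inA K A M B)) f,
    ins n (evalFirst K A M B V M (inM K A M B)) f, ?_, ?_⟩
  · exact gdelta_ins_eq_zero (L := coindA K A M B V) (R := coindR K A M B V A)
      (fun y => by ext; simp [coindA, rightA]) (fun x φ => by ext; simp [coindR, leftB])
      (fun x φ => by ext; simp [coindM, inM_mul]) f hf
  · exact eq_gdelta_ins_add_cup (fun y => by ext; simp [coindA, rightA])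
      (fun x φ => by ext; simp [coindR, leftB])
      (fun x φ => by ext; simp [coindA, rightA, inA_mul]) f hf

/-- From degree 2 on, the cocycle `h` of the decomposition has positive degree, hence bounds. Its
cup product with `mulM` then bounds too, `mulM` being a derivation by the product rule for corner
entries. Dually, `Torₖ(A, B) = 0` for `k ≥ 2`. -/
theorem exists_gdelta_eq_of_coindA {n : ℕ}
    (f : Multi K (Tri K A M B) (A →ₗ[K] B →ₗ[K] V) (n + 2))
    (hf : gdelta (n + 2) (coindA K A M B V) (coindR K A M B V A) f = 0) :
    ∃ g, gdelta (n + 1) (coindA K A M B V) (coindR K A M B V A) g = f := by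
  obtain ⟨g, h, hh, rfl⟩ := coind_decomposition f hf
  obtain ⟨h', rfl⟩ := exists_gdelta_eq_of_coindM h hh
  refine exists_gdelta_eq_add ⟨g, rfl⟩ (exists_gdelta_eq_cup (fun s t x => ?_) (fun s t x => ?_) h')
  · ext a b
    simp [coindA, coindM, rightA, ← mul_smul]
  · ext a b
    simp [coindR]

/-- In degree 1 the cocycle `h` has degree 0 and need not bound: it is a bilinear map `g` on `M × B`
balanced over `B`, determined by the linear map `g(·, 1)` on `M`. Dually, `Tor₁(A, B) = M`. -/
theorem exists_of_coindA_one (f : Multi K (Tri K A M B) (A →ₗ[K] B →ₗ[K] V) 1)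
    (hf : gdelta 1 (coindA K A M B V) (coindR K A M B V A) f = 0) :
    ∃ (y : A →ₗ[K] B →ₗ[K] V) (g : M →ₗ[K] B →ₗ[K] V),
      (∀ (m : M) (b b' : B), g (((1 : A) ⊗ₜ[K] MulOpposite.op b') • m) b = g m (b' * b)) ∧
      ∀ t a b, f ![t] a b = y (a * t.a) b - y a (t.b * b) +
        g ((a ⊗ₜ[K] (1 : Bᵐᵒᵖ)) • t.m) b := by
  obtain ⟨g, h, hh, rfl⟩ := coind_decomposition f hf
  refine ⟨g ![], h ![], fun m b b' => ?_, fun t a b => ?_⟩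
  · have := congrArg (fun k => k ![inB K A M B b'] m b) hh
    simp only [gdelta_zero_apply] at this
    exact sub_eq_zero.1 this
  · rw [add_apply, gdelta_zero_apply, cup_zero_apply]
    rfl

end Coinduced

end Tri

/-! ### Lifting of cochains, and inflated bimodules -/

namespace Hochschild

/-- As `T` is projective, postcomposition with `p` is again surjective on linear maps from `T`, so
the variables can be treated one at a time. -/
theorem exists_comp_eq_multi {K T : Type u} [CommRing K] [Ring T] [Algebra K T]
    [Module.Projective K T] {N N' : Type u} [AddCommGroup N] [Module K N] [AddCommGroup N']
    [Module K N'] (p : N →ₗ[K] N') (hp : Function.Surjective p) {n : ℕ} (f : Multi K T N' n) :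
    ∃ g : Multi K T N n, ∀ t, p (g t) = f t := by
  induction n generalizing N N' with
  | zero =>
    obtain ⟨y, hy⟩ := hp (f ![])
    refine ⟨nullaryEquiv K T N y, fun t => ?_⟩
    rw [Subsingleton.elim t ![]]
    exact hy
  | succ n ih =>
    obtain ⟨g, hg⟩ := ih (LinearMap.llcomp K T N N' p)
      (fun φ => Module.projective_lifting_property p φ hp) (curryEquiv K T N' n f)
    refine ⟨(curryEquiv K T N n).symm g, fun t => ?_⟩
    have := congrArg (fun φ => φ (t (Fin.last n))) (hg (Fin.init t))
    rw [curryEquiv_apply, Fin.snoc_init_self] at this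
    exact this

end Hochschild

open Hochschild

namespace Infl

section

variable {K A M B N N' : Type u} [CommRing K] [Ring A] [Algebra K A] [Ring B] [Algebra K B]
  [AddCommGroup M] [Module K M] [Module (A ⊗[K] Bᵐᵒᵖ) M] [IsScalarTower K (A ⊗[K] Bᵐᵒᵖ) M]
  [AddCommGroup N] [Module (A ⊗[K] Bᵐᵒᵖ) N] [AddCommGroup N'] [Module (A ⊗[K] Bᵐᵒᵖ) N']

instance : IsScalarTower K (A ⊗[K] Bᵐᵒᵖ) (Infl K A M B N) where
  smul_assoc k r x := by rw [scalar_smul_def, ← mul_smul, ← Algebra.smul_def]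

theorem smul_op_smul (t s : Tri K A M B) (x : Infl K A M B N) :
    t • MulOpposite.op s • x = (t.a ⊗ₜ[K] MulOpposite.op s.b) • x := by
  rw [op_smul_def, smul_def, ← mul_smul]
  simp

instance : SMulCommClass (Tri K A M B) (Tri K A M B)ᵐᵒᵖ (Infl K A M B N) where
  smul_comm t s x := by
    induction s using MulOpposite.rec' with
    | _ s =>
    rw [smul_op_smul, op_smul_def, smul_def, ← mul_smul]
    simp

variable (K A M B N) in
/-- The identity map from the inflated bimodule to the original module. -/
def equiv : Infl K A M B N ≃ₗ[A ⊗[K] Bᵐᵒᵖ] N :=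
  { AddEquiv.refl N with map_smul' := fun _ _ => rfl }

theorem equiv_smul (t : Tri K A M B) (x : Infl K A M B N) :
    equiv K A M B N (t • x) = (t.a ⊗ₜ[K] (1 : Bᵐᵒᵖ)) • equiv K A M B N x := rfl

theorem equiv_op_smul (t : Tri K A M B) (x : Infl K A M B N) :
    equiv K A M B N (MulOpposite.op t • x) =
      ((1 : A) ⊗ₜ[K] MulOpposite.op t.b) • equiv K A M B N x := rfl

theorem equiv_scalar_smul (k : K) (x : Infl K A M B N) :
    equiv K A M B N (k • x) = algebraMap K (A ⊗[K] Bᵐᵒᵖ) k • equiv K A M B N x := rfl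

theorem equiv_symm_scalar_smul [Module K N] [IsScalarTower K (A ⊗[K] Bᵐᵒᵖ) N] (k : K) (x : N) :
    (equiv K A M B N).symm (k • x) = k • (equiv K A M B N).symm x := by
  rw [← algebraMap_smul (A ⊗[K] Bᵐᵒᵖ) k x]; rfl

/-- A morphism of `A ⊗ Bᵒᵖ`-modules as a `K`-linear map. -/
def mapK (g : N →ₗ[A ⊗[K] Bᵐᵒᵖ] N') : Infl K A M B N →ₗ[K] Infl K A M B N' where
  toFun x := (equiv K A M B N').symm (g (equiv K A M B N x))
  map_add' x y := by simp
  map_smul' k x := g.map_smul (algebraMap K (A ⊗[K] Bᵐᵒᵖ) k) (equiv K A M B N x)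

/-- Postcomposition of cochains with a morphism of `A ⊗ Bᵒᵖ`-modules. -/
def push (g : N →ₗ[A ⊗[K] Bᵐᵒᵖ] N') (n : ℕ) :
    Cochain K (Tri K A M B) (Infl K A M B N) n →ₗ[K]
      Cochain K (Tri K A M B) (Infl K A M B N') n where
  toFun f := (mapK g).compMultilinearMap f
  map_add' f f' := by ext; simp
  map_smul' k f := by ext; simp

theorem push_apply (g : N →ₗ[A ⊗[K] Bᵐᵒᵖ] N') {n : ℕ}
    (f : Cochain K (Tri K A M B) (Infl K A M B N) n) (t : Fin n → Tri K A M B) :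
    push g n f t = mapK g (f t) := rfl

theorem equiv_push (g : N →ₗ[A ⊗[K] Bᵐᵒᵖ] N') {n : ℕ}
    (f : Cochain K (Tri K A M B) (Infl K A M B N) n) (t : Fin n → Tri K A M B) :
    equiv K A M B N' (push g n f t) = g (equiv K A M B N (f t)) := rfl

theorem delta_push (g : N →ₗ[A ⊗[K] Bᵐᵒᵖ] N') {n : ℕ}
    (f : Cochain K (Tri K A M B) (Infl K A M B N) n) :
    delta K _ _ n (push g n f) = push g (n + 1) (delta K _ _ n f) := by
  have hl : ∀ (t : Tri K A M B) (x : Infl K A M B N), t • mapK g x = mapK g (t • x) :=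
    fun t x => (g.map_smul _ (equiv K A M B N x)).symm
  have hr : ∀ (t : Tri K A M B) (x : Infl K A M B N),
      MulOpposite.op t • mapK g x = mapK g (MulOpposite.op t • x) :=
    fun t x => (g.map_smul _ (equiv K A M B N x)).symm
  ext t
  simp only [push_apply, delta_apply, hl, hr, map_add, map_sum, map_smul]

theorem equiv_delta {n : ℕ} (f : Cochain K (Tri K A M B) (Infl K A M B N) n) (g : N →ₗ[A ⊗[K] Bᵐᵒᵖ] N')
    (t : Fin (n + 1) → Tri K A M B) :
    g (equiv K A M B N (delta K _ _ n f t)) =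
      equiv K A M B N' (delta K _ _ n (push g n f) t) := by
  rw [delta_push, equiv_push]

variable (K A M B) in
/-- The projection to the upper right entry as a cochain. -/
def corner : Cochain K (Tri K A M B) (Infl K A M B M) 1 where
  toFun t := (equiv K A M B M).symm (t 0).m
  map_update_add' := by
    intro _ t i x y
    rw [Fin.eq_zero i]
    simp only [Function.update_self, Tri.add_m, map_add]
  map_update_smul' := by
    intro _ t i k x
    rw [Fin.eq_zero i]
    simp only [Function.update_self, Tri.smul_m, equiv_symm_scalar_smul]

theorem equiv_corner (t : Fin 1 → Tri K A M B) :
    equiv K A M B M (corner K A M B t) = (t 0).m := rfl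

theorem delta_one_apply {T N : Type u} [Ring T] [Algebra K T] [AddCommGroup N] [Module K N]
    [Module T N] [Module Tᵐᵒᵖ N] [IsScalarTower K T N] [IsScalarTower K Tᵐᵒᵖ N]
    (f : Cochain K T N 1) (t : Fin 2 → T) :
    delta K T N 1 f t = t 0 • f ![t 1] - f ![t 0 * t 1] + MulOpposite.op (t 1) • f ![t 0] := by
  have h1 : Fin.tail t = ![t 1] := by ext i; rw [Fin.eq_zero i]; rfl
  have h2 : Fin.init t = ![t 0] := by ext i; rw [Fin.eq_zero i]; rfl
  have h3 : Fin.contractNth 0 (· * ·) t = ![t 0 * t 1] := by ext i; rw [Fin.eq_zero i]; rfl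
  rw [delta_apply, h1, h2]
  simp [h3, sub_eq_add_neg]

theorem delta_corner : delta K _ _ 1 (corner K A M B) = 0 := by
  ext t
  apply (equiv K A M B M).injective
  rw [delta_one_apply]
  simp only [map_add, map_sub, equiv_corner, equiv_smul, equiv_op_smul]
  change _ - (t 0 * t 1).m + _ = 0
  simp

end

end Infl

/-! ### The bar complex representing cochains with inflated coefficients -/

namespace Tri

section BarResolution

variable (K A M B : Type u) [CommRing K] [Ring A] [Algebra K A] [Ring B] [Algebra K B]
  [AddCommGroup M] [Module K M] [Module (A ⊗[K] Bᵐᵒᵖ) M] [IsScalarTower K (A ⊗[K] Bᵐᵒᵖ) M]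

/-- The `A ⊗ Bᵒᵖ`-module that represents the Hochschild `n`-cochains of `T = [A M; 0 B]` with
coefficients in inflated modules. -/
def Bar (n : ℕ) : Type u := (A ⊗[K] Bᵐᵒᵖ) ⊗[K] (⨂[K] (_ : Fin n), Tri K A M B)

noncomputable instance (n : ℕ) : AddCommGroup (Bar K A M B n) :=
  inferInstanceAs (AddCommGroup ((A ⊗[K] Bᵐᵒᵖ) ⊗[K] (⨂[K] (_ : Fin n), Tri K A M B)))

noncomputable instance (n : ℕ) : Module (A ⊗[K] Bᵐᵒᵖ) (Bar K A M B n) :=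
  inferInstanceAs
    (Module (A ⊗[K] Bᵐᵒᵖ) ((A ⊗[K] Bᵐᵒᵖ) ⊗[K] (⨂[K] (_ : Fin n), Tri K A M B)))

noncomputable instance (n : ℕ) : Module K (Bar K A M B n) :=
  inferInstanceAs (Module K ((A ⊗[K] Bᵐᵒᵖ) ⊗[K] (⨂[K] (_ : Fin n), Tri K A M B)))

instance (n : ℕ) : IsScalarTower K (A ⊗[K] Bᵐᵒᵖ) (Bar K A M B n) :=
  inferInstanceAs
    (IsScalarTower K (A ⊗[K] Bᵐᵒᵖ) ((A ⊗[K] Bᵐᵒᵖ) ⊗[K] (⨂[K] (_ : Fin n), Tri K A M B)))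

/-- The pure tensors. -/
noncomputable def Bar.mk {n : ℕ} (r : A ⊗[K] Bᵐᵒᵖ) (t : Fin n → Tri K A M B) :
    Bar K A M B n :=
  (r ⊗ₜ[K] PiTensorProduct.tprod K t : (A ⊗[K] Bᵐᵒᵖ) ⊗[K] (⨂[K] (_ : Fin n), Tri K A M B))

/-- The generators of the module `Bar K A M B n`. -/
noncomputable def gen (n : ℕ) : Multi K (Tri K A M B) (Bar K A M B n) n where
  toFun t := Bar.mk K A M B 1 t
  map_update_add' t i x y :=
    ((congrArg (fun y => (1 : A ⊗[K] Bᵐᵒᵖ) ⊗ₜ[K] y)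
      ((PiTensorProduct.tprod K).map_update_add t i x y)).trans (TensorProduct.tmul_add _ _ _) :)
  map_update_smul' t i k x :=
    ((congrArg (fun y => (1 : A ⊗[K] Bᵐᵒᵖ) ⊗ₜ[K] y)
      ((PiTensorProduct.tprod K).map_update_smul t i k x)).trans (TensorProduct.tmul_smul _ _ _) :)

theorem smul_gen {n : ℕ} (r : A ⊗[K] Bᵐᵒᵖ) (t : Fin n → Tri K A M B) :
    r • gen K A M B n t = Bar.mk K A M B r t := by
  change r • ((1 : A ⊗[K] Bᵐᵒᵖ) ⊗ₜ[K] PiTensorProduct.tprod K t) = _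
  rw [TensorProduct.smul_tmul', smul_eq_mul, mul_one]
  rfl

/-- The universal cochain. -/
noncomputable def univ (n : ℕ) : Cochain K (Tri K A M B) (Infl K A M B (Bar K A M B n)) n where
  toFun t := (Infl.equiv K A M B _).symm (gen K A M B n t)
  map_update_add' t i x y := by rw [MultilinearMap.map_update_add, map_add]
  map_update_smul' t i k x := by
    rw [MultilinearMap.map_update_smul, Infl.equiv_symm_scalar_smul]

variable {K A M B} {N : Type u} [AddCommGroup N] [Module (A ⊗[K] Bᵐᵒᵖ) N]

/-- The morphism that corresponds to a cochain. -/
noncomputable def barLift {n : ℕ} (f : Cochain K (Tri K A M B) (Infl K A M B N) n) :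
    Bar K A M B n →ₗ[A ⊗[K] Bᵐᵒᵖ] N :=
  (Infl.equiv K A M B N).toLinearMap ∘ₗ
    (TensorProduct.AlgebraTensorModule.lift
      (LinearMap.toSpanSingleton (A ⊗[K] Bᵐᵒᵖ) _ (PiTensorProduct.lift f)) :
    ((A ⊗[K] Bᵐᵒᵖ) ⊗[K] (⨂[K] (_ : Fin n), Tri K A M B)) →ₗ[A ⊗[K] Bᵐᵒᵖ] Infl K A M B N)

@[simp] theorem barLift_gen {n : ℕ} (f : Cochain K (Tri K A M B) (Infl K A M B N) n)
    (t : Fin n → Tri K A M B) : barLift f (gen K A M B n t) = Infl.equiv K A M B N (f t) := by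
  change Infl.equiv K A M B N (TensorProduct.AlgebraTensorModule.lift
    (LinearMap.toSpanSingleton (A ⊗[K] Bᵐᵒᵖ) _ (PiTensorProduct.lift f))
      (1 ⊗ₜ[K] PiTensorProduct.tprod K t)) = _
  rw [TensorProduct.AlgebraTensorModule.lift_tmul]
  simp

theorem bar_induction {n : ℕ} {p : Bar K A M B n → Prop} (h0 : p 0)
    (h : ∀ (r : A ⊗[K] Bᵐᵒᵖ) t, p (r • gen K A M B n t))
    (hadd : ∀ x y, p x → p y → p (x + y)) (x : Bar K A M B n) : p x := by
  refine TensorProduct.induction_on (motive := p) x h0 (fun r y => ?_) hadd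
  induction y using PiTensorProduct.induction_on with
  | smul_tprod k t =>
    convert h (k • r) t using 1
    rw [smul_gen, TensorProduct.tmul_smul, TensorProduct.smul_tmul']
    rfl
  | add y z hy hz => rw [TensorProduct.tmul_add]; exact hadd _ _ hy hz

theorem bar_hom_ext {n : ℕ} {f g : Bar K A M B n →ₗ[A ⊗[K] Bᵐᵒᵖ] N}
    (h : ∀ t, f (gen K A M B n t) = g (gen K A M B n t)) : f = g := by
  ext x
  induction x using bar_induction with
  | h0 => simp
  | h r t => rw [map_smul, map_smul, h]
  | hadd x y hx hy => rw [map_add, map_add, hx, hy]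

theorem barLift_push {n : ℕ} (g : Bar K A M B n →ₗ[A ⊗[K] Bᵐᵒᵖ] N) :
    barLift (Infl.push g n (univ K A M B n)) = g :=
  bar_hom_ext fun t => by rw [barLift_gen]; rfl

theorem push_barLift {n : ℕ} (f : Cochain K (Tri K A M B) (Infl K A M B N) n) :
    Infl.push (barLift f) n (univ K A M B n) = f := by
  ext t
  exact barLift_gen f t

variable (K A M B) in
/-- The differential. -/
noncomputable def barD (n : ℕ) : Bar K A M B (n + 1) →ₗ[A ⊗[K] Bᵐᵒᵖ] Bar K A M B n :=
  barLift (delta K _ _ n (univ K A M B n))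

theorem barLift_comp_barD {n : ℕ} (f : Cochain K (Tri K A M B) (Infl K A M B N) n) :
    barLift f ∘ₗ barD K A M B n = barLift (delta K _ _ n f) := by
  refine bar_hom_ext fun t => ?_
  rw [LinearMap.comp_apply, barD, barLift_gen, barLift_gen, Infl.equiv_delta, push_barLift]

theorem push_comp_barD {n : ℕ} (g : Bar K A M B n →ₗ[A ⊗[K] Bᵐᵒᵖ] N) :
    Infl.push (g ∘ₗ barD K A M B n) (n + 1) (univ K A M B (n + 1)) =
      delta K _ _ n (Infl.push g n (univ K A M B n)) := by
  conv_lhs => rw [← barLift_push g, barLift_comp_barD, push_barLift]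

theorem barLift_zero {n : ℕ} :
    barLift (0 : Cochain K (Tri K A M B) (Infl K A M B N) n) = 0 :=
  bar_hom_ext fun t => by rw [barLift_gen]; rfl

theorem barD_comp_barD (n : ℕ) : barD K A M B n ∘ₗ barD K A M B (n + 1) = 0 := by
  rw [barD, barLift_comp_barD, delta_delta, barLift_zero]

instance [Module.Projective K A] [Module.Projective K M] [Module.Projective K B] :
    Module.Projective K (Tri K A M B) :=
  Module.Projective.of_equiv (R := K) (M := A × M × B)
    ({ (Tri.equivProd (K := K) (A := A) (M := M) (B := B)).symm with
      map_add' := fun _ _ => rfl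
      map_smul' := fun _ _ => rfl } : (A × M × B) ≃ₗ[K] Tri K A M B)

/-- Morphisms from `Bar K A M B n` are `n`-cochains, so the lifting property is that of multilinear
maps on the projective module `T`. -/
instance [Module.Projective K A] [Module.Projective K M] [Module.Projective K B] (n : ℕ) :
    Module.Projective (A ⊗[K] Bᵐᵒᵖ) (Bar K A M B n) := by
  refine Module.Projective.of_lifting_property fun {P Q} _ _ _ _ p g hp => ?_
  obtain ⟨f, hf⟩ := exists_comp_eq_multi (Infl.mapK (K := K) (A := A) (M := M) (B := B) p)
    (fun y => hp y) (Infl.push g n (univ K A M B n))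
  refine ⟨barLift f, bar_hom_ext fun t => ?_⟩
  rw [LinearMap.comp_apply, barLift_gen]
  exact hf t

end BarResolution

end Tri

namespace Infl

variable (K A M B N : Type u) [CommRing K] [Ring A] [Algebra K A] [Ring B] [Algebra K B]
  [AddCommGroup M] [Module K M] [Module (A ⊗[K] Bᵐᵒᵖ) M] [IsScalarTower K (A ⊗[K] Bᵐᵒᵖ) M]
  [AddCommGroup N] [Module (A ⊗[K] Bᵐᵒᵖ) N] [Module K N] [IsScalarTower K (A ⊗[K] Bᵐᵒᵖ) N]

/-- `Infl.equiv` as a `K`-linear map. -/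
def equivK : Infl K A M B N →ₗ[K] N where
  toFun x := equiv K A M B N x
  map_add' _ _ := rfl
  map_smul' k x := algebraMap_smul (A ⊗[K] Bᵐᵒᵖ) k (equiv K A M B N x)

end Infl

/-! ### Exactness of the bar complex by duality -/

namespace Tri

section BarExactness

variable {K A M B : Type u} [CommRing K] [Ring A] [Algebra K A] [Ring B] [Algebra K B]
  [AddCommGroup M] [Module K M] [Module (A ⊗[K] Bᵐᵒᵖ) M] [IsScalarTower K (A ⊗[K] Bᵐᵒᵖ) M]
  {N : Type u} [AddCommGroup N] [Module (A ⊗[K] Bᵐᵒᵖ) N]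
  {V : Type u} [AddCommGroup V] [Module K V]

/-- The map to the coinduced bimodule that is adjoint to a `K`-linear map. -/
def toCoind (ψ : Infl K A M B N →ₗ[K] V) : Infl K A M B N →ₗ[K] (A →ₗ[K] B →ₗ[K] V) :=
  LinearMap.mk₂ K
    (fun x a => ψ ∘ₗ (LinearMap.toSpanSingleton (A ⊗[K] Bᵐᵒᵖ) _ x).restrictScalars K ∘ₗ
      (TensorProduct.mk K A Bᵐᵒᵖ a) ∘ₗ (MulOpposite.opLinearEquiv K).toLinearMap)
    (by intros; ext; simp)
    (by intros; ext; simp [smul_comm _ (_ : K) (_ : Infl K A M B N)])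
    (by intros; ext; simp [add_smul])
    (by intros; ext; simp)

theorem toCoind_apply (ψ : Infl K A M B N →ₗ[K] V) (x : Infl K A M B N) (a : A) (b : B) :
    toCoind ψ x a b = ψ ((a ⊗ₜ[K] MulOpposite.op b) • x) := rfl

/-- The map `toCoind ψ` is equivariant for both actions; composing the universal cochain with it
turns `K`-linear maps on the bar complex into coinduced cochains. -/
theorem gdelta_toCoind (ψ : Infl K A M B N →ₗ[K] V) {n : ℕ}
    (f : Cochain K (Tri K A M B) (Infl K A M B N) n) :
    gdelta n (coindA K A M B V) (coindR K A M B V A)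
      (multiMap LinearMap.id (toCoind ψ) n f) =
      multiMap LinearMap.id (toCoind ψ) (n + 1) (delta K _ _ n f) := by
  rw [delta_eq_gdelta]
  refine gdelta_multiMap (fun _ _ => rfl) (fun t x => ?_) (fun t x => ?_) f
  · ext a b
    simp only [coindA, precomp_apply, toCoind_apply, LinearMap.id_apply, leftAct_apply,
      Infl.smul_def, ← mul_smul]
    simp [rightA]
  · ext a b
    simp only [coindR, precomp₂_apply, toCoind_apply, LinearMap.id_apply, rightAct_apply,
      Infl.op_smul_def, ← mul_smul]
    simp [leftB]

/-- With `bar_linear_ext`, this identifies the `K`-linear maps from the bar complex to `V` with the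
coinduced cochains, so vanishing of coinduced cohomology becomes a statement about the bar complex.
-/
theorem exists_bar_linear {n : ℕ} (g : Multi K (Tri K A M B) (A →ₗ[K] B →ₗ[K] V) n) :
    ∃ φ : Infl K A M B (Bar K A M B n) →ₗ[K] V,
      multiMap LinearMap.id (toCoind φ) n (univ K A M B n) = g := by
  let L : (A →ₗ[K] B →ₗ[K] V) →ₗ[K] (A ⊗[K] Bᵐᵒᵖ →ₗ[K] V) :=
    { toFun := fun f => TensorProduct.lift (f.compl₂ (MulOpposite.opLinearEquiv K).symm.toLinearMap)
      map_add' := fun f f' => by ext; simp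
      map_smul' := fun k f => by ext; simp }
  let φ : Bar K A M B n →ₗ[K] V :=
    (TensorProduct.lift (PiTensorProduct.lift (L.compMultilinearMap g)).flip :
      (A ⊗[K] Bᵐᵒᵖ) ⊗[K] (⨂[K] (_ : Fin n), Tri K A M B) →ₗ[K] V)
  refine ⟨φ ∘ₗ Infl.equivK K A M B _, ?_⟩
  ext t a b
  change φ ((a ⊗ₜ[K] MulOpposite.op b) • gen K A M B n t) = _
  rw [smul_gen]
  change TensorProduct.lift (PiTensorProduct.lift (L.compMultilinearMap g)).flip
    ((a ⊗ₜ[K] MulOpposite.op b) ⊗ₜ[K] PiTensorProduct.tprod K t) = _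
  rw [TensorProduct.lift.tmul, LinearMap.flip_apply, PiTensorProduct.lift.tprod]
  rfl

theorem bar_linear_ext {n : ℕ} {φ ψ : Infl K A M B (Bar K A M B n) →ₗ[K] V}
    (h : ∀ t a b, toCoind φ (univ K A M B n t) a b = toCoind ψ (univ K A M B n t) a b) :
    φ = ψ := by
  ext x
  refine bar_induction (p := fun x => φ ((Infl.equiv K A M B _).symm x) =
    ψ ((Infl.equiv K A M B _).symm x)) ?_ ?_ ?_ (Infl.equiv K A M B _ x)
  · simp
  · intro r t
    induction r using TensorProduct.induction_on with
    | zero => simp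
    | tmul a b =>
      exact h t a b.unop
    | add r s hr hs =>
      rw [add_smul, map_add, map_add, map_add, hr, hs]
  · intro x y hx hy
    rw [map_add, map_add, map_add, hx, hy]

theorem mapK_univ {n : ℕ} (g : Bar K A M B n →ₗ[A ⊗[K] Bᵐᵒᵖ] N) (t : Fin n → Tri K A M B) :
    Infl.mapK g (univ K A M B n t) = Infl.push g n (univ K A M B n) t := rfl

theorem toCoind_comp_mapK {N' : Type u} [AddCommGroup N'] [Module (A ⊗[K] Bᵐᵒᵖ) N']
    (ψ : Infl K A M B N →ₗ[K] V) (g : N' →ₗ[A ⊗[K] Bᵐᵒᵖ] N) (x : Infl K A M B N') :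
    toCoind (ψ ∘ₗ Infl.mapK g) x = toCoind ψ (Infl.mapK g x) := by
  ext a b
  exact congrArg ψ (g.map_smul (a ⊗ₜ[K] MulOpposite.op b) (Infl.equiv K A M B N' x))

theorem push_barD {n : ℕ} :
    Infl.push (barD K A M B n) (n + 1) (univ K A M B (n + 1)) =
      delta K _ _ n (univ K A M B n) := push_barLift _

variable (K A M B) in
/-- The augmentation `Bar K A M B 1 → M`. -/
noncomputable def eps : Bar K A M B 1 →ₗ[A ⊗[K] Bᵐᵒᵖ] M := barLift (Infl.corner K A M B)

theorem exists_comp_barD {n : ℕ} (ψ : Infl K A M B (Bar K A M B (n + 2)) →ₗ[K] V)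
    (hψ : ψ ∘ₗ Infl.mapK (barD K A M B (n + 2)) = 0) :
    ∃ φ : Infl K A M B (Bar K A M B (n + 1)) →ₗ[K] V,
      ψ = φ ∘ₗ Infl.mapK (barD K A M B (n + 1)) := by
  obtain ⟨g, hg⟩ := exists_gdelta_eq_of_coindA
    (multiMap LinearMap.id (toCoind ψ) (n + 2) (univ K A M B (n + 2))) (by
      rw [gdelta_toCoind, ← push_barD]
      ext t a b
      change toCoind ψ (Infl.mapK _ (univ K A M B (n + 3) t)) a b = 0
      rw [← toCoind_comp_mapK, hψ]
      rfl)
  obtain ⟨φ, rfl⟩ := exists_bar_linear g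
  refine ⟨φ, bar_linear_ext fun t a b => ?_⟩
  rw [gdelta_toCoind, ← push_barD] at hg
  rw [toCoind_comp_mapK]
  exact (congrArg (fun f => f t a b) hg).symm

theorem exists_comp_barD_add_eps (ψ : Infl K A M B (Bar K A M B 1) →ₗ[K] V)
    (hψ : ψ ∘ₗ Infl.mapK (barD K A M B 1) = 0) :
    ∃ (φ : Infl K A M B (Bar K A M B 0) →ₗ[K] V) (φ' : M →ₗ[K] V),
      ∀ x, ψ x = φ (Infl.mapK (barD K A M B 0) x) +
        φ' (eps K A M B (Infl.equiv K A M B _ x)) := by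
  obtain ⟨y, g, hg, hy⟩ := exists_of_coindA_one
    (multiMap LinearMap.id (toCoind ψ) 1 (univ K A M B 1)) (by
      rw [gdelta_toCoind, ← push_barD]
      ext t a b
      change toCoind ψ (Infl.mapK _ (univ K A M B 2 t)) a b = 0
      rw [← toCoind_comp_mapK, hψ]
      rfl)
  obtain ⟨φ, hφ⟩ := exists_bar_linear (nullaryEquiv K (Tri K A M B) _ y)
  refine ⟨φ, g.flip 1, fun x => ?_⟩
  have key : ψ = φ ∘ₗ Infl.mapK (barD K A M B 0) +
      g.flip 1 ∘ₗ Infl.equivK K A M B M ∘ₗ Infl.mapK (eps K A M B) := by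
    refine bar_linear_ext fun t a b => ?_
    have h1 : toCoind ψ (univ K A M B 1 t) a b = y (a * (t 0).a) b - y a ((t 0).b * b) +
        g ((a ⊗ₜ[K] (1 : Bᵐᵒᵖ)) • (t 0).m) b := by
      have ht : ![t 0] = t := by
        ext i : 1
        rw [Fin.eq_zero i]
        rfl
      have h := hy (t 0) a b
      rw [ht] at h
      exact h
    have h2 : toCoind (φ ∘ₗ Infl.mapK (barD K A M B 0)) (univ K A M B 1 t) a b =
        y (a * (t 0).a) b - y a ((t 0).b * b) := by
      rw [toCoind_comp_mapK, mapK_univ, push_barD]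
      have h3 := gdelta_toCoind φ (univ K A M B 0)
      rw [hφ] at h3
      refine (congrArg (fun f => f t a b) h3).symm.trans ?_
      simp only [gdelta_zero_apply]
      rfl
    have h4 : toCoind (g.flip 1 ∘ₗ Infl.equivK K A M B M ∘ₗ Infl.mapK (eps K A M B))
        (univ K A M B 1 t) a b = g ((a ⊗ₜ[K] (1 : Bᵐᵒᵖ)) • (t 0).m) b := by
      change g (eps K A M B ((a ⊗ₜ[K] MulOpposite.op b) • gen K A M B 1 t)) 1 = _
      rw [map_smul, eps, barLift_gen, Infl.equiv_corner, ← mul_one b, ← hg, ← mul_smul]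
      simp
    rw [h1, ← h2, ← h4]
    rfl
  rw [key]
  rfl

/-- The test map is the projection to the cokernel of the incoming differential. It kills
boundaries, hence factors through the outgoing differential, and so it kills cycles: every cycle is
a boundary. -/
theorem exact_barD (n : ℕ) :
    Function.Exact (barD K A M B (n + 2)) (barD K A M B (n + 1)) := by
  intro x
  constructor
  · intro hx
    obtain ⟨φ, hφ⟩ := exists_comp_barD
      (LinearMap.range (Infl.mapK (K := K) (M := M) (barD K A M B (n + 2)))).mkQ
      (LinearMap.range_mkQ_comp _)
    have h := congrArg (fun f => f ((Infl.equiv K A M B _).symm x)) hφ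
    have h' : Infl.mapK (barD K A M B (n + 1)) ((Infl.equiv K A M B _).symm x) = 0 := hx
    rw [LinearMap.comp_apply, h', map_zero] at h
    rw [Submodule.mkQ_apply, Submodule.Quotient.mk_eq_zero] at h
    exact h
  · rintro ⟨y, rfl⟩
    exact congrArg (fun f => f y) (barD_comp_barD n.succ)

/-- The same test one degree lower, where the factorization has an additional term through the
augmentation. -/
theorem exists_barD_eq (x : Bar K A M B 1) (hx : barD K A M B 0 x = 0) (hx' : eps K A M B x = 0) :
    ∃ y, barD K A M B 1 y = x := by
  obtain ⟨φ, φ', hφ⟩ := exists_comp_barD_add_eps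
    (LinearMap.range (Infl.mapK (K := K) (M := M) (barD K A M B 1))).mkQ
    (LinearMap.range_mkQ_comp _)
  have h := hφ ((Infl.equiv K A M B _).symm x)
  have h' : Infl.mapK (barD K A M B 0) ((Infl.equiv K A M B _).symm x) = 0 := hx
  rw [h', map_zero, LinearEquiv.apply_symm_apply, hx', map_zero, add_zero,
    Submodule.mkQ_apply, Submodule.Quotient.mk_eq_zero] at h
  exact h

end BarExactness

end Tri

/-! ### Projective resolutions from exact sequences of modules -/

namespace ModuleCat

section

variable {R : Type u} [Ring R] (X : ℕ → ModuleCat.{u} R) (d : ∀ n, X (n + 1) ⟶ X n)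
  {Z : ModuleCat.{u} R} (ε : X 0 ⟶ Z)
  (hd : ∀ n, Function.Exact (d (n + 1)).hom (d n).hom)
  (hε : Function.Exact (d 0).hom ε.hom) (hε' : Function.Surjective ε.hom)
  (hX : ∀ n, Projective (X n))

/-- The chain complex given by an exact sequence of modules. -/
noncomputable def complexOfExact (hd : ∀ n, Function.Exact (d (n + 1)).hom (d n).hom) :
    ChainComplex (ModuleCat.{u} R) ℕ :=
  ChainComplex.of X d fun n => ModuleCat.hom_ext (hd n).linearMap_comp_eq_zero

theorem complexOfExact_d (n : ℕ) : (complexOfExact X d hd).d (n + 1) n = d n :=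
  ChainComplex.of_d X d n

/-- The projective resolution given by an exact sequence of projective modules. -/
noncomputable def resolutionOfExact : ProjectiveResolution Z where
  complex := complexOfExact X d hd
  projective := hX
  π := (ChainComplex.toSingle₀Equiv (complexOfExact X d hd) Z).symm ⟨ε, by
    rw [complexOfExact_d]
    exact ModuleCat.hom_ext hε.linearMap_comp_eq_zero⟩
  quasiIso := ⟨fun n => by
    cases n
    · rw [ChainComplex.quasiIsoAt₀_iff, ShortComplex.quasiIso_iff_of_zeros']
      · refine (ShortComplex.exact_and_epi_g_iff_of_iso
          (S₂ := ShortComplex.mk (d 0) ε (ModuleCat.hom_ext hε.linearMap_comp_eq_zero)) ?_).2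
          ⟨(ShortComplex.ShortExact.moduleCat_exact_iff_function_exact _).2 hε,
            (ModuleCat.epi_iff_surjective _).2 hε'⟩
        refine ShortComplex.isoMk (Iso.refl _) (Iso.refl _) (Iso.refl _) ?_ ?_
        · exact (Category.id_comp _).trans
            ((complexOfExact_d X d hd 0).symm.trans (Category.comp_id _).symm)
        · exact (Category.id_comp _).trans
            ((ChainComplex.toSingle₀Equiv_symm_apply_f_zero (C := complexOfExact X d hd) ε
              (by rw [complexOfExact_d]; exact ModuleCat.hom_ext hε.linearMap_comp_eq_zero)).symm.trans
              (Category.comp_id _).symm)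
      all_goals rfl
    · rw [quasiIsoAt_iff_exactAt']
      · rename_i n
        rw [HomologicalComplex.exactAt_iff' _ (n + 1 + 1) (n + 1) n (by simp) (by simp),
          ShortComplex.ShortExact.moduleCat_exact_iff_function_exact]
        have h := hd n
        rw [← complexOfExact_d X d hd n, ← complexOfExact_d X d hd (n + 1)] at h
        exact h
      · apply ChainComplex.exactAt_succ_single_obj⟩

theorem resolutionOfExact_π_f_zero :
    (resolutionOfExact X d ε hd hε hε' hX).π.f 0 = ε :=
  ChainComplex.toSingle₀Equiv_symm_apply_f_zero (C := complexOfExact X d hd) ε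
    (by rw [complexOfExact_d]; exact ModuleCat.hom_ext hε.linearMap_comp_eq_zero)

end

end ModuleCat

/-! ### The truncated bar complex as a projective resolution of `M` -/

namespace Tri

section Resolution

variable (K A M B : Type u) [CommRing K] [Ring A] [Algebra K A] [Ring B] [Algebra K B]
  [AddCommGroup M] [Module K M] [Module (A ⊗[K] Bᵐᵒᵖ) M] [IsScalarTower K (A ⊗[K] Bᵐᵒᵖ) M]

theorem delta_zero_apply {T N : Type u} [Ring T] [Algebra K T] [AddCommGroup N] [Module K N]
    [Module T N] [Module Tᵐᵒᵖ N] [IsScalarTower K T N] [IsScalarTower K Tᵐᵒᵖ N]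
    (f : Cochain K T N 0) (t : Fin 1 → T) :
    delta K T N 0 f t = t 0 • f ![] - MulOpposite.op (t 0) • f ![] := by
  rw [delta_eq_gdelta, gdelta_zero_apply]
  rfl

theorem barD_gen_one (t : Fin 1 → Tri K A M B) :
    barD K A M B 0 (gen K A M B 1 t) = ((t 0).a ⊗ₜ[K] (1 : Bᵐᵒᵖ)) • gen K A M B 0 ![] -
      ((1 : A) ⊗ₜ[K] MulOpposite.op (t 0).b) • gen K A M B 0 ![] := by
  rw [barD, barLift_gen, delta_zero_apply]
  rfl

/-- A section of the differential `Bar K A M B 1 → Bar K A M B 0`. -/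
noncomputable def barSection : Bar K A M B 0 →ₗ[A ⊗[K] Bᵐᵒᵖ] Bar K A M B 1 :=
  barLift (nullaryEquiv K _ _ (univ K A M B 1 ![inA K A M B 1]))

/-- The section sends the generator to the class of the upper left idempotent, whose entries are `a
= 1` and `b = 0`. Hence the bar complex splits at its end, and the kernel of the last differential
is a direct summand of `Bar K A M B 1`, so again projective. -/
theorem barD_barSection (x : Bar K A M B 0) : barD K A M B 0 (barSection K A M B x) = x := by
  have : barD K A M B 0 ∘ₗ barSection K A M B = LinearMap.id := by
    refine bar_hom_ext fun t => ?_
    rw [LinearMap.comp_apply, barSection, barLift_gen]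
    change barD K A M B 0 (gen K A M B 1 ![inA K A M B 1]) = _
    rw [barD_gen_one]
    simp only [Matrix.cons_val_zero, inA_apply_a, inA_apply_b, MulOpposite.op_zero,
      TensorProduct.tmul_zero]
    rw [one_tmul_one_smul, zero_tensor_smul, Subsingleton.elim t ![]]
    exact sub_zero _
  exact congrArg (fun f => f x) this

/-- The projection of `Bar K A M B 1` to the kernel of the differential. -/
noncomputable def kerProj :
    Bar K A M B 1 →ₗ[A ⊗[K] Bᵐᵒᵖ] LinearMap.ker (barD K A M B 0) :=
  (LinearMap.id - barSection K A M B ∘ₗ barD K A M B 0).codRestrict _ fun x => by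
    rw [LinearMap.mem_ker, LinearMap.sub_apply, LinearMap.comp_apply, map_sub, barD_barSection]
    exact sub_self _

theorem kerProj_coe (x : Bar K A M B 1) :
    (kerProj K A M B x : Bar K A M B 1) = x - barSection K A M B (barD K A M B 0 x) := rfl

theorem kerProj_of_mem (x : LinearMap.ker (barD K A M B 0)) : kerProj K A M B x = x := by
  ext
  rw [kerProj_coe, x.2, map_zero, sub_zero]

theorem barD_mem_ker (x : Bar K A M B 2) :
    barD K A M B 1 x ∈ LinearMap.ker (barD K A M B 0) :=
  congrArg (fun f : Bar K A M B 2 →ₗ[A ⊗[K] Bᵐᵒᵖ] Bar K A M B 0 => f x) (barD_comp_barD 0)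

/-- The terms of the resolution of `M`. -/
noncomputable def resX : ℕ → ModuleCat.{u} (A ⊗[K] Bᵐᵒᵖ)
  | 0 => ModuleCat.of _ (LinearMap.ker (barD K A M B 0))
  | k + 1 => ModuleCat.of _ (Bar K A M B (k + 2))

/-- The differentials of the resolution of `M`. -/
noncomputable def resD : ∀ k, resX K A M B (k + 1) ⟶ resX K A M B k
  | 0 => ModuleCat.ofHom ((barD K A M B 1).codRestrict _ (barD_mem_ker K A M B))
  | k + 1 => ModuleCat.ofHom (barD K A M B (k + 2))

/-- The augmentation of the resolution of `M`. -/
noncomputable def resEps : resX K A M B 0 ⟶ ModuleCat.of (A ⊗[K] Bᵐᵒᵖ) M :=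
  ModuleCat.ofHom (eps K A M B ∘ₗ (LinearMap.ker (barD K A M B 0)).subtype)

theorem exact_resD (k : ℕ) :
    Function.Exact (resD K A M B (k + 1)).hom (resD K A M B k).hom := by
  cases k with
  | zero =>
    intro x
    refine Iff.trans ?_ (exact_barD 0 x)
    exact Subtype.ext_iff
  | succ k => exact exact_barD (k + 1)

theorem eps_barD (x : Bar K A M B 2) : eps K A M B (barD K A M B 1 x) = 0 := by
  have : eps K A M B ∘ₗ barD K A M B 1 = 0 := by
    rw [eps, barLift_comp_barD, Infl.delta_corner, barLift_zero]
  exact congrArg (fun f => f x) this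

theorem exact_resEps : Function.Exact (resD K A M B 0).hom (resEps K A M B).hom := by
  intro x
  constructor
  · intro hx
    obtain ⟨y, hy⟩ := exists_barD_eq x.1 x.2 hx
    exact ⟨y, Subtype.ext hy⟩
  · rintro ⟨y, rfl⟩
    exact eps_barD K A M B y

theorem resEps_surjective : Function.Surjective (resEps K A M B).hom := by
  intro x
  -- A matrix with zero diagonal is a cycle: the differential in this degree involves the diagonal
  -- entries only.
  refine ⟨⟨gen K A M B 1 ![inM K A M B x], ?_⟩, ?_⟩
  · rw [LinearMap.mem_ker, barD_gen_one]
    simp only [Matrix.cons_val_zero, inM_apply_a, inM_apply_b, MulOpposite.op_zero,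
      TensorProduct.tmul_zero, TensorProduct.zero_tmul]
    rw [zero_tensor_smul]
    exact sub_self _
  · exact barLift_gen _ _

variable [Module.Projective K A] [Module.Projective K M] [Module.Projective K B]

theorem projective_resX (k : ℕ) : Projective (resX K A M B k) := by
  cases k with
  | zero =>
    have : Module.Projective (A ⊗[K] Bᵐᵒᵖ) (LinearMap.ker (barD K A M B 0)) :=
      Module.Projective.of_split (LinearMap.ker (barD K A M B 0)).subtype (kerProj K A M B)
        (LinearMap.ext (kerProj_of_mem K A M B))
    exact (IsProjective.iff_projective _).1 this
  | succ k =>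
    exact (IsProjective.iff_projective _).1
      (inferInstance : Module.Projective (A ⊗[K] Bᵐᵒᵖ) (Bar K A M B (k + 2)))

/-- The projective resolution of `M` by the modules that represent the Hochschild cochains. -/
noncomputable def res : ProjectiveResolution (ModuleCat.of (A ⊗[K] Bᵐᵒᵖ) M) :=
  ModuleCat.resolutionOfExact (resX K A M B) (resD K A M B) (resEps K A M B) (exact_resD K A M B)
    (exact_resEps K A M B) (resEps_surjective K A M B) (projective_resX K A M B)

theorem res_d (k : ℕ) : (res K A M B).complex.d (k + 1) k = resD K A M B k :=
  ModuleCat.complexOfExact_d _ _ (exact_resD K A M B) k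

theorem res_π : (res K A M B).π.f 0 = resEps K A M B :=
  ModuleCat.resolutionOfExact_π_f_zero _ _ _ _ _ _ _

end Resolution

section Comparison

variable (K A M B : Type u) [CommRing K] [Ring A] [Algebra K A] [Ring B] [Algebra K B]
  [AddCommGroup M] [Module K M] [Module (A ⊗[K] Bᵐᵒᵖ) M] [IsScalarTower K (A ⊗[K] Bᵐᵒᵖ) M]

/-- The inclusion of the resolution in the bar complex. -/
noncomputable def resIncl :
    ∀ k, resX K A M B k ⟶ ModuleCat.of (A ⊗[K] Bᵐᵒᵖ) (Bar K A M B (k + 1))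
  | 0 => ModuleCat.ofHom (LinearMap.ker (barD K A M B 0)).subtype
  | k + 1 => 𝟙 (ModuleCat.of (A ⊗[K] Bᵐᵒᵖ) (Bar K A M B (k + 2)))

/-- The projection of the bar complex to the resolution. -/
noncomputable def resProj :
    ∀ k, ModuleCat.of (A ⊗[K] Bᵐᵒᵖ) (Bar K A M B (k + 1)) ⟶ resX K A M B k
  | 0 => ModuleCat.ofHom (kerProj K A M B)
  | k + 1 => 𝟙 (ModuleCat.of (A ⊗[K] Bᵐᵒᵖ) (Bar K A M B (k + 2)))

theorem resIncl_resProj (k : ℕ) : resIncl K A M B k ≫ resProj K A M B k = 𝟙 _ := by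
  cases k with
  | zero => exact ModuleCat.hom_ext (LinearMap.ext (kerProj_of_mem K A M B))
  | succ k => exact Category.id_comp _

theorem resD_resIncl (k : ℕ) : resD K A M B k ≫ resIncl K A M B k =
    resIncl K A M B (k + 1) ≫ ModuleCat.ofHom (barD K A M B (k + 1)) := by
  cases k with
  | zero => rfl
  | succ k => exact (Category.comp_id _).trans (Category.id_comp _).symm

theorem barD_resProj (k : ℕ) : ModuleCat.ofHom (barD K A M B (k + 1)) ≫ resProj K A M B k =
    resProj K A M B (k + 1) ≫ resD K A M B k := by
  cases k with
  | zero =>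
    exact ModuleCat.hom_ext (LinearMap.ext fun x =>
      kerProj_of_mem K A M B ⟨_, barD_mem_ker K A M B x⟩)
  | succ k => exact (Category.comp_id _).trans (Category.id_comp _).symm

/-- The section takes values generated by an idempotent with zero corner entry, which the
augmentation kills. -/
theorem eps_kerProj (x : Bar K A M B 1) : eps K A M B (kerProj K A M B x) = eps K A M B x := by
  have : eps K A M B ∘ₗ barSection K A M B = 0 := by
    refine bar_hom_ext fun t => ?_
    rw [LinearMap.comp_apply, barSection, barLift_gen]
    change eps K A M B (gen K A M B 1 ![inA K A M B 1]) = 0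
    rw [eps, barLift_gen]
    rfl
  rw [kerProj_coe, map_sub]
  refine (congrArg (fun y => eps K A M B x - y)
    (congrArg (fun f => f (barD K A M B 0 x)) this)).trans ?_
  exact sub_zero _

theorem resProj_resEps :
    resProj K A M B 0 ≫ resEps K A M B = ModuleCat.ofHom (eps K A M B) :=
  ModuleCat.hom_ext (LinearMap.ext (eps_kerProj K A M B))

/-- The cochains that lift the derivation `T → M` through the resolution. -/
noncomputable def resCochain (k : ℕ) :
    Cochain K (Tri K A M B) (Infl K A M B (resX K A M B k)) (k + 1) :=
  Infl.push (resProj K A M B k).hom (k + 1) (univ K A M B (k + 1))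

theorem resEps_resCochain (t : Fin 1 → Tri K A M B) :
    (resEps K A M B).hom (Infl.equiv K A M B _ (resCochain K A M B 0 t)) = (t 0).m := by
  refine (congrArg (fun f => f.hom (gen K A M B 1 t)) (resProj_resEps K A M B)).trans ?_
  exact barLift_gen _ _

theorem resD_resCochain (k : ℕ) :
    Infl.push (resD K A M B k).hom (k + 2) (resCochain K A M B (k + 1)) =
      delta K _ _ (k + 1) (resCochain K A M B k) := by
  rw [resCochain, resCochain, Infl.delta_push, ← push_barD]
  ext t
  exact congrArg (fun f => f.hom (gen K A M B (k + 2) t)) (barD_resProj K A M B k).symm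

end Comparison

end Tri

/-! ### Hochschild cocycles with inflated coefficients as Ext classes -/

namespace CategoryTheory.ProjectiveResolution

theorem extMk_zero_degree_eq_zero_iff {C : Type*} [Category C] [Abelian C] [HasExt C] {X Y : C}
    (R : ProjectiveResolution X) (f : R.complex.X 0 ⟶ Y) (hf : R.complex.d 1 0 ≫ f = 0) :
    R.extMk f 1 rfl hf = 0 ↔ f = 0 := by
  refine ⟨fun h => ?_, fun h => by subst h; simp⟩
  simp only [← R.extEquivCohomologyClass.apply_eq_iff_eq, extEquivCohomologyClass_extMk,
    extEquivCohomologyClass_zero, CochainComplex.HomComplex.CohomologyClass.mk_eq_zero_iff] at h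
  rw [CochainComplex.HomComplex.Cocycle.toSingleMk_mem_coboundaries_iff _ _ _ _ _ 1 (by simp)] at h
  obtain ⟨g, hg⟩ := h
  -- In cochain indexing the resolution is zero in degree 1, so the morphism `g` vanishes and there
  -- are no nonzero coboundaries.
  rw [(R.cochainComplex.isZero_of_isStrictlyLE 0 1 (by simp)).eq_of_src g 0,
    Limits.comp_zero] at hg
  rw [← cancel_epi (R.cochainComplexXIso (-(0 : ℕ)) 0 rfl).hom, ← hg, Limits.comp_zero]

theorem smul_extMk {K C : Type*} [CommRing K] [Category C] [Abelian C] [Linear K C] [HasExt C]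
    {X Y : C} (R : ProjectiveResolution X) {n : ℕ} (k : K) (f : R.complex.X n ⟶ Y) (m : ℕ)
    (hm : n + 1 = m) (hf : R.complex.d m n ≫ f = 0) :
    k • R.extMk f m hm hf = R.extMk (k • f) m hm (by rw [Linear.comp_smul, hf, smul_zero]) := by
  rw [Ext.smul_eq_comp_mk₀, extMk_comp_mk₀]
  congr 1
  rw [Linear.comp_smul, Category.comp_id]

end CategoryTheory.ProjectiveResolution

namespace Tri

section ExtClass

variable {K A M B : Type u} [CommRing K] [Ring A] [Algebra K A] [Ring B] [Algebra K B]
  [AddCommGroup M] [Module K M] [Module (A ⊗[K] Bᵐᵒᵖ) M] [IsScalarTower K (A ⊗[K] Bᵐᵒᵖ) M]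
  {N : Type u} [AddCommGroup N] [Module (A ⊗[K] Bᵐᵒᵖ) N]

/-- The morphism on a term of the resolution that corresponds to a cochain. -/
noncomputable def resLift {n : ℕ} (z : Cochain K (Tri K A M B) (Infl K A M B N) (n + 1)) :
    resX K A M B n ⟶ ModuleCat.of (A ⊗[K] Bᵐᵒᵖ) N :=
  resIncl K A M B n ≫ ModuleCat.ofHom (barLift z)

theorem barLift_add {n : ℕ} (z w : Cochain K (Tri K A M B) (Infl K A M B N) n) :
    barLift (z + w) = barLift z + barLift w :=
  bar_hom_ext fun t => by simp only [barLift_gen, LinearMap.add_apply, add_apply, map_add]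

theorem resLift_add {n : ℕ} (z w : Cochain K (Tri K A M B) (Infl K A M B N) (n + 1)) :
    resLift (z + w) = resLift z + resLift w := by
  rw [resLift, barLift_add, ModuleCat.ofHom_add, Preadditive.comp_add]
  rfl

theorem ofHom_barLift_smul {n : ℕ} (k : K) (z : Cochain K (Tri K A M B) (Infl K A M B N) n) :
    ModuleCat.ofHom (barLift (k • z)) = k • ModuleCat.ofHom (barLift z) := by
  refine ModuleCat.hom_ext (bar_hom_ext fun t => ?_)
  change barLift (k • z) (gen K A M B n t) =
    algebraMap K (A ⊗[K] Bᵐᵒᵖ) k • barLift z (gen K A M B n t)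
  simp only [barLift_gen, smul_apply, Infl.equiv_scalar_smul]

theorem resLift_smul {n : ℕ} (k : K) (z : Cochain K (Tri K A M B) (Infl K A M B N) (n + 1)) :
    resLift (k • z) = k • resLift z := by
  rw [resLift, ofHom_barLift_smul, Linear.comp_smul]
  rfl

theorem resD_resLift {n : ℕ} (z : Cochain K (Tri K A M B) (Infl K A M B N) (n + 1)) :
    resD K A M B n ≫ resLift z = resLift (delta K _ _ (n + 1) z) := by
  rw [resLift, ← Category.assoc, resD_resIncl, Category.assoc, ← ModuleCat.ofHom_comp,
    barLift_comp_barD, resLift]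

theorem resLift_zero {n : ℕ} :
    resLift (0 : Cochain K (Tri K A M B) (Infl K A M B N) (n + 1)) = 0 := by
  rw [resLift, barLift_zero]
  exact Limits.comp_zero

theorem resLift_push {n : ℕ} (φ : resX K A M B n ⟶ ModuleCat.of (A ⊗[K] Bᵐᵒᵖ) N) :
    resLift (Infl.push φ.hom (n + 1) (resCochain K A M B n)) = φ := by
  have : barLift (Infl.push φ.hom (n + 1) (resCochain K A M B n)) =
      (resProj K A M B n ≫ φ).hom :=
    bar_hom_ext fun t => by rw [barLift_gen]; rfl
  rw [resLift, this, ModuleCat.ofHom_hom, ← Category.assoc, resIncl_resProj, Category.id_comp]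

theorem delta_push_resCochain {n : ℕ} (φ : resX K A M B n ⟶ ModuleCat.of (A ⊗[K] Bᵐᵒᵖ) N) :
    delta K _ _ (n + 1) (Infl.push φ.hom (n + 1) (resCochain K A M B n)) =
      Infl.push (resD K A M B n ≫ φ).hom (n + 2) (resCochain K A M B (n + 1)) := by
  rw [Infl.delta_push, ← resD_resCochain]
  rfl

theorem mem_coboundaries_of_resLift_eq {n : ℕ}
    (z : Cochain K (Tri K A M B) (Infl K A M B N) (n + 2))
    (g : resX K A M B n ⟶ ModuleCat.of (A ⊗[K] Bᵐᵒᵖ) N) (h : resD K A M B n ≫ g = resLift z) :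
    z ∈ coboundaries K _ _ (n + 2) := by
  refine ⟨Infl.push g.hom (n + 1) (resCochain K A M B n), ?_⟩
  rw [delta_push_resCochain, h]
  exact push_barLift z

/-- In degree 1 the resolution sees only the kernel of the last differential. A morphism that
vanishes there factors through this differential, explicitly by composing with `barSection`. -/
theorem mem_coboundaries_of_resLift_eq_zero
    (z : Cochain K (Tri K A M B) (Infl K A M B N) 1) (h : resLift z = 0) :
    z ∈ coboundaries K _ _ 1 := by
  refine ⟨Infl.push (barLift z ∘ₗ barSection K A M B) 0 (univ K A M B 0), ?_⟩
  rw [← push_comp_barD]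
  conv_rhs => rw [← push_barLift z]
  refine congrArg (fun f => Infl.push f 1 (univ K A M B 1)) (LinearMap.ext fun x => ?_)
  have h1 := congrArg (fun f => f.hom (kerProj K A M B x)) h
  have h2 : barLift z (kerProj K A M B x : Bar K A M B 1) = 0 := h1
  rw [kerProj_coe, map_sub] at h2
  exact (sub_eq_zero.1 h2).symm

variable [Module.Projective K A] [Module.Projective K M] [Module.Projective K B]

/-- The class in `Ext` of a morphism on a term of the resolution. -/
noncomputable def resMk {Y : ModuleCat.{u} (A ⊗[K] Bᵐᵒᵖ)} {n : ℕ} (φ : resX K A M B n ⟶ Y)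
    (hφ : resD K A M B n ≫ φ = 0) : Ext (ModuleCat.of (A ⊗[K] Bᵐᵒᵖ) M) Y n :=
  (res K A M B).extMk φ (n + 1) rfl
    ((congrArg (fun d : resX K A M B (n + 1) ⟶ resX K A M B n => d ≫ φ) (res_d K A M B n)).trans hφ)

theorem resMk_congr {Y : ModuleCat.{u} (A ⊗[K] Bᵐᵒᵖ)} {n : ℕ} {φ ψ : resX K A M B n ⟶ Y}
    (h : φ = ψ) (hφ : resD K A M B n ≫ φ = 0) (hψ : resD K A M B n ≫ ψ = 0) :
    resMk φ hφ = resMk ψ hψ := by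
  subst h
  rfl

theorem resMk_add {Y : ModuleCat.{u} (A ⊗[K] Bᵐᵒᵖ)} {n : ℕ} (φ ψ : resX K A M B n ⟶ Y)
    (hφ : resD K A M B n ≫ φ = 0) (hψ : resD K A M B n ≫ ψ = 0) :
    resMk (φ + ψ) (by rw [Preadditive.comp_add, hφ, hψ, add_zero]) = resMk φ hφ + resMk ψ hψ :=
  ((res K A M B).add_extMk φ ψ (n + 1) rfl _ _).symm

theorem resMk_smul {Y : ModuleCat.{u} (A ⊗[K] Bᵐᵒᵖ)} {n : ℕ} (k : K) (φ : resX K A M B n ⟶ Y)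
    (hφ : resD K A M B n ≫ φ = 0) :
    resMk (k • φ) (by rw [Linear.comp_smul, hφ, smul_zero]) = k • resMk φ hφ :=
  ((res K A M B).smul_extMk k φ (n + 1) rfl _).symm

theorem resMk_surjective {Y : ModuleCat.{u} (A ⊗[K] Bᵐᵒᵖ)} {n : ℕ}
    (x : Ext (ModuleCat.of (A ⊗[K] Bᵐᵒᵖ) M) Y n) :
    ∃ (φ : resX K A M B n ⟶ Y) (hφ : resD K A M B n ≫ φ = 0), resMk φ hφ = x := by
  obtain ⟨φ, hφ, rfl⟩ := (res K A M B).extMk_surjective x (n + 1) rfl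
  exact ⟨φ, (congrArg (fun d : resX K A M B (n + 1) ⟶ resX K A M B n => d ≫ φ)
    (res_d K A M B n)).symm.trans hφ, rfl⟩

theorem resMk_zero_eq_zero_iff {Y : ModuleCat.{u} (A ⊗[K] Bᵐᵒᵖ)} (φ : resX K A M B 0 ⟶ Y)
    (hφ : resD K A M B 0 ≫ φ = 0) : resMk φ hφ = 0 ↔ φ = 0 :=
  (res K A M B).extMk_zero_degree_eq_zero_iff φ _

theorem resMk_succ_eq_zero_iff {Y : ModuleCat.{u} (A ⊗[K] Bᵐᵒᵖ)} {n : ℕ}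
    (φ : resX K A M B (n + 1) ⟶ Y) (hφ : resD K A M B (n + 1) ≫ φ = 0) :
    resMk φ hφ = 0 ↔ ∃ ψ : resX K A M B n ⟶ Y, resD K A M B n ≫ ψ = φ := by
  have h := (res K A M B).extMk_eq_zero_iff φ (n + 2) rfl
    ((congrArg (fun d : resX K A M B (n + 2) ⟶ resX K A M B (n + 1) => d ≫ φ)
      (res_d K A M B (n + 1))).trans hφ) n rfl
  exact h.trans (exists_congr fun ψ => Eq.congr_left
    (congrArg (fun d : resX K A M B (n + 1) ⟶ resX K A M B n => d ≫ ψ) (res_d K A M B n)))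

theorem resMk_comp_mk₀ {Y Y' : ModuleCat.{u} (A ⊗[K] Bᵐᵒᵖ)} {n : ℕ}
    (φ : resX K A M B n ⟶ Y) (hφ : resD K A M B n ≫ φ = 0) (g : Y ⟶ Y') :
    (resMk φ hφ).comp (Ext.mk₀ g) (add_zero n) =
      resMk (φ ≫ g) (by rw [← Category.assoc, hφ, Limits.zero_comp]) :=
  (res K A M B).extMk_comp_mk₀ φ (n + 1) rfl _ g

theorem resD_resLift_cocycle {n : ℕ}
    (z : cocycles K (Tri K A M B) (Infl K A M B N) (n + 1)) :
    resD K A M B n ≫ resLift z.1 = 0 := by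
  rw [resD_resLift, LinearMap.mem_ker.1 z.2, resLift_zero]

variable (K A M B N) in
/-- The class in `Ext` of a Hochschild cocycle with coefficients in an inflated module. -/
noncomputable def extClass (n : ℕ) : cocycles K (Tri K A M B) (Infl K A M B N) (n + 1) →ₗ[K]
    Ext (ModuleCat.of (A ⊗[K] Bᵐᵒᵖ) M) (ModuleCat.of (A ⊗[K] Bᵐᵒᵖ) N) n where
  toFun z := resMk (resLift z.1) (resD_resLift_cocycle z)
  map_add' z w := (resMk_congr (resLift_add z.1 w.1) _ _).trans (resMk_add _ _ _ _)
  map_smul' k z := (resMk_congr (resLift_smul k z.1) _ _).trans (resMk_smul _ _ _)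

theorem extClass_apply {n : ℕ} (z : cocycles K (Tri K A M B) (Infl K A M B N) (n + 1)) :
    extClass K A M B N n z = resMk (resLift z.1) (resD_resLift_cocycle z) := rfl

theorem extClass_push_resCochain {n : ℕ} (φ : resX K A M B n ⟶ ModuleCat.of (A ⊗[K] Bᵐᵒᵖ) N)
    (hφ : resD K A M B n ≫ φ = 0) :
    ∃ z : cocycles K (Tri K A M B) (Infl K A M B N) (n + 1),
      z.1 = Infl.push φ.hom (n + 1) (resCochain K A M B n) ∧
      extClass K A M B N n z = resMk φ hφ := by
  have h : Infl.push φ.hom (n + 1) (resCochain K A M B n) ∈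
      cocycles K (Tri K A M B) (Infl K A M B N) (n + 1) := by
    rw [cocycles, LinearMap.mem_ker, delta_push_resCochain, hφ]
    rfl
  exact ⟨⟨_, h⟩, rfl, resMk_congr (resLift_push φ) (resD_resLift_cocycle ⟨_, h⟩) hφ⟩

theorem extClass_surjective (n : ℕ) : Function.Surjective (extClass K A M B N n) := by
  intro x
  obtain ⟨φ, hφ, rfl⟩ := resMk_surjective x
  obtain ⟨z, -, hz⟩ := extClass_push_resCochain φ hφ
  exact ⟨z, hz⟩

/-- For `n > 0` the coboundaries of the bar complex and of the resolution correspond under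
`resLift`. For `n = 0` there are none on the Ext side, while Hochschild 1-coboundaries are the
morphisms factoring through `barD K A M B 0`, which are zero on its kernel. -/
theorem extClass_eq_zero_iff {n : ℕ} (z : cocycles K (Tri K A M B) (Infl K A M B N) (n + 1)) :
    extClass K A M B N n z = 0 ↔ z.1 ∈ coboundaries K _ _ (n + 1) := by
  rw [extClass_apply]
  cases n with
  | zero =>
    rw [resMk_zero_eq_zero_iff]
    refine ⟨mem_coboundaries_of_resLift_eq_zero z.1, ?_⟩
    rintro ⟨w, hw⟩
    rw [← hw, resLift, ← barLift_comp_barD]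
    refine ModuleCat.hom_ext (LinearMap.ext fun x => ?_)
    change barLift w (barD K A M B 0 x.1) = 0
    rw [LinearMap.mem_ker.1 x.2, map_zero]
  | succ n =>
    rw [resMk_succ_eq_zero_iff]
    constructor
    · rintro ⟨g, hg⟩
      exact mem_coboundaries_of_resLift_eq z.1 g hg
    · rintro ⟨w, hw⟩
      exact ⟨resLift w, by rw [resD_resLift, hw]⟩

theorem extClass_push {N' : Type u} [AddCommGroup N'] [Module (A ⊗[K] Bᵐᵒᵖ) N']
    (g : N →ₗ[A ⊗[K] Bᵐᵒᵖ] N') {n : ℕ}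
    (z : cocycles K (Tri K A M B) (Infl K A M B N) (n + 1))
    (w : cocycles K (Tri K A M B) (Infl K A M B N') (n + 1))
    (h : w.1 = Infl.push g (n + 1) z.1) :
    extClass K A M B N' n w =
      (extClass K A M B N n z).comp (Ext.mk₀ (ModuleCat.ofHom g)) (add_zero n) := by
  rw [extClass_apply, extClass_apply, resMk_comp_mk₀]
  refine resMk_congr ?_ _ _
  have h' : barLift w.1 = g ∘ₗ barLift z.1 :=
    bar_hom_ext fun t => by rw [h, barLift_gen, LinearMap.comp_apply, barLift_gen]; rfl
  rw [resLift, h', ModuleCat.ofHom_comp, ← Category.assoc, resLift]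

end ExtClass

end Tri

/-! ### Functoriality in the corner module -/

namespace Infl

section Pull

variable {K A M M' B N : Type u} [CommRing K] [Ring A] [Algebra K A] [Ring B] [Algebra K B]
  [AddCommGroup M] [Module K M] [Module (A ⊗[K] Bᵐᵒᵖ) M] [IsScalarTower K (A ⊗[K] Bᵐᵒᵖ) M]
  [AddCommGroup M'] [Module K M'] [Module (A ⊗[K] Bᵐᵒᵖ) M'] [IsScalarTower K (A ⊗[K] Bᵐᵒᵖ) M']
  [AddCommGroup N] [Module (A ⊗[K] Bᵐᵒᵖ) N]

variable (K A M M' B N) in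
/-- The identity map between two inflations of the same module. -/
def change : Infl K A M' B N →ₗ[K] Infl K A M B N where
  toFun x := (equiv K A M B N).symm (equiv K A M' B N x)
  map_add' _ _ := rfl
  map_smul' _ _ := rfl

/-- The pull-back of cochains along the algebra morphism defined by a morphism `M → M'`. -/
def pull (f : M →ₗ[A ⊗[K] Bᵐᵒᵖ] M') (n : ℕ) :
    Cochain K (Tri K A M' B) (Infl K A M' B N) n →ₗ[K]
      Cochain K (Tri K A M B) (Infl K A M B N) n :=
  cochainMap (Tri.map f) (change K A M M' B N) n

theorem equiv_pull (f : M →ₗ[A ⊗[K] Bᵐᵒᵖ] M') {n : ℕ}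
    (z : Cochain K (Tri K A M' B) (Infl K A M' B N) n) (t : Fin n → Tri K A M B) :
    equiv K A M B N (pull f n z t) = equiv K A M' B N (z fun i => Tri.map f (t i)) := rfl

theorem delta_pull (f : M →ₗ[A ⊗[K] Bᵐᵒᵖ] M') {n : ℕ}
    (z : Cochain K (Tri K A M' B) (Infl K A M' B N) n) :
    delta K _ _ n (pull f n z) = pull f (n + 1) (delta K _ _ n z) :=
  (cochainMap_delta (Tri.map f) (change K A M M' B N) (fun _ _ => rfl) (fun _ _ => rfl) n z).symm

end Pull

end Infl

namespace Tri

section Functoriality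

variable {K A M M' B N : Type u} [CommRing K] [Ring A] [Algebra K A] [Ring B] [Algebra K B]
  [AddCommGroup M] [Module K M] [Module (A ⊗[K] Bᵐᵒᵖ) M] [IsScalarTower K (A ⊗[K] Bᵐᵒᵖ) M]
  [AddCommGroup M'] [Module K M'] [Module (A ⊗[K] Bᵐᵒᵖ) M'] [IsScalarTower K (A ⊗[K] Bᵐᵒᵖ) M']
  [AddCommGroup N] [Module (A ⊗[K] Bᵐᵒᵖ) N] (f : M →ₗ[A ⊗[K] Bᵐᵒᵖ] M')

/-- The morphism of bar complexes defined by a morphism `M → M'`. -/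
noncomputable def barMap (n : ℕ) : Bar K A M B n →ₗ[A ⊗[K] Bᵐᵒᵖ] Bar K A M' B n :=
  barLift (Infl.pull f n (univ K A M' B n))

theorem barMap_gen {n : ℕ} (t : Fin n → Tri K A M B) :
    barMap f n (gen K A M B n t) = gen K A M' B n fun i => Tri.map f (t i) :=
  barLift_gen _ t

theorem barLift_pull {n : ℕ} (z : Cochain K (Tri K A M' B) (Infl K A M' B N) n) :
    barLift (Infl.pull f n z) = barLift z ∘ₗ barMap f n :=
  bar_hom_ext fun t => by
    rw [barLift_gen, LinearMap.comp_apply, barMap_gen, barLift_gen, Infl.equiv_pull]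

theorem barMap_comp_barD (n : ℕ) :
    barMap f n ∘ₗ barD K A M B n = barD K A M' B n ∘ₗ barMap f (n + 1) := by
  rw [barMap, barLift_comp_barD, Infl.delta_pull, barLift_pull, barD]

theorem barMap_barD {n : ℕ} (x : Bar K A M B (n + 1)) :
    barMap f n (barD K A M B n x) = barD K A M' B n (barMap f (n + 1) x) :=
  congrArg (fun g : Bar K A M B (n + 1) →ₗ[A ⊗[K] Bᵐᵒᵖ] Bar K A M' B n => g x)
    (barMap_comp_barD f n)

theorem eps_barMap (x : Bar K A M B 1) :
    eps K A M' B (barMap f 1 x) = f (eps K A M B x) := by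
  have : eps K A M' B ∘ₗ barMap f 1 = f ∘ₗ eps K A M B := by
    refine bar_hom_ext fun t => ?_
    rw [LinearMap.comp_apply, LinearMap.comp_apply, barMap_gen, eps, barLift_gen, eps, barLift_gen]
    rfl
  exact congrArg (fun g : Bar K A M B 1 →ₗ[A ⊗[K] Bᵐᵒᵖ] M' => g x) this

/-- The morphism of resolutions defined by a morphism `M → M'`. -/
noncomputable def resMap : ∀ k, resX K A M B k ⟶ resX K A M' B k
  | 0 => ModuleCat.ofHom ((barMap f 1 ∘ₗ (LinearMap.ker (barD K A M B 0)).subtype).codRestrict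
      (LinearMap.ker (barD K A M' B 0)) fun x => by
        rw [LinearMap.mem_ker, LinearMap.comp_apply, ← barMap_barD]
        exact (congrArg (barMap f 0) x.2).trans (map_zero _))
  | k + 1 => ModuleCat.ofHom (barMap f (k + 2))

theorem resMap_resIncl (k : ℕ) : resMap f k ≫ resIncl K A M' B k =
    resIncl K A M B k ≫ ModuleCat.ofHom (barMap f (k + 1)) := by
  cases k with
  | zero => rfl
  | succ k => exact (Category.comp_id _).trans (Category.id_comp _).symm

theorem resMap_resD (k : ℕ) : resMap f (k + 1) ≫ resD K A M' B k =
    resD K A M B k ≫ resMap f k := by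
  cases k with
  | zero =>
    exact ModuleCat.hom_ext (LinearMap.ext fun x => Subtype.ext (barMap_barD f x).symm)
  | succ k => exact ModuleCat.hom_ext (LinearMap.ext fun x => (barMap_barD f x).symm)

theorem resMap_resEps : resMap f 0 ≫ resEps K A M' B = resEps K A M B ≫ ModuleCat.ofHom f :=
  ModuleCat.hom_ext (LinearMap.ext fun x => eps_barMap f x.1)

variable [Module.Projective K A] [Module.Projective K M] [Module.Projective K M']
  [Module.Projective K B]

/-- The morphism of projective resolutions defined by a morphism `M → M'`. -/
noncomputable def resHom :
    ProjectiveResolution.Hom (res K A M B) (res K A M' B) (ModuleCat.ofHom f) where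
  hom :=
    { f := resMap f
      comm' := by
        rintro _ k rfl
        refine (congrArg (fun d : resX K A M' B (k + 1) ⟶ resX K A M' B k =>
          resMap f (k + 1) ≫ d) (res_d K A M' B k)).trans ?_
        refine (resMap_resD f k).trans ?_
        exact congrArg (fun d : resX K A M B (k + 1) ⟶ resX K A M B k => d ≫ resMap f k)
          (res_d K A M B k).symm }
  hom_f_zero_comp_π_f_zero := by
    refine (congrArg (fun d : resX K A M' B 0 ⟶ ModuleCat.of (A ⊗[K] Bᵐᵒᵖ) M' =>
          resMap f 0 ≫ d) (res_π K A M' B)).trans ?_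
    refine (resMap_resEps f).trans ?_
    exact congrArg (fun d : resX K A M B 0 ⟶ ModuleCat.of (A ⊗[K] Bᵐᵒᵖ) M =>
          d ≫ ModuleCat.ofHom f) (res_π K A M B).symm

theorem mk₀_comp_resMk {Y : ModuleCat.{u} (A ⊗[K] Bᵐᵒᵖ)} {n : ℕ} (φ : resX K A M' B n ⟶ Y)
    (hφ : resD K A M' B n ≫ φ = 0) :
    (Ext.mk₀ (ModuleCat.ofHom f)).comp (resMk φ hφ) (zero_add n) =
      resMk (resMap f n ≫ φ) (by
        rw [← Category.assoc, ← resMap_resD, Category.assoc, hφ, Limits.comp_zero]) := by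
  have h : (res K A M' B).complex.d (n + 1) n ≫ φ = 0 :=
    (congrArg (fun d : resX K A M' B (n + 1) ⟶ resX K A M' B n => d ≫ φ)
      (res_d K A M' B n)).trans hφ
  exact (ProjectiveResolution.mk₀_comp_extMk (R := res K A M' B) φ (n + 1) rfl h (resHom f)).trans
    rfl

/-- Pulling cochains back along `T_M → T_{M'}` is composition with the morphism `resHom` of
resolutions lifting `f`. Together with `extClass_push`, this gives the matrix components of an Ext
class directly on cochains. -/
theorem extClass_pull {n : ℕ}
    (z : cocycles K (Tri K A M' B) (Infl K A M' B N) (n + 1))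
    (w : cocycles K (Tri K A M B) (Infl K A M B N) (n + 1))
    (h : w.1 = Infl.pull f (n + 1) z.1) :
    extClass K A M B N n w =
      (Ext.mk₀ (ModuleCat.ofHom f)).comp (extClass K A M' B N n z) (zero_add n) := by
  rw [extClass_apply, extClass_apply, mk₀_comp_resMk]
  refine resMk_congr ?_ _ _
  rw [resLift, h, barLift_pull, resLift, ← Category.assoc, resMap_resIncl, Category.assoc,
    ← ModuleCat.ofHom_comp]

end Functoriality

end Tri

/-! ### The canonical map from Ext to Hochschild cohomology, and its corner components -/

namespace Tri

section Happel

variable {K A M B : Type u} [CommRing K] [Ring A] [Algebra K A] [Ring B] [Algebra K B]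
  [AddCommGroup M] [Module K M] [Module (A ⊗[K] Bᵐᵒᵖ) M] [IsScalarTower K (A ⊗[K] Bᵐᵒᵖ) M]

variable (K A M B) in
/-- The bimodule inclusion `M → T`. -/
def inclM : Infl K A M B M →ₗ[K] Tri K A M B := inM K A M B ∘ₗ Infl.equivK K A M B M

theorem inclM_smul (t : Tri K A M B) (x : Infl K A M B M) :
    inclM K A M B (t • x) = t • inclM K A M B x := by
  ext
  · exact (mul_zero t.a).symm
  · refine (add_zero ((t.a ⊗ₜ[K] (1 : Bᵐᵒᵖ)) • Infl.equiv K A M B M x)).symm.trans ?_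
    exact congrArg (fun y => (t.a ⊗ₜ[K] (1 : Bᵐᵒᵖ)) • Infl.equiv K A M B M x + y)
      ((congrArg (fun r : A ⊗[K] Bᵐᵒᵖ => r • t.m) (TensorProduct.tmul_zero Bᵐᵒᵖ (1 : A))).trans
        (zero_tensor_smul t.m)).symm
  · exact (mul_zero t.b).symm

theorem inclM_op_smul (t : Tri K A M B) (x : Infl K A M B M) :
    inclM K A M B (MulOpposite.op t • x) = MulOpposite.op t • inclM K A M B x := by
  ext
  · exact (zero_mul t.a).symm
  · refine (zero_add (((1 : A) ⊗ₜ[K] MulOpposite.op t.b) • Infl.equiv K A M B M x)).symm.trans ?_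
    exact congrArg (fun y => y + ((1 : A) ⊗ₜ[K] MulOpposite.op t.b) • Infl.equiv K A M B M x)
      ((congrArg (fun r : A ⊗[K] Bᵐᵒᵖ => r • t.m) (TensorProduct.zero_tmul A (1 : Bᵐᵒᵖ))).trans
        (zero_tensor_smul t.m)).symm
  · exact (zero_mul t.b).symm

variable (K A M B) in
/-- Cochains with coefficients in `M` as cochains with coefficients in `T`. -/
def upper (n : ℕ) : Cochain K (Tri K A M B) (Infl K A M B M) n →ₗ[K]
    Cochain K (Tri K A M B) (Tri K A M B) n :=
  cochainMap (AlgHom.id K (Tri K A M B)) (inclM K A M B) n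

theorem upper_injective {n : ℕ} : Function.Injective (upper K A M B n) := by
  intro z w h
  ext t
  exact congrArg (fun f => (f t).m) h

theorem delta_upper {n : ℕ} (z : Cochain K (Tri K A M B) (Infl K A M B M) n) :
    delta K _ _ n (upper K A M B n z) = upper K A M B (n + 1) (delta K _ _ n z) :=
  (cochainMap_delta (AlgHom.id K (Tri K A M B)) (inclM K A M B) inclM_smul inclM_op_smul n z).symm

variable {N₁ N₂ : Type u} [AddCommGroup N₁] [Module K N₁] [Module (A ⊗[K] Bᵐᵒᵖ) N₁]
  [IsScalarTower K (A ⊗[K] Bᵐᵒᵖ) N₁] [AddCommGroup N₂] [Module (A ⊗[K] Bᵐᵒᵖ) N₂]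

variable (N₁) in
/-- The upper right entry, followed by a morphism `M → N₂`. -/
def cornerMap (π : M →ₗ[A ⊗[K] Bᵐᵒᵖ] N₂) : Tri K A M B →ₗ[K] Infl K A N₁ B N₂ where
  toFun t := (Infl.equiv K A N₁ B N₂).symm (π t.m)
  map_add' s t := by rw [add_m, map_add, map_add]
  map_smul' k t := by
    rw [smul_m, ← algebraMap_smul (A ⊗[K] Bᵐᵒᵖ) k t.m, map_smul]
    rfl

/-- The corner cochain `π f(ι ×⋯× ι)` of a cochain `f`. -/
def cornerCochain (ι : N₁ →ₗ[A ⊗[K] Bᵐᵒᵖ] M) (π : M →ₗ[A ⊗[K] Bᵐᵒᵖ] N₂) (n : ℕ) :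
    Cochain K (Tri K A M B) (Tri K A M B) n →ₗ[K]
      Cochain K (Tri K A N₁ B) (Infl K A N₁ B N₂) n :=
  cochainMap (map ι) (cornerMap N₁ π) n

/-- The product of `map ι s` and `t` has in its corner a second term, the image of `s.m` under `ι`
times `t.b`. It is the only obstruction to equivariance, and `π ι = 0` removes it. -/
theorem cornerMap_smul {ι : N₁ →ₗ[A ⊗[K] Bᵐᵒᵖ] M} {π : M →ₗ[A ⊗[K] Bᵐᵒᵖ] N₂}
    (h : ∀ x, π (ι x) = 0) (s : Tri K A N₁ B) (t : Tri K A M B) :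
    cornerMap N₁ π (map ι s • t) = s • cornerMap N₁ π t := by
  change π ((s.a ⊗ₜ[K] (1 : Bᵐᵒᵖ)) • t.m + ((1 : A) ⊗ₜ[K] MulOpposite.op t.b) • ι s.m) =
    (s.a ⊗ₜ[K] (1 : Bᵐᵒᵖ)) • π t.m
  rw [map_add, map_smul, map_smul, h, smul_zero, add_zero]

theorem cornerMap_op_smul {ι : N₁ →ₗ[A ⊗[K] Bᵐᵒᵖ] M} {π : M →ₗ[A ⊗[K] Bᵐᵒᵖ] N₂}
    (h : ∀ x, π (ι x) = 0) (s : Tri K A N₁ B) (t : Tri K A M B) :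
    cornerMap N₁ π (MulOpposite.op (map ι s) • t) = MulOpposite.op s • cornerMap N₁ π t := by
  change π ((t.a ⊗ₜ[K] (1 : Bᵐᵒᵖ)) • ι s.m + ((1 : A) ⊗ₜ[K] MulOpposite.op s.b) • t.m) =
    ((1 : A) ⊗ₜ[K] MulOpposite.op s.b) • π t.m
  rw [map_add, map_smul, map_smul, h, smul_zero, zero_add]

variable [Module.Projective K A] [Module.Projective K M] [Module.Projective K B]

variable (K A M B) in
/-- The isomorphism `Hⁿ⁺¹(T, N) ≃ Extⁿ(M, N)`. -/
noncomputable def extCohomology (N : Type u) [AddCommGroup N] [Module (A ⊗[K] Bᵐᵒᵖ) N] (n : ℕ) :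
    Cohomology K (Tri K A M B) (Infl K A M B N) (n + 1) ≃ₗ[K]
      Ext (ModuleCat.of (A ⊗[K] Bᵐᵒᵖ) M) (ModuleCat.of (A ⊗[K] Bᵐᵒᵖ) N) n :=
  LinearEquiv.ofBijective
    (Submodule.liftQ _ (extClass K A M B N n) fun z hz => (extClass_eq_zero_iff z).2 hz)
    ⟨LinearMap.ker_eq_bot.1 (Submodule.ker_liftQ_eq_bot _ _ _ fun z hz =>
      (extClass_eq_zero_iff z).1 hz),
    fun x => by
      obtain ⟨z, rfl⟩ := extClass_surjective n x
      exact ⟨Submodule.Quotient.mk z, rfl⟩⟩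

variable (K A M B) in
/-- The canonical map `Extⁿ(M, M) → HHⁿ⁺¹(T)`. -/
noncomputable def happelMap (n : ℕ) :
    Ext (ModuleCat.of (A ⊗[K] Bᵐᵒᵖ) M) (ModuleCat.of (A ⊗[K] Bᵐᵒᵖ) M) n →ₗ[K]
      HH K (Tri K A M B) (n + 1) :=
  cohomologyMap (AlgHom.id K (Tri K A M B)) (inclM K A M B) inclM_smul inclM_op_smul (n + 1) ∘ₗ
    (extCohomology K A M B M n).symm.toLinearMap

theorem upper_mem_cocycles {n : ℕ} (z : cocycles K (Tri K A M B) (Infl K A M B M) n) :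
    upper K A M B n z.1 ∈ cocycles K (Tri K A M B) (Tri K A M B) n := by
  rw [cocycles, LinearMap.mem_ker, delta_upper, LinearMap.mem_ker.1 z.2, map_zero]

theorem happelMap_extClass {n : ℕ} (z : cocycles K (Tri K A M B) (Infl K A M B M) (n + 1)) :
    happelMap K A M B n (extClass K A M B M n z) =
      Submodule.Quotient.mk ⟨upper K A M B (n + 1) z.1, upper_mem_cocycles z⟩ := by
  have : (extCohomology K A M B M n).symm (extClass K A M B M n z) = Submodule.Quotient.mk z :=
    (LinearEquiv.symm_apply_eq _).2 rfl
  exact congrArg (cohomologyMap (AlgHom.id K (Tri K A M B)) (inclM K A M B) inclM_smul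
    inclM_op_smul (n + 1)) this

/-- The universal cochains `resCochain` lift the derivation `T → M` through `res`, so the Yoneda
product of the class of `φ` with that derivation is represented by `φ` composed with `resCochain`,
the very cocycle used for `happelMap`. -/
theorem isHappelImage_happelMap (n : ℕ)
    (x : Ext (ModuleCat.of (A ⊗[K] Bᵐᵒᵖ) M) (ModuleCat.of (A ⊗[K] Bᵐᵒᵖ) M) n) :
    IsHappelImage n x (happelMap K A M B n x) := by
  obtain ⟨φ, hφ, rfl⟩ := resMk_surjective x
  obtain ⟨z, hz, hz'⟩ := extClass_push_resCochain φ hφ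
  refine ⟨res K A M B, resCochain K A M B, φ, _, ⟨_, upper_mem_cocycles z⟩,
    fun t => ?_, fun k t => ?_, rfl, fun t => ?_, ?_⟩
  · refine Eq.trans ?_ (resEps_resCochain K A M B t)
    exact congrArg (fun f : resX K A M B 0 ⟶ ModuleCat.of (A ⊗[K] Bᵐᵒᵖ) M =>
      f.hom (resCochain K A M B 0 t)) (res_π K A M B)
  · refine Eq.trans ?_ (congrArg (fun f => f t) (resD_resCochain K A M B k))
    exact congrArg (fun f : resX K A M B (k + 1) ⟶ resX K A M B k =>
      f.hom (resCochain K A M B (k + 1) t)) (res_d K A M B k)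
  · change upper K A M B (n + 1) z.1 t = _
    rw [hz]
    rfl
  · rw [← hz', happelMap_extClass]

variable [Module.Projective K N₁]

/-- The map `HHⁿ⁺¹(T) → Extⁿ(N₁, N₂)` defined by morphisms `ι : N₁ → M` and `π : M → N₂` with
`π ι = 0`. -/
noncomputable def cornerHH (ι : N₁ →ₗ[A ⊗[K] Bᵐᵒᵖ] M) (π : M →ₗ[A ⊗[K] Bᵐᵒᵖ] N₂)
    (h : ∀ x, π (ι x) = 0) (n : ℕ) : HH K (Tri K A M B) (n + 1) →ₗ[K]
      Ext (ModuleCat.of (A ⊗[K] Bᵐᵒᵖ) N₁) (ModuleCat.of (A ⊗[K] Bᵐᵒᵖ) N₂) n :=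
  (extCohomology K A N₁ B N₂ n).toLinearMap ∘ₗ
    cohomologyMap (map ι) (cornerMap N₁ π) (cornerMap_smul h) (cornerMap_op_smul h) (n + 1)

theorem extClass_pull_push (ι : N₁ →ₗ[A ⊗[K] Bᵐᵒᵖ] M) (π : M →ₗ[A ⊗[K] Bᵐᵒᵖ] N₂) {n : ℕ}
    (z : cocycles K (Tri K A M B) (Infl K A M B M) (n + 1))
    (w : cocycles K (Tri K A N₁ B) (Infl K A N₁ B N₂) (n + 1))
    (h : w.1 = Infl.pull ι (n + 1) (Infl.push π (n + 1) z.1)) :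
    extClass K A N₁ B N₂ n w = (Ext.mk₀ (ModuleCat.ofHom ι)).comp
      ((extClass K A M B M n z).comp (Ext.mk₀ (ModuleCat.ofHom π)) (add_zero n)) (zero_add n) := by
  have hv : Infl.push π (n + 1) z.1 ∈ cocycles K (Tri K A M B) (Infl K A M B N₂) (n + 1) := by
    rw [cocycles, LinearMap.mem_ker, Infl.delta_push, LinearMap.mem_ker.1 z.2, map_zero]
  rw [extClass_pull ι ⟨_, hv⟩ w h, extClass_push π z ⟨_, hv⟩ rfl]

/-- This recovers components of an Ext class from its image alone; the retraction of `l*` is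
assembled from such maps. -/
theorem cornerHH_happelMap (ι : N₁ →ₗ[A ⊗[K] Bᵐᵒᵖ] M) (π : M →ₗ[A ⊗[K] Bᵐᵒᵖ] N₂)
    (h : ∀ x, π (ι x) = 0) (n : ℕ)
    (x : Ext (ModuleCat.of (A ⊗[K] Bᵐᵒᵖ) M) (ModuleCat.of (A ⊗[K] Bᵐᵒᵖ) M) n) :
    cornerHH ι π h n (happelMap K A M B n x) = (Ext.mk₀ (ModuleCat.ofHom ι)).comp
      (x.comp (Ext.mk₀ (ModuleCat.ofHom π)) (add_zero n)) (zero_add n) := by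
  obtain ⟨z, rfl⟩ := extClass_surjective n x
  rw [happelMap_extClass]
  exact extClass_pull_push ι π z _ rfl

end Happel

end Tri

/-! ### The kernel of the restriction map -/

namespace Tri

section Restriction

variable {K A M N B : Type u} [CommRing K] [Ring A] [Algebra K A] [Ring B] [Algebra K B]
  [AddCommGroup M] [Module K M] [Module (A ⊗[K] Bᵐᵒᵖ) M] [IsScalarTower K (A ⊗[K] Bᵐᵒᵖ) M]
  [AddCommGroup N] [Module K N] [Module (A ⊗[K] Bᵐᵒᵖ) N] [IsScalarTower K (A ⊗[K] Bᵐᵒᵖ) N]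

/-- The cochain `T(π) f(T(ι) ×⋯× T(ι))`. -/
def restrictCochain (ι : N →ₗ[A ⊗[K] Bᵐᵒᵖ] M) (π : M →ₗ[A ⊗[K] Bᵐᵒᵖ] N) (n : ℕ) :
    Cochain K (Tri K A M B) (Tri K A M B) n →ₗ[K] Cochain K (Tri K A N B) (Tri K A N B) n :=
  cochainMap (map ι) (map π).toLinearMap n

theorem delta_restrictCochain {ι : N →ₗ[A ⊗[K] Bᵐᵒᵖ] M} {π : M →ₗ[A ⊗[K] Bᵐᵒᵖ] N}
    (h : ∀ x, π (ι x) = x) {n : ℕ} (f : Cochain K (Tri K A M B) (Tri K A M B) n) :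
    delta K _ _ n (restrictCochain ι π n f) = restrictCochain ι π (n + 1) (delta K _ _ n f) :=
  (cochainMap_delta (map ι) (map π).toLinearMap (fun s x => by ext <;> simp [map_apply, h])
    (fun s x => by ext <;> simp [map_apply, h]) n f).symm

theorem map_delta (ρ : M →ₗ[A ⊗[K] Bᵐᵒᵖ] N) {n : ℕ}
    {f : Cochain K (Tri K A M B) (Tri K A M B) n} {g : Cochain K (Tri K A N B) (Tri K A N B) n}
    (h : ∀ t, map ρ (f t) = g fun i => map ρ (t i)) (t : Fin (n + 1) → Tri K A M B) :
    map ρ (delta K _ _ n f t) = delta K _ _ n g fun i => map ρ (t i) := by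
  have hc : ∀ j : Fin n, (Fin.contractNth j.castSucc (· * ·) fun i => map ρ (t i)) =
      fun i => map ρ (Fin.contractNth j.castSucc (· * ·) t i) := by
    intro j
    ext1 i
    simp only [Fin.contractNth]
    split_ifs <;> simp
  simp only [delta_apply, map_add, map_sum, map_smul, smul_eq_mul, MulOpposite.smul_eq_mul_unop,
    MulOpposite.unop_op, map_mul, h, hc]
  rfl

/-- The projection of `T` to `A` is multiplicative, so diagonal entries of a coboundary ignore the
corner entries of the values, whatever `ρ` is. -/
theorem delta_a (ρ : M →ₗ[A ⊗[K] Bᵐᵒᵖ] N) {n : ℕ}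
    {f : Cochain K (Tri K A M B) (Tri K A M B) n} {g : Cochain K (Tri K A N B) (Tri K A N B) n}
    (h : ∀ t, (f t).a = (g fun i => map ρ (t i)).a) (t : Fin (n + 1) → Tri K A M B) :
    (delta K _ _ n f t).a = (delta K _ _ n g fun i => map ρ (t i)).a := by
  have hc : ∀ j : Fin n, (Fin.contractNth j.castSucc (· * ·) fun i => map ρ (t i)) =
      fun i => map ρ (Fin.contractNth j.castSucc (· * ·) t i) := by
    intro j
    ext1 i
    simp only [Fin.contractNth]
    split_ifs <;> simp
  rw [← prA_apply, ← prA_apply]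
  simp only [delta_apply, map_add, map_sum, map_smul, smul_eq_mul, MulOpposite.smul_eq_mul_unop,
    MulOpposite.unop_op, hc]
  simp only [prA_apply, mul_a, h]
  rfl

theorem delta_b (ρ : M →ₗ[A ⊗[K] Bᵐᵒᵖ] N) {n : ℕ}
    {f : Cochain K (Tri K A M B) (Tri K A M B) n} {g : Cochain K (Tri K A N B) (Tri K A N B) n}
    (h : ∀ t, (f t).b = (g fun i => map ρ (t i)).b) (t : Fin (n + 1) → Tri K A M B) :
    (delta K _ _ n f t).b = (delta K _ _ n g fun i => map ρ (t i)).b := by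
  have hc : ∀ j : Fin n, (Fin.contractNth j.castSucc (· * ·) fun i => map ρ (t i)) =
      fun i => map ρ (Fin.contractNth j.castSucc (· * ·) t i) := by
    intro j
    ext1 i
    simp only [Fin.contractNth]
    split_ifs <;> simp
  rw [← prB_apply, ← prB_apply]
  simp only [delta_apply, map_add, map_sum, map_smul, smul_eq_mul, MulOpposite.smul_eq_mul_unop,
    MulOpposite.unop_op, hc]
  simp only [prB_apply, mul_b, h]
  rfl

theorem map_map_of_retract {ι : N →ₗ[A ⊗[K] Bᵐᵒᵖ] M} {π : M →ₗ[A ⊗[K] Bᵐᵒᵖ] N}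
    (h : ∀ x, π (ι x) = x) (t : Tri K A N B) : map π (map ι t) = t := by
  ext <;> simp [map_apply, h]

/-- A cochain whose values have zero diagonal comes from the upper right entry. -/
theorem exists_upper_eq {n : ℕ} (f : Cochain K (Tri K A M B) (Tri K A M B) n)
    (ha : ∀ t, (f t).a = 0) (hb : ∀ t, (f t).b = 0) : ∃ z, upper K A M B n z = f := by
  refine ⟨cornerMap M LinearMap.id |>.compMultilinearMap f, ?_⟩
  ext t
  · exact (ha t).symm
  · rfl
  · exact (hb t).symm

theorem IsDiagonal.a_eq {n : ℕ} {f : Cochain K (Tri K A M B) (Tri K A M B) n}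
    (hf : IsDiagonal f) {s t : Fin n → Tri K A M B} (h : ∀ i, (s i).a = (t i).a) :
    (f s).a = (f t).a := by
  rw [hf.1 s, hf.1 t]
  simp only [h]

theorem IsDiagonal.b_eq {n : ℕ} {f : Cochain K (Tri K A M B) (Tri K A M B) n}
    (hf : IsDiagonal f) {s t : Fin n → Tri K A M B} (h : ∀ i, (s i).b = (t i).b) :
    (f s).b = (f t).b := by
  rw [hf.2 s, hf.2 t]
  simp only [h]

theorem mk_eq_mk_iff {T : Type u} [Ring T] [Algebra K T] {n : ℕ}
    (z w : cocycles K T T n) :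
    (Submodule.Quotient.mk z : HH K T n) = Submodule.Quotient.mk w ↔
      z.1 - w.1 ∈ coboundaries K T T n :=
  Submodule.Quotient.eq _

theorem exists_isDiagonal_rep {n : ℕ} (y : HH K (Tri K A M B) (n + 1)) :
    ∃ z : cocycles K (Tri K A M B) (Tri K A M B) (n + 1),
      IsDiagonal z.1 ∧ Submodule.Quotient.mk z = y := by
  obtain ⟨⟨f, hf⟩, rfl⟩ := Submodule.Quotient.mk_surjective _ y
  obtain ⟨g, hg⟩ := exists_isDiagonal f hf
  refine ⟨⟨_, ?_⟩, hg, ?_⟩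
  · rw [cocycles, LinearMap.mem_ker, map_sub, LinearMap.mem_ker.1 hf, delta_delta, sub_zero]
  · rw [mk_eq_mk_iff]
    exact ⟨-g, by rw [map_neg, sub_sub_cancel_left]⟩

theorem restrictHH_mk (ι : N →ₗ[A ⊗[K] Bᵐᵒᵖ] M) (π : M →ₗ[A ⊗[K] Bᵐᵒᵖ] N)
    (h : ∀ x, π (ι x) = x) {n : ℕ} (z : cocycles K (Tri K A M B) (Tri K A M B) n)
    (w : cocycles K (Tri K A N B) (Tri K A N B) n) (hw : restrictCochain ι π n z.1 = w.1) :
    restrictHH ι π h n (Submodule.Quotient.mk z) = Submodule.Quotient.mk w :=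
  congrArg Submodule.Quotient.mk (Subtype.ext hw)

theorem restrictCochain_mem_cocycles {ι : N →ₗ[A ⊗[K] Bᵐᵒᵖ] M} {π : M →ₗ[A ⊗[K] Bᵐᵒᵖ] N}
    (h : ∀ x, π (ι x) = x) {n : ℕ} (z : cocycles K (Tri K A M B) (Tri K A M B) n) :
    restrictCochain ι π n z.1 ∈ cocycles K (Tri K A N B) (Tri K A N B) n := by
  rw [cocycles, LinearMap.mem_ker, delta_restrictCochain h, LinearMap.mem_ker.1 z.2, map_zero]

theorem restrictCochain_upper {n : ℕ} (ι : N →ₗ[A ⊗[K] Bᵐᵒᵖ] M)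
    (π : M →ₗ[A ⊗[K] Bᵐᵒᵖ] N) (z : Cochain K (Tri K A M B) (Infl K A M B M) n) :
    restrictCochain ι π n (upper K A M B n z) =
      upper K A N B n (Infl.pull ι n (Infl.push π n z)) := by
  ext t <;> rfl

section Exact

variable [Module.Projective K A] [Module.Projective K M] [Module.Projective K B]
  [Module.Projective K N]

theorem exists_happelMap_eq {ι : N →ₗ[A ⊗[K] Bᵐᵒᵖ] M} {π : M →ₗ[A ⊗[K] Bᵐᵒᵖ] N}
    (h : ∀ x, π (ι x) = x) {n : ℕ} (y : HH K (Tri K A M B) (n + 1))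
    (hy : restrictHH ι π h (n + 1) y = 0) :
    ∃ x, happelMap K A M B n x = y ∧ (Ext.mk₀ (ModuleCat.ofHom ι)).comp
      (x.comp (Ext.mk₀ (ModuleCat.ofHom π)) (add_zero n)) (zero_add n) = 0 := by
  obtain ⟨f, hf, rfl⟩ := exists_isDiagonal_rep y
  rw [restrictHH_mk ι π h f ⟨_, restrictCochain_mem_cocycles h f⟩ rfl,
    Submodule.Quotient.mk_eq_zero] at hy
  obtain ⟨g, hg⟩ := hy
  change delta K _ _ n g = restrictCochain ι π (n + 1) f.1 at hg
  -- The second argument `0` discards the corner of `g` and keeps its diagonal, pulled back to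
  -- `T_M`. Then `f - δG` has zero diagonal, because the diagonal of `f` sees only the diagonal of
  -- its arguments.
  let G : Cochain K (Tri K A M B) (Tri K A M B) n := restrictCochain π 0 n g
  have hG : ∀ t, (delta K _ _ n G t).a = (f.1 t).a := fun t => by
    rw [delta_a (g := g) π (fun _ => rfl), hg]
    exact hf.a_eq fun _ => rfl
  have hG' : ∀ t, (delta K _ _ n G t).b = (f.1 t).b := fun t => by
    rw [delta_b (g := g) π (fun _ => rfl), hg]
    exact hf.b_eq fun _ => rfl
  obtain ⟨z, hz⟩ := exists_upper_eq (f.1 - delta K _ _ n G)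
    (fun t => (congrArg (fun a => (f.1 t).a - a) (hG t)).trans (sub_self _))
    (fun t => (congrArg (fun b => (f.1 t).b - b) (hG' t)).trans (sub_self _))
  have hz' : z ∈ cocycles K (Tri K A M B) (Infl K A M B M) (n + 1) := by
    refine upper_injective ?_
    rw [← delta_upper, hz, map_sub, delta_delta, LinearMap.mem_ker.1 f.2, sub_zero, map_zero]
  -- `G` restricts to the diagonal part of `g`. The rest of `g` is a cochain `v` with values in the
  -- corner, and `δv` is the restriction of `z`; thus the component of the Ext class on `N` is zero.
  obtain ⟨v, hv⟩ := exists_upper_eq (g - restrictCochain ι π n G)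
    (fun t => (congrArg (fun s => (g t).a - (g s).a)
      (funext fun i => map_map_of_retract h (t i))).trans (sub_self _))
    (fun t => (congrArg (fun s => (g t).b - (g s).b)
      (funext fun i => map_map_of_retract h (t i))).trans (sub_self _))
  have hw : delta K _ _ n v = Infl.pull ι (n + 1) (Infl.push π (n + 1) z) := by
    refine upper_injective ?_
    rw [← delta_upper, hv, ← restrictCochain_upper, hz, map_sub, map_sub, hg,
      delta_restrictCochain h]
  have hw' : delta K _ _ n v ∈ cocycles K (Tri K A N B) (Infl K A N B N) (n + 1) := by
    rw [cocycles, LinearMap.mem_ker, delta_delta]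
  refine ⟨extClass K A M B M n ⟨z, hz'⟩, ?_, ?_⟩
  · rw [happelMap_extClass, mk_eq_mk_iff]
    refine ⟨-G, ?_⟩
    change delta K _ _ n (-G) = upper K A M B (n + 1) z - f.1
    rw [map_neg, hz, sub_sub_cancel_left]
  · rw [← extClass_pull_push ι π ⟨z, hz'⟩ ⟨_, hw'⟩ hw, extClass_eq_zero_iff]
    exact ⟨v, rfl⟩

end Exact

end Restriction

end Tri

/-! ### Lifting cocycles along the restriction map -/

namespace Tri

section Lift

variable {K A M N B : Type u} [CommRing K] [Ring A] [Algebra K A] [Ring B] [Algebra K B]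
  [AddCommGroup M] [Module K M] [Module (A ⊗[K] Bᵐᵒᵖ) M] [IsScalarTower K (A ⊗[K] Bᵐᵒᵖ) M]
  [AddCommGroup N] [Module K N] [Module (A ⊗[K] Bᵐᵒᵖ) N] [IsScalarTower K (A ⊗[K] Bᵐᵒᵖ) N]
  {J : Type*} [Fintype J] [DecidableEq J] {Y : J → Type u} [∀ j, AddCommGroup (Y j)]
  [∀ j, Module K (Y j)] [∀ j, Module (A ⊗[K] Bᵐᵒᵖ) (Y j)]
  [∀ j, IsScalarTower K (A ⊗[K] Bᵐᵒᵖ) (Y j)]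
  {ι : ∀ j, Y j →ₗ[A ⊗[K] Bᵐᵒᵖ] M} {π : ∀ j, M →ₗ[A ⊗[K] Bᵐᵒᵖ] Y j}
  (hπι : ∀ j x, π j (ι j x) = x) (hπι' : ∀ j k, j ≠ k → ∀ x, π j (ι k x) = 0)
  (hπ : ∀ x, (∀ j, π j x = 0) → x = 0)
  {ι' : ∀ j, Y j →ₗ[A ⊗[K] Bᵐᵒᵖ] N} {π' : ∀ j, N →ₗ[A ⊗[K] Bᵐᵒᵖ] Y j}
  (h' : ∀ j x, π' j (ι' j x) = x)

include hπι hπι' hπ h' in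
-- Here `M` is cut into pieces `Y j`, each a retract of `N`. Extending the corner of `f` by zero
-- would not give a cocycle, since the diagonal of `f` acts on every piece. Instead each piece
-- carries the compression of the corner of `f` to that piece.
theorem exists_cocycle_lift {n : ℕ} (f : cocycles K (Tri K A N B) (Tri K A N B) n)
    (hf : IsDiagonal f.1) : ∃ g : cocycles K (Tri K A M B) (Tri K A M B) n,
      (∀ t, (g.1 t).a = (f.1 fun i => map 0 (t i)).a) ∧
      (∀ t, (g.1 t).b = (f.1 fun i => map 0 (t i)).b) ∧
      ((∀ t, (f.1 t).m = 0) → ∀ t, (g.1 t).m = 0) := by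
  let g : Cochain K (Tri K A M B) (Tri K A M B) n := restrictCochain 0 0 n f.1 +
    upper K A M B n (∑ j, cornerCochain (ι' j ∘ₗ π j) (ι j ∘ₗ π' j) n f.1)
  have ha : ∀ t, (g t).a = (f.1 fun i => map 0 (t i)).a := fun t => add_zero _
  have hb : ∀ t, (g t).b = (f.1 fun i => map 0 (t i)).b := fun t => add_zero _
  have hm : ∀ t, (g t).m = ∑ j, ι j (π' j (f.1 fun i => map (ι' j ∘ₗ π j) (t i)).m) := fun t => by
    refine (zero_add _).trans ?_
    change Infl.equiv K A M B M ((∑ j, cornerCochain (ι' j ∘ₗ π j) (ι j ∘ₗ π' j) n f.1) t) = _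
    rw [sum_apply, map_sum]
    rfl
  -- Projected to a piece, `g` is the pullback of the cocycle that `f` induces on the triangular
  -- algebra of that piece. The diagonal and these projections detect zero, so `g` is a cocycle.
  have hj : ∀ j t, map (π j) (g t) =
      restrictCochain (ι' j) (π' j) n f.1 fun i => map (π j) (t i) := fun j t => by
    ext
    · exact (ha t).trans (hf.a_eq fun _ => rfl)
    · change π j (g t).m = π' j (f.1 fun i => map (ι' j ∘ₗ π j) (t i)).m
      rw [hm, map_sum, Finset.sum_eq_single j (fun k _ hk => hπι' j k hk.symm _) (by simp), hπι]
    · exact (hb t).trans (hf.b_eq fun _ => rfl)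
  have hf' : delta K _ _ n f.1 = 0 := f.2
  have hg : delta K _ _ n g = 0 := by
    ext t
    · exact (delta_a (g := f.1) 0 ha t).trans (by rw [hf']; rfl)
    · refine hπ _ fun j => ?_
      have h1 := map_delta (π j) (hj j) t
      rw [delta_restrictCochain (h' j), hf', map_zero] at h1
      exact congrArg Tri.m h1
    · exact (delta_b (g := f.1) 0 hb t).trans (by rw [hf']; rfl)
  refine ⟨⟨g, hg⟩, ha, hb, fun hfm t => (hm t).trans (Finset.sum_eq_zero fun j _ => ?_)⟩
  rw [hfm, map_zero, map_zero]

include hπι hπι' hπ h' in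
-- The lift restricts to a cocycle with the correct diagonal. The difference has values in the
-- corner, and a corner cocycle does extend by zero, being pulled back along `proj` and pushed
-- forward along `incl`.
theorem restrictHH_succ_surjective {incl : N →ₗ[A ⊗[K] Bᵐᵒᵖ] M} {proj : M →ₗ[A ⊗[K] Bᵐᵒᵖ] N}
    (h : ∀ x, proj (incl x) = x) (n : ℕ) :
    Function.Surjective (restrictHH (K := K) (B := B) incl proj h (n + 1)) := by
  intro y
  obtain ⟨f, hf, rfl⟩ := exists_isDiagonal_rep y
  obtain ⟨g, ha, hb, -⟩ := exists_cocycle_lift hπι hπι' hπ h' f hf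
  have ha' : ∀ t, (f.1 t).a = (restrictCochain incl proj (n + 1) g.1 t).a := fun t => by
    refine Eq.trans ?_ (ha fun i => map incl (t i)).symm
    exact hf.a_eq fun _ => rfl
  have hb' : ∀ t, (f.1 t).b = (restrictCochain incl proj (n + 1) g.1 t).b := fun t => by
    refine Eq.trans ?_ (hb fun i => map incl (t i)).symm
    exact hf.b_eq fun _ => rfl
  obtain ⟨z, hz⟩ := exists_upper_eq (f.1 - restrictCochain incl proj (n + 1) g.1)
    (fun t => sub_eq_zero.2 (ha' t))
    (fun t => sub_eq_zero.2 (hb' t))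
  have hz' : delta K _ _ (n + 1) z = 0 := by
    refine upper_injective ?_
    rw [← delta_upper, hz, map_sub, LinearMap.mem_ker.1 f.2,
      LinearMap.mem_ker.1 (restrictCochain_mem_cocycles h g), sub_zero, map_zero]
  have hw : g.1 + upper K A M B (n + 1) (Infl.pull proj (n + 1) (Infl.push incl (n + 1) z)) ∈
      cocycles K (Tri K A M B) (Tri K A M B) (n + 1) := by
    refine LinearMap.mem_ker.2 ?_
    rw [map_add, delta_upper, Infl.delta_pull, Infl.delta_push, hz',
      map_zero, map_zero, map_zero, add_zero]
    exact g.2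
  refine ⟨Submodule.Quotient.mk ⟨_, hw⟩, restrictHH_mk incl proj h _ _ ?_⟩
  have h1 : Infl.pull incl (n + 1) (Infl.push proj (n + 1)
      (Infl.pull proj (n + 1) (Infl.push incl (n + 1) z))) = z := by
    ext t
    change proj (incl (z fun i => map proj (map incl (t i)))) = z t
    simp only [map_map_of_retract h]
    exact h _
  change restrictCochain incl proj (n + 1) (g.1 + upper K A M B (n + 1) _) = f.1
  rw [map_add, restrictCochain_upper, h1, hz, add_sub_cancel]

theorem smul_eq_of_mem_cocycles_zero {T : Type u} [Ring T] [Algebra K T]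
    (f : cocycles K T T 0) (t : T) : t * f.1 ![] = f.1 ![] * t := by
  have := congrArg (fun g => g ![t]) (LinearMap.mem_ker.1 f.2)
  rw [delta_zero_apply] at this
  exact sub_eq_zero.1 this

/-- A 0-cocycle is a central element, and commuting with the upper left idempotent kills the corner.
-/
theorem m_eq_zero_of_cocycle (f : cocycles K (Tri K A M B) (Tri K A M B) 0)
    (t : Fin 0 → Tri K A M B) : (f.1 t).m = 0 := by
  rw [Subsingleton.elim t ![]]
  have := congrArg Tri.m (smul_eq_of_mem_cocycles_zero f (inA K A M B 1))
  simp only [mul_m, inA_apply_a, inA_apply_m, inA_apply_b, MulOpposite.op_zero,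
    TensorProduct.tmul_zero, smul_zero, add_zero, zero_add] at this
  rw [one_tmul_one_smul, zero_tensor_smul] at this
  exact this

include hπι hπι' hπ h' in
-- Central elements are diagonal, and restriction does not change the diagonal. Surjectivity means
-- that a pair central for `N` is central for `M`, which holds because every piece of `M` is a
-- retract of `N`.
theorem restrictHH_zero_bijective {incl : N →ₗ[A ⊗[K] Bᵐᵒᵖ] M} {proj : M →ₗ[A ⊗[K] Bᵐᵒᵖ] N}
    (h : ∀ x, proj (incl x) = x) :
    Function.Bijective (restrictHH (K := K) (B := B) incl proj h 0) := by
  constructor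
  · rw [injective_iff_map_eq_zero]
    intro y hy
    obtain ⟨f, rfl⟩ := Submodule.Quotient.mk_surjective _ y
    rw [restrictHH_mk incl proj h f ⟨_, restrictCochain_mem_cocycles h f⟩ rfl,
      Submodule.Quotient.mk_eq_zero] at hy
    replace hy : restrictCochain incl proj 0 f.1 = 0 := hy
    have hf : f = 0 := by
      ext t
      · rw [Subsingleton.elim t ![]]
        have := congrArg (fun g => (g ![]).a) hy
        rw [Subsingleton.elim ![] fun i => map incl (![] i)]
        exact this
      · exact m_eq_zero_of_cocycle f t
      · rw [Subsingleton.elim t ![]]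
        have := congrArg (fun g => (g ![]).b) hy
        rw [Subsingleton.elim ![] fun i => map incl (![] i)]
        exact this
    rw [hf]
    rfl
  · intro y
    obtain ⟨f, rfl⟩ := Submodule.Quotient.mk_surjective _ y
    obtain ⟨g, ha, hb, hm⟩ := exists_cocycle_lift hπι hπι' hπ h' f
      ⟨fun t => congrArg (fun s => (f.1 s).a) (Subsingleton.elim _ _),
        fun t => congrArg (fun s => (f.1 s).b) (Subsingleton.elim _ _)⟩
    refine ⟨Submodule.Quotient.mk g, restrictHH_mk incl proj h _ _ ?_⟩
    ext t
    · rw [Subsingleton.elim t fun i => map 0 (map incl (t i))]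
      exact ha _
    · refine Eq.trans ?_ (m_eq_zero_of_cocycle f t).symm
      exact (congrArg proj (hm (m_eq_zero_of_cocycle f) _)).trans (map_zero proj)
    · rw [Subsingleton.elim t fun i => map 0 (map incl (t i))]
      exact hb _

end Lift

end Tri

/-! ### Matrix components of Ext classes over the copies -/

namespace CategoryTheory.Abelian.Ext

section

variable {C : Type*} [Category C] [Abelian C] [HasExt C] {X X' X'' Y Y' Y'' : C} {k : ℕ}

/-- The class `f x g` for morphisms `f` and `g`. -/
noncomputable def sandwich (f : X' ⟶ X) (g : Y ⟶ Y') (x : Ext X Y k) : Ext X' Y' k :=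
  (mk₀ f).comp (x.comp (mk₀ g) (add_zero k)) (zero_add k)

theorem sandwich_sandwich (f : X' ⟶ X) (g : Y ⟶ Y') (f' : X'' ⟶ X') (g' : Y' ⟶ Y'')
    (x : Ext X Y k) : sandwich f' g' (sandwich f g x) = sandwich (f' ≫ f) (g ≫ g') x := by
  rw [sandwich, sandwich, sandwich, ← mk₀_comp_mk₀, ← mk₀_comp_mk₀, comp_assoc_of_second_deg_zero,
    comp_assoc_of_third_deg_zero, comp_assoc_of_third_deg_zero]

theorem sandwich_id (x : Ext X Y k) : sandwich (𝟙 X) (𝟙 Y) x = x := by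
  simp [sandwich]

theorem sandwich_zero_left (g : Y ⟶ Y') (x : Ext X Y k) : sandwich (0 : X' ⟶ X) g x = 0 := by
  simp [sandwich]

theorem sandwich_zero_right (f : X' ⟶ X) (x : Ext X Y k) : sandwich f (0 : Y ⟶ Y') x = 0 := by
  simp [sandwich]

theorem sandwich_zero (f : X' ⟶ X) (g : Y ⟶ Y') : sandwich f g (0 : Ext X Y k) = 0 := by
  simp [sandwich]

theorem sandwich_sub_left (f f' : X' ⟶ X) (g : Y ⟶ Y') (x : Ext X Y k) :
    sandwich (f - f') g x = sandwich f g x - sandwich f' g x := by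
  simp [sandwich, sub_eq_add_neg, mk₀_add, mk₀_neg]

theorem sandwich_add_right (f : X' ⟶ X) (g g' : Y ⟶ Y') (x : Ext X Y k) :
    sandwich f (g + g') x = sandwich f g x + sandwich f g' x := by
  simp [sandwich, mk₀_add]

theorem sandwich_sum {J : Type*} [Fintype J] (f : X' ⟶ X) (g : Y ⟶ Y') (x : J → Ext X Y k) :
    sandwich f g (∑ j, x j) = ∑ j, sandwich f g (x j) := by
  simp only [sandwich, comp_sum, sum_comp]

theorem sandwich_sum_left {J : Type*} [Fintype J] (f : J → (X' ⟶ X)) (g : Y ⟶ Y') (x : Ext X Y k) :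
    sandwich (∑ j, f j) g x = ∑ j, sandwich (f j) g x := by
  simp only [sandwich, mk₀_sum, sum_comp]

theorem sandwich_sum_right {J : Type*} [Fintype J] (f : X' ⟶ X) (g : J → (Y ⟶ Y')) (x : Ext X Y k) :
    sandwich f (∑ j, g j) x = ∑ j, sandwich f (g j) x := by
  simp only [sandwich, mk₀_sum, comp_sum]

end

end CategoryTheory.Abelian.Ext

open CategoryTheory.Abelian.Ext

section Copies

variable {n : ℕ} {m : Fin n → ℕ}
variable {K A B : Type u} [CommRing K] [Ring A] [Algebra K A] [Ring B] [Algebra K B]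
variable (X : Fin n → Type u) [∀ i, AddCommGroup (X i)] [∀ i, Module (A ⊗[K] Bᵐᵒᵖ) (X i)]

theorem inclOne_projOne_self (i : Fin n) (p : Fin (m i)) :
    inclOne (K := K) (A := A) (B := B) X m i p ≫ projOne X m i p = 𝟙 _ := by
  ext x
  simp [inclOne, projOne]

theorem inclOne_projOne_of_ne_index {i j : Fin n} (h : i ≠ j) (p : Fin (m i)) (q : Fin (m j)) :
    inclOne (K := K) (A := A) (B := B) X m i p ≫ projOne X m j q = 0 := by
  ext x
  simp [inclOne, projOne, h.symm]

theorem inclOne_projOne_of_ne {i : Fin n} {p q : Fin (m i)} (h : p ≠ q) :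
    inclOne (K := K) (A := A) (B := B) X m i p ≫ projOne X m i q = 0 := by
  ext x
  simp [inclOne, projOne, h.symm]

theorem sum_projOne_inclOne :
    ∑ i, ∑ p, projOne (K := K) (A := A) (B := B) X m i p ≫ inclOne X m i p = 𝟙 _ := by
  refine ModuleCat.hom_ext (LinearMap.ext fun x => funext fun j => funext fun q => ?_)
  simp only [ModuleCat.hom_sum, LinearMap.sum_apply, Finset.sum_apply]
  change ∑ i, ∑ p, (Pi.single i (Pi.single p (x i p)) : ∀ i, Fin (m i) → X i) j q = x j q
  rw [Finset.sum_eq_single j, Finset.sum_eq_single q]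
  · simp
  · intro p _ hp
    simp [hp.symm]
  · simp
  · intro i _ hi
    simp [hi.symm]
  · simp

variable {c : ∀ i, Fin (m i)}

variable (c) in
/-- The inclusion of the chosen copies as a morphism. -/
def copyInclHom (K A B : Type u) [CommRing K] [Ring A] [Algebra K A] [Ring B] [Algebra K B]
    (X : Fin n → Type u) [∀ i, AddCommGroup (X i)] [∀ i, Module (A ⊗[K] Bᵐᵒᵖ) (X i)] :
    ModuleCat.of (A ⊗[K] Bᵐᵒᵖ) (∀ i, X i) ⟶
      ModuleCat.of (A ⊗[K] Bᵐᵒᵖ) (∀ i, Fin (m i) → X i) :=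
  ModuleCat.ofHom (copyIncl (A ⊗[K] Bᵐᵒᵖ) X c)

variable (c) in
/-- The projection to the chosen copies as a morphism. -/
def copyProjHom (K A B : Type u) [CommRing K] [Ring A] [Algebra K A] [Ring B] [Algebra K B]
    (X : Fin n → Type u) [∀ i, AddCommGroup (X i)] [∀ i, Module (A ⊗[K] Bᵐᵒᵖ) (X i)] :
    ModuleCat.of (A ⊗[K] Bᵐᵒᵖ) (∀ i, Fin (m i) → X i) ⟶ ModuleCat.of (A ⊗[K] Bᵐᵒᵖ) (∀ i, X i) :=
  ModuleCat.ofHom (copyProj (A ⊗[K] Bᵐᵒᵖ) X c)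

theorem copyInclHom_projOne {i : Fin n} {p : Fin (m i)} (h : p ≠ c i) :
    copyInclHom c K A B X ≫ projOne X m i p = 0 := by
  ext x
  simp [copyInclHom, copyIncl, projOne, h]

theorem inclOne_copyProjHom {i : Fin n} {p : Fin (m i)} (h : p ≠ c i) :
    inclOne X m i p ≫ copyProjHom c K A B X = 0 := by
  refine ModuleCat.hom_ext (LinearMap.ext fun x => funext fun j => ?_)
  change (Pi.single i (Pi.single p x) : ∀ i, Fin (m i) → X i) j (c j) = 0
  by_cases hj : j = i
  · subst hj
    simp [h.symm]
  · simp [hj]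

theorem single_copyInclHom (i : Fin n) :
    ModuleCat.ofHom (LinearMap.single (A ⊗[K] Bᵐᵒᵖ) X i) ≫ copyInclHom c K A B X =
      inclOne X m i (c i) := by
  refine ModuleCat.hom_ext (LinearMap.ext fun x => funext fun j => ?_)
  change Pi.single (c j) ((Pi.single i x : ∀ i, X i) j) =
    (Pi.single i (Pi.single (c i) x) : ∀ i, Fin (m i) → X i) j
  by_cases hj : j = i
  · subst hj
    simp
  · simp [hj]

theorem copyProjHom_proj (i : Fin n) :
    copyProjHom c K A B X ≫ ModuleCat.ofHom (LinearMap.proj i) = projOne X m i (c i) := rfl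

variable (e : ∀ i j, Fin (m i * m j - 1) ≃ OtherPairs c i j) {k : ℕ}

theorem otherExtIncl_apply (x : ∀ i j, Fin (m i * m j - 1) →
      Ext (ModuleCat.of (A ⊗[K] Bᵐᵒᵖ) (X i)) (ModuleCat.of (A ⊗[K] Bᵐᵒᵖ) (X j)) k) :
    otherExtIncl X c e k x = ∑ i, ∑ j, ∑ s,
      sandwich (projOne X m i (e i j s).1.1) (inclOne X m j (e i j s).1.2) (x i j s) := rfl

theorem sandwich_copy_otherExtIncl (x : ∀ i j, Fin (m i * m j - 1) →
      Ext (ModuleCat.of (A ⊗[K] Bᵐᵒᵖ) (X i)) (ModuleCat.of (A ⊗[K] Bᵐᵒᵖ) (X j)) k) :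
    sandwich (copyInclHom c K A B X) (copyProjHom c K A B X) (otherExtIncl X c e k x) = 0 := by
  simp only [otherExtIncl_apply, sandwich_sum, sandwich_sandwich]
  refine Finset.sum_eq_zero fun i _ => Finset.sum_eq_zero fun j _ => Finset.sum_eq_zero fun s _ => ?_
  by_cases h : (e i j s).1.1 = c i
  · have h' : (e i j s).1.2 ≠ c j := fun h' => (e i j s).2 (Prod.ext h h')
    rw [inclOne_copyProjHom X h', sandwich_zero_right]
  · rw [copyInclHom_projOne X h, sandwich_zero_left]

theorem sandwich_chosen_eq_zero
    (x : Ext (ModuleCat.of (A ⊗[K] Bᵐᵒᵖ) (∀ i, Fin (m i) → X i))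
      (ModuleCat.of (A ⊗[K] Bᵐᵒᵖ) (∀ i, Fin (m i) → X i)) k)
    (h : sandwich (copyInclHom c K A B X) (copyProjHom c K A B X) x = 0) (i j : Fin n) :
    sandwich (inclOne X m i (c i)) (projOne X m j (c j)) x = 0 := by
  rw [← single_copyInclHom, ← copyProjHom_proj, ← sandwich_sandwich, h, sandwich_zero]

theorem sandwich_otherExtIncl (x : ∀ i j, Fin (m i * m j - 1) →
      Ext (ModuleCat.of (A ⊗[K] Bᵐᵒᵖ) (X i)) (ModuleCat.of (A ⊗[K] Bᵐᵒᵖ) (X j)) k)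
    (i j : Fin n) (s : Fin (m i * m j - 1)) :
    sandwich (inclOne X m i (e i j s).1.1) (projOne X m j (e i j s).1.2)
      (otherExtIncl X c e k x) = x i j s := by
  simp only [otherExtIncl_apply, sandwich_sum, sandwich_sandwich]
  rw [Finset.sum_eq_single i, Finset.sum_eq_single j, Finset.sum_eq_single s]
  · rw [inclOne_projOne_self, inclOne_projOne_self, sandwich_id]
  · intro s' _ hs
    by_cases h : (e i j s).1.1 = (e i j s').1.1
    · have h' : (e i j s').1.2 ≠ (e i j s).1.2 := fun h' =>
        hs ((e i j).injective (Subtype.ext (Prod.ext h.symm h')))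
      rw [inclOne_projOne_of_ne X h', sandwich_zero_right]
    · rw [inclOne_projOne_of_ne X h, sandwich_zero_left]
  · simp
  · intro j' _ hj
    refine Finset.sum_eq_zero fun s' _ => ?_
    rw [inclOne_projOne_of_ne_index X hj, sandwich_zero_right]
  · simp
  · intro i' _ hi
    refine Finset.sum_eq_zero fun j' _ => Finset.sum_eq_zero fun s' _ => ?_
    rw [inclOne_projOne_of_ne_index X hi.symm, sandwich_zero_left]
  · simp

/-- A class is the sum of its components over all pairs of copies. For each `i` and `j` the
equivalence `e i j` enumerates all pairs but the chosen one, whose component is assumed to vanish.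
-/
theorem mem_range_otherExtIncl
    (x : Ext (ModuleCat.of (A ⊗[K] Bᵐᵒᵖ) (∀ i, Fin (m i) → X i))
      (ModuleCat.of (A ⊗[K] Bᵐᵒᵖ) (∀ i, Fin (m i) → X i)) k)
    (h : ∀ i j, sandwich (inclOne X m i (c i)) (projOne X m j (c j)) x = 0) :
    ∃ y, otherExtIncl X c e k y = x := by
  refine ⟨fun i j s => sandwich (inclOne X m i (e i j s).1.1) (projOne X m j (e i j s).1.2) x, ?_⟩
  conv_rhs => rw [← sandwich_id x, ← sum_projOne_inclOne]
  simp only [otherExtIncl_apply, sandwich_sandwich, sandwich_sum_left]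
  simp only [sandwich_sum_right]
  refine Finset.sum_congr rfl fun i _ => ?_
  rw [Finset.sum_comm]
  refine Finset.sum_congr rfl fun j _ => ?_
  rw [← Fintype.sum_prod_type' (f := fun p q => sandwich (projOne X m i p ≫ inclOne X m i p)
    (projOne X m j q ≫ inclOne X m j q) x)]
  refine Fintype.sum_of_injective (fun s => (e i j s).1)
    (Subtype.val_injective.comp (e i j).injective) _ _ (fun pq hpq => ?_) fun s => rfl
  have hc : pq = (c i, c j) := by
    by_contra hc
    exact hpq ⟨(e i j).symm ⟨pq, hc⟩, by simp⟩
  subst hc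
  have := h i j
  rw [← sandwich_sandwich, this, sandwich_zero]

end Copies

theorem Module.Projective.pi_of_fintype {K : Type*} [CommRing K] {J : Type*} [Fintype J]
    [DecidableEq J] (X : J → Type*) [∀ j, AddCommGroup (X j)] [∀ j, Module K (X j)]
    [∀ j, Module.Projective K (X j)] : Module.Projective K (∀ j, X j) :=
  Module.Projective.of_equiv (DFinsupp.linearEquivFunOnFintype (R := K) (M := X))

/-! ### Exactness and splitting -/

namespace Tri

section

variable {K A M N B : Type u} [CommRing K] [Ring A] [Algebra K A] [Ring B] [Algebra K B]
  [AddCommGroup M] [Module K M] [Module (A ⊗[K] Bᵐᵒᵖ) M] [IsScalarTower K (A ⊗[K] Bᵐᵒᵖ) M]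
  [AddCommGroup N] [Module K N] [Module (A ⊗[K] Bᵐᵒᵖ) N] [IsScalarTower K (A ⊗[K] Bᵐᵒᵖ) N]
  [Module.Projective K A] [Module.Projective K M] [Module.Projective K B]
  [Module.Projective K N]

theorem restrictHH_happelMap {ι : N →ₗ[A ⊗[K] Bᵐᵒᵖ] M} {π : M →ₗ[A ⊗[K] Bᵐᵒᵖ] N}
    (h : ∀ x, π (ι x) = x) {n : ℕ}
    (x : Ext (ModuleCat.of (A ⊗[K] Bᵐᵒᵖ) M) (ModuleCat.of (A ⊗[K] Bᵐᵒᵖ) M) n) :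
    restrictHH ι π h (n + 1) (happelMap K A M B n x) =
      happelMap K A N B n (sandwich (ModuleCat.ofHom ι) (ModuleCat.ofHom π) x) := by
  obtain ⟨z, rfl⟩ := extClass_surjective n x
  have hw : Infl.pull ι (n + 1) (Infl.push π (n + 1) z.1) ∈
      cocycles K (Tri K A N B) (Infl K A N B N) (n + 1) := by
    refine LinearMap.mem_ker.2 ?_
    rw [Infl.delta_pull, Infl.delta_push, LinearMap.mem_ker.1 z.2, map_zero, map_zero]
  rw [sandwich, ← extClass_pull_push ι π z ⟨_, hw⟩ rfl, happelMap_extClass, happelMap_extClass]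
  exact restrictHH_mk ι π h _ _ (restrictCochain_upper ι π z.1)

end

end Tri

section Splitting

variable {n : ℕ} {m : Fin n → ℕ} {K A B : Type u} [CommRing K] [Ring A] [Algebra K A] [Ring B]
  [Algebra K B] [Module.Projective K A] [Module.Projective K B]
  (X : Fin n → Type u) [∀ i, AddCommGroup (X i)] [∀ i, Module K (X i)]
  [∀ i, Module (A ⊗[K] Bᵐᵒᵖ) (X i)] [∀ i, IsScalarTower K (A ⊗[K] Bᵐᵒᵖ) (X i)]
  [∀ i, Module.Projective K (X i)] [Module.Projective K (∀ i, Fin (m i) → X i)]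
  {c : ∀ i, Fin (m i)} (k : ℕ)

theorem exists_sandwich_linear {N₁ N₂ : Type u} [AddCommGroup N₁] [Module K N₁]
    [Module (A ⊗[K] Bᵐᵒᵖ) N₁] [IsScalarTower K (A ⊗[K] Bᵐᵒᵖ) N₁] [Module.Projective K N₁]
    [AddCommGroup N₂] [Module (A ⊗[K] Bᵐᵒᵖ) N₂] {M : Type u} [AddCommGroup M] [Module K M]
    [Module (A ⊗[K] Bᵐᵒᵖ) M] [IsScalarTower K (A ⊗[K] Bᵐᵒᵖ) M] [Module.Projective K M]
    (f : ModuleCat.of (A ⊗[K] Bᵐᵒᵖ) N₁ ⟶ ModuleCat.of (A ⊗[K] Bᵐᵒᵖ) M)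
    (g : ModuleCat.of (A ⊗[K] Bᵐᵒᵖ) M ⟶ ModuleCat.of (A ⊗[K] Bᵐᵒᵖ) N₂) (h : f ≫ g = 0) :
    ∃ ρ : HH K (Tri K A M B) (k + 1) →ₗ[K]
        Ext (ModuleCat.of (A ⊗[K] Bᵐᵒᵖ) N₁) (ModuleCat.of (A ⊗[K] Bᵐᵒᵖ) N₂) k,
      ∀ x, ρ (Tri.happelMap K A M B k x) = sandwich f g x :=
  have h' : ∀ x, g.hom (f.hom x) = 0 := fun x => congrArg (fun φ => φ.hom x) h
  ⟨Tri.cornerHH f.hom g.hom h' k, Tri.cornerHH_happelMap f.hom g.hom h' k⟩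

/-- For different copies the inclusion followed by the projection is zero and
`exists_sandwich_linear` applies. For `(p, p)` with `p ≠ c i` it is the identity, and the component
is reached through the chosen copy. -/
theorem exists_component_linear (i j : Fin n) (p : Fin (m i)) (q : Fin (m j))
    (hpq : (p, q) ≠ (c i, c j)) :
    ∃ ρ : HH K (Tri K A (∀ i, Fin (m i) → X i) B) (k + 1) →ₗ[K]
        Ext (ModuleCat.of (A ⊗[K] Bᵐᵒᵖ) (X i)) (ModuleCat.of (A ⊗[K] Bᵐᵒᵖ) (X j)) k,
      ∀ x, sandwich (inclOne X m i (c i)) (projOne X m i (c i)) x = 0 →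
        ρ (Tri.happelMap K A _ B k x) = sandwich (inclOne X m i p) (projOne X m j q) x := by
  by_cases hij : i = j
  · subst hij
    by_cases hpq' : p = q
    · subst hpq'
      have hp : p ≠ c i := fun hp => hpq (by rw [hp])
      -- The composite is `1 - 1 = 0`. Writing `x_{pq}` for the component from `p` to `q`, this map
      -- gives `x_{pp} + x_{pc} - x_{cp} - x_{cc}`; `ρ₂` and `ρ₃` give `x_{pc}` and `x_{cp}`, and
      -- `x_{cc} = 0` by assumption.
      obtain ⟨ρ₁, h₁⟩ := exists_sandwich_linear (K := K) k
        (inclOne (K := K) (A := A) (B := B) X m i p - inclOne X m i (c i))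
        (projOne X m i p + projOne X m i (c i)) (by
          rw [Preadditive.sub_comp, Preadditive.comp_add, Preadditive.comp_add,
            inclOne_projOne_self, inclOne_projOne_self, inclOne_projOne_of_ne X hp,
            inclOne_projOne_of_ne X hp.symm, add_zero, zero_add, sub_self])
      obtain ⟨ρ₂, h₂⟩ := exists_sandwich_linear (K := K) k
        (inclOne (K := K) (A := A) (B := B) X m i p) (projOne X m i (c i)) (inclOne_projOne_of_ne X hp)
      obtain ⟨ρ₃, h₃⟩ := exists_sandwich_linear (K := K) k
        (inclOne (K := K) (A := A) (B := B) X m i (c i)) (projOne X m i p) (inclOne_projOne_of_ne X hp.symm)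
      refine ⟨ρ₁ - ρ₂ + ρ₃, fun x hx => ?_⟩
      rw [LinearMap.add_apply, LinearMap.sub_apply, h₁, h₂, h₃, sandwich_sub_left,
        sandwich_add_right, sandwich_add_right, hx]
      abel
    · obtain ⟨ρ, hρ⟩ := exists_sandwich_linear (K := K) k
        (inclOne (K := K) (A := A) (B := B) X m i p) (projOne X m i q) (inclOne_projOne_of_ne X hpq')
      exact ⟨ρ, fun x _ => hρ x⟩
  · obtain ⟨ρ, hρ⟩ := exists_sandwich_linear (K := K) k
      (inclOne (K := K) (A := A) (B := B) X m i p) (projOne X m j q) (inclOne_projOne_of_ne_index X hij p q)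
    exact ⟨ρ, fun x _ => hρ x⟩

theorem exists_retraction (e : ∀ i j, Fin (m i * m j - 1) ≃ OtherPairs c i j)
    [Module.Projective K (∀ i, X i)] :
    ∃ ρ : HH K (Tri K A (∀ i, Fin (m i) → X i) B) (k + 1) →ₗ[K]
        (∀ i j, Fin (m i * m j - 1) →
          Ext (ModuleCat.of (A ⊗[K] Bᵐᵒᵖ) (X i)) (ModuleCat.of (A ⊗[K] Bᵐᵒᵖ) (X j)) k),
      ρ ∘ₗ (Tri.happelMap K A _ B k ∘ₗ otherExtIncl X c e k) = LinearMap.id := by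
  choose ρ hρ using fun i j s =>
    exists_component_linear (K := K) (A := A) (B := B) X k i j _ _ (e i j s).2
  refine ⟨LinearMap.pi fun i => LinearMap.pi fun j => LinearMap.pi fun s => ρ i j s,
    LinearMap.ext fun x => funext fun i => funext fun j => funext fun s => ?_⟩
  refine (hρ i j s _ ?_).trans (sandwich_otherExtIncl X e x i j s)
  exact sandwich_chosen_eq_zero X _ (sandwich_copy_otherExtIncl X e x) i i

theorem exact_happelMap_otherExtIncl (e : ∀ i j, Fin (m i * m j - 1) ≃ OtherPairs c i j)
    [Module.Projective K (∀ i, X i)] :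
    Function.Exact (Tri.happelMap K A _ B k ∘ₗ otherExtIncl X c e k)
      (copyRestrictHH K A B X c (k + 1)) := by
  intro y
  constructor
  · intro hy
    obtain ⟨x, rfl, hx⟩ := Tri.exists_happelMap_eq _ y hy
    obtain ⟨w, rfl⟩ := mem_range_otherExtIncl X e x fun i j => sandwich_chosen_eq_zero X x hx i j
    exact ⟨w, rfl⟩
  · rintro ⟨w, rfl⟩
    refine (Tri.restrictHH_happelMap _ _).trans ?_
    exact (congrArg (Tri.happelMap K A _ B k) (sandwich_copy_otherExtIncl X e w)).trans
      (map_zero _)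

end Splitting

/-! ### Surjectivity for the decomposition into copies -/

section Surjectivity

variable {n : ℕ} {m : Fin n → ℕ} {K A B : Type u} [CommRing K] [Ring A] [Algebra K A] [Ring B]
  [Algebra K B]
  (X : Fin n → Type u) [∀ i, AddCommGroup (X i)] [∀ i, Module K (X i)]
  [∀ i, Module (A ⊗[K] Bᵐᵒᵖ) (X i)] [∀ i, IsScalarTower K (A ⊗[K] Bᵐᵒᵖ) (X i)]
  (c : ∀ i, Fin (m i))

theorem projOne_inclOne_self_apply (j : Σ i, Fin (m i)) (x : X j.1) :
    (projOne (K := K) (A := A) (B := B) X m j.1 j.2).hom ((inclOne X m j.1 j.2).hom x) = x :=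
  LinearMap.congr_fun (congrArg ModuleCat.Hom.hom
    (inclOne_projOne_self (K := K) (A := A) (B := B) X j.1 j.2)) x

theorem projOne_inclOne_of_ne_apply (j l : Σ i, Fin (m i)) (h : j ≠ l) (x : X l.1) :
    (projOne (K := K) (A := A) (B := B) X m j.1 j.2).hom ((inclOne X m l.1 l.2).hom x) = 0 := by
  obtain ⟨i, p⟩ := j
  obtain ⟨i', q⟩ := l
  by_cases hi : i' = i
  · subst hi
    have hpq : q ≠ p := fun hpq => h (by rw [hpq])
    exact LinearMap.congr_fun (congrArg ModuleCat.Hom.hom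
      (inclOne_projOne_of_ne (K := K) (A := A) (B := B) X hpq)) x
  · exact LinearMap.congr_fun (congrArg ModuleCat.Hom.hom
      (inclOne_projOne_of_ne_index (K := K) (A := A) (B := B) X hi q p)) x

theorem copyRestrictHH_zero_bijective : Function.Bijective (copyRestrictHH K A B X c 0) :=
  -- The pieces of `M` are the copies `(i, p)`; each is a retract of `M'` through the summand `X i`,
  -- whether or not `p` is the chosen copy.
  Tri.restrictHH_zero_bijective (J := Σ i, Fin (m i)) (Y := fun j => X j.1)
    (ι := fun j => (inclOne X m j.1 j.2).hom) (π := fun j => (projOne X m j.1 j.2).hom)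
    (ι' := fun j => LinearMap.single (A ⊗[K] Bᵐᵒᵖ) X j.1) (π' := fun j => LinearMap.proj j.1)
    (projOne_inclOne_self_apply X) (projOne_inclOne_of_ne_apply X)
    (fun x hx => funext fun i => funext fun p => hx ⟨i, p⟩) (fun j x => by simp) _

theorem copyRestrictHH_succ_surjective (k : ℕ) :
    Function.Surjective (copyRestrictHH K A B X c (k + 1)) :=
  Tri.restrictHH_succ_surjective (J := Σ i, Fin (m i)) (Y := fun j => X j.1)
    (ι := fun j => (inclOne X m j.1 j.2).hom) (π := fun j => (projOne X m j.1 j.2).hom)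
    (ι' := fun j => LinearMap.single (A ⊗[K] Bᵐᵒᵖ) X j.1) (π' := fun j => LinearMap.proj j.1)
    (projOne_inclOne_self_apply X) (projOne_inclOne_of_ne_apply X)
    (fun x hx => funext fun i => funext fun p => hx ⟨i, p⟩) (fun j x => by simp) _ k

end Surjectivity

theorem mainTheorem1 {K A B : Type u} [CommRing K] [Ring A] [Algebra K A] [Ring B] [Algebra K B]
    [Module.Projective K A] [Module.Projective K B]
    {n : ℕ} (X : Fin n → Type u) [∀ i, AddCommGroup (X i)] [∀ i, Module K (X i)]
    [∀ i, Module (A ⊗[K] Bᵐᵒᵖ) (X i)] [∀ i, IsScalarTower K (A ⊗[K] Bᵐᵒᵖ) (X i)]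
    [∀ i, Module.Projective K (X i)]
    (m : Fin n → ℕ) (hm : ∀ i, 1 ≤ m i)
    (c : ∀ i, Fin (m i)) (e : ∀ i j, Fin (m i * m j - 1) ≃ OtherPairs c i j) :
    Function.Bijective (copyRestrictHH K A B X c 0) ∧
    ∀ k : ℕ, ∃ l : Ext (ModuleCat.of (A ⊗[K] Bᵐᵒᵖ) (∀ i, Fin (m i) → X i))
          (ModuleCat.of (A ⊗[K] Bᵐᵒᵖ) (∀ i, Fin (m i) → X i)) k →ₗ[K]
        Hochschild.HH K (Tri K A (∀ i, Fin (m i) → X i) B) (k + 1),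
      (∀ x, IsHappelImage k x (l x)) ∧
      Function.Injective (l ∘ₗ otherExtIncl X c e k) ∧
      Function.Exact (l ∘ₗ otherExtIncl X c e k) (copyRestrictHH K A B X c (k + 1)) ∧
      ∃ s : Hochschild.HH K (Tri K A (∀ i, X i) B) (k + 1) →ₗ[K]
          Hochschild.HH K (Tri K A (∀ i, Fin (m i) → X i) B) (k + 1),
        copyRestrictHH K A B X c (k + 1) ∘ₗ s = LinearMap.id := by
  have h₁ : Module.Projective K (∀ i, X i) := Module.Projective.pi_of_fintype X
  have h₂ : ∀ i, Module.Projective K (Fin (m i) → X i) := fun i =>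
    Module.Projective.pi_of_fintype fun _ => X i
  have h₃ : Module.Projective K (∀ i, Fin (m i) → X i) :=
    Module.Projective.pi_of_fintype fun i => Fin (m i) → X i
  refine ⟨copyRestrictHH_zero_bijective X c, fun k =>
    ⟨Tri.happelMap K A _ B k, Tri.isHappelImage_happelMap k, ?_⟩⟩
  have hexact := exact_happelMap_otherExtIncl (K := K) (A := A) (B := B) X k e
  -- For an exact pair, injectivity with a section on the right is equivalent to surjectivity with a
  -- retraction on the left. The latter form is what was constructed: surjectivity chooses
  -- representatives and supplies no linear section by itself.
  have hsplit : (Function.Injective (Tri.happelMap K A _ B k ∘ₗ otherExtIncl X c e k) ∧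
      ∃ s, copyRestrictHH K A B X c (k + 1) ∘ₗ s = LinearMap.id) ↔
      (Function.Surjective (copyRestrictHH K A B X c (k + 1)) ∧
      ∃ ρ, ρ ∘ₗ (Tri.happelMap K A _ B k ∘ₗ otherExtIncl X c e k) = LinearMap.id) :=
    hexact.split_tfae'.out 0 1
  obtain ⟨hinj, hs⟩ := hsplit.2
    ⟨copyRestrictHH_succ_surjective X c k, exists_retraction X k e⟩
  exact ⟨hinj, hexact, hs⟩
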